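/- Let $d\ge 2$, $\hat f(\xi)=\int_{\mathbb{R}^d}f(x)e^{-2\pi i x\cdot\xi}\,dx$, and let $\mathcal S,\mathcal S'$ be the Schwartz functions and the tempered distributions on $\mathbb{R}^d$. **Classical spaces.** Let $\Phi,\varphi\in\mathcal S$ satisfy $\operatorname{supp}\hat\varphi\subseteq\{1/2\le|\xi|\le 2\}$, $\operatorname{supp}\hat\Phi\subseteq\{|\xi|\le 2\}$, $|\hat\varphi(\xi)|\ge c>0$ for $3/5\le|\xi|\le 5/3$ and $|\hat\Phi(\xi)|\ge c>0$ for $|\xi|\le 5/3$. With $\varphi_{2^\nu I}(x)=2^{d\nu}\varphi(2^\nu x)$, the space $\mathbf B^{\alpha,q}_p$ consists of the $f\in\mathcal S'$ with $$\|f\|_{\mathbf B^{\alpha,q}_p}=\|\Phi*f\|_{L^p}+\Big(\sum_{\nu\ge 0}\big(2^{\nu\alpha}\|\varphi_{2^\nu I}*f\|_{L^p}\big)^q\Big)^{1/q}<\infty .$$ **Shear anisotropic spaces.** Let $\hat\psi_1,\hat\psi_2\in C^\infty(\mathbb{R})$ with $\operatorname{supp}\hat\psi_1\subset[-\frac12,-\frac1{16}]\cup[\frac1{16},\frac12]$,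 $\operatorname{supp}\hat\psi_2\subset[-1,1]$, $\sum_{j\ge 0}|\hat\psi_1(2^{-2j}\omega)|^2=1$ for $|\omega|\ge\frac18$, and $|\hat\psi_2(\omega-1)|^2+|\hat\psi_2(\omega)|^2+|\hat\psi_2(\omega+1)|^2=1$ for $|\omega|\le 1$. Let $\Psi\in\mathcal S$ with $\operatorname{supp}\hat\Psi\subset[-\frac14,\frac14]^d$ and $|\hat\Psi|=1$ on $[-\frac18,\frac18]^d$. For $i=1,\dots,d$ let $\hat\psi^{(i)}(\xi)=\hat\psi_1(\xi_i)\prod_{k\ne i}\hat\psi_2(\xi_k/\xi_i)$ (and $\hat\psi^{(i)}(\xi)=0$ if $\xi_i=0$), let $A_{(i)}$ be the diagonal matrix with entry $4$ in position $i$ and $2$ elsewhere, and for $\ell=(\ell_k)_{k\ne i}\in\mathbb{Z}^{d-1}$ let $B^{[\ell]}_{(i)}$ be the identity matrix with the entries $\ell_k$ inserted in the off-diagonal positions $(i,k)$, $k\neq i$. For an invertible matrix $M$ write $\psi_M(x)=|\det M|^{-1}\psi(M^{-1}x)$; write $B^{-[\ell]}$ for $(B^{[\ell]})^{-1}$, and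 $|Q_j|=2^{-(d+1)j}$. The space $\mathbf B^{\alpha,q}_p(AB)$ consists of the $f\in\mathcal S'$ with $$\|f\|_{\mathbf B^{\alpha,q}_p(AB)}=\|f*\Psi\|_{L^p}+\Big(\sum_{i=1}^d\sum_{j\ge 0}\ \sum_{|\ell_k|\le 2^j\ \forall k}\Big[|Q_j|^{-\alpha}\big\|f*\psi^{(i)}_{A_{(i)}^{-j}B_{(i)}^{-[\ell]}}\big\|_{L^p}\Big]^q\Big)^{1/q}<\infty .$$ In both norms the $\ell^q$ sum is a supremum when $q=\infty$. **Theorem.** Let $0<p,q\le\infty$, $\alpha_1,\alpha_2\in\mathbb{R}$ and $s=\frac12\big[\max(1,1/p)-\min(1,1/q)\big]$. Let $\lambda=0$ if $0<p\le 1$, and let $\lambda>d(p-1)/p$ if $1<p\le\infty$ (that is, $\lambda>d$ if $p=\infty$). If $$2d+\lambda+2\big(\alpha_1+s(d-1)\big)<(d+1)(\alpha_2+1),$$ then $\mathbf B^{\alpha_2,q}_p(AB)\hookrightarrow\mathbf B^{\alpha_1,q}_p$: that is, $\mathbf B^{\alpha_2,q}_p(AB)\subseteq\mathbf B^{\alpha_1,q}_p$,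 and there is a constant $C>0$ such that $\|f\|_{\mathbf B^{\alpha_1,q}_p}\le C\,\|f\|_{\mathbf B^{\alpha_2,q}_p(AB)}$ for all $f\in\mathbf B^{\alpha_2,q}_p(AB)$. -/

import Mathlib

open scoped SchwartzMap FourierTransform ENNReal

namespace ShearBesov

noncomputable section

/-- `ℝ^d` with its Euclidean norm. -/
abbrev Rd (d : ℕ) : Type := EuclideanSpace ℝ (Fin d)

/-! ### Convolution and dilations -/

/-- The convolution `(f ∗ g)(x) = ⟨f, g(x - ·)⟩` of a tempered distribution with a Schwartz
function, as a function on `ℝ^d`. -/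
def conv {d : ℕ} (f : 𝓢'(Rd d, ℂ)) (g : 𝓢(Rd d, ℂ)) (x : Rd d) : ℂ :=
  f (SchwartzMap.compSubConstCLM ℂ x
    (SchwartzMap.compCLMOfContinuousLinearEquiv ℂ (ContinuousLinearEquiv.neg ℝ) g))

/-- The action `x ↦ M x` of an invertible matrix on `ℝ^d`. -/
def glEquiv {d : ℕ} (M : GL (Fin d) ℝ) : Rd d ≃L[ℝ] Rd d :=
  (LinearEquiv.ofLinearMap (Matrix.toEuclideanLin (M : Matrix (Fin d) (Fin d) ℝ))
    (Matrix.toEuclideanLin ((M⁻¹ : GL (Fin d) ℝ) : Matrix (Fin d) (Fin d) ℝ))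
    (by
      ext x i
      simp [Matrix.toLpLin_apply, Matrix.mulVec_mulVec])
    (by
      ext x i
      simp [Matrix.toLpLin_apply, Matrix.mulVec_mulVec])).toContinuousLinearEquiv

/-- The anisotropic dilation `g_M(x) = |det M|⁻¹ g(M⁻¹ x)`. -/
def matrixDilate {d : ℕ} (M : GL (Fin d) ℝ) (g : 𝓢(Rd d, ℂ)) : 𝓢(Rd d, ℂ) :=
  ((|(M : Matrix (Fin d) (Fin d) ℝ).det|⁻¹ : ℝ) : ℂ) •
    SchwartzMap.compCLMOfContinuousLinearEquiv ℂ (glEquiv M⁻¹) g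

/-- The dyadic dilation `x ↦ 2^{dν} g(2^ν x)`. -/
def dyadicDilate {d : ℕ} (ν : ℕ) (g : 𝓢(Rd d, ℂ)) : 𝓢(Rd d, ℂ) :=
  ((2 : ℂ) ^ (d * ν)) •
    SchwartzMap.compCLMOfContinuousLinearEquiv ℂ
      (ContinuousLinearEquiv.smulLeft (Units.mk0 ((2 : ℝ) ^ ν) (by positivity))) g

/-- The `ℓ^q` quasi-norm of a family of extended nonnegative numbers, `0 < q ≤ ∞`
(the supremum when `q = ∞`). -/
def lqNorm {ι : Type} (q : ℝ≥0∞) (a : ι → ℝ≥0∞) : ℝ≥0∞ :=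
  if q = ∞ then ⨆ i, a i else (∑' i, a i ^ q.toReal) ^ (q.toReal)⁻¹

/-! ### Classical inhomogeneous Besov spaces -/

/-- Admissible pairs `(Φ, φ)` of Schwartz functions defining the classical inhomogeneous Besov
spaces. -/
structure IsDyadicPair {d : ℕ} (Φ φ : 𝓢(Rd d, ℂ)) : Prop where
  support_phi : tsupport (𝓕 φ : 𝓢(Rd d, ℂ)) ⊆ {ξ | 1 / 2 ≤ ‖ξ‖ ∧ ‖ξ‖ ≤ 2}
  support_Phi : tsupport (𝓕 Φ : 𝓢(Rd d, ℂ)) ⊆ {ξ | ‖ξ‖ ≤ 2}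
  lower_phi : ∃ c : ℝ, 0 < c ∧ ∀ ξ : Rd d, 3 / 5 ≤ ‖ξ‖ → ‖ξ‖ ≤ 5 / 3 →
    c ≤ ‖(𝓕 φ : 𝓢(Rd d, ℂ)) ξ‖
  lower_Phi : ∃ c : ℝ, 0 < c ∧ ∀ ξ : Rd d, ‖ξ‖ ≤ 5 / 3 → c ≤ ‖(𝓕 Φ : 𝓢(Rd d, ℂ)) ξ‖

/-- The quasi-norm of the classical space `B^{α,q}_p`:
`‖Φ ∗ f‖_{L^p} + (∑_{ν ≥ 0} (2^{να} ‖φ_ν ∗ f‖_{L^p})^q)^{1/q}`, with value `∞` off the space. -/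
def besovNorm {d : ℕ} (Φ φ : 𝓢(Rd d, ℂ)) (α : ℝ) (p q : ℝ≥0∞) (f : 𝓢'(Rd d, ℂ)) : ℝ≥0∞ :=
  MeasureTheory.eLpNorm (conv f Φ) p MeasureTheory.volume +
    lqNorm q (fun ν : ℕ => ENNReal.ofReal ((2 : ℝ) ^ ((ν : ℝ) * α)) *
      MeasureTheory.eLpNorm (conv f (dyadicDilate ν φ)) p MeasureTheory.volume)

/-- The classical inhomogeneous Besov space `B^{α,q}_p`. -/
def besovSpace {d : ℕ} (Φ φ : 𝓢(Rd d, ℂ)) (α : ℝ) (p q : ℝ≥0∞) : Set (𝓢'(Rd d, ℂ)) :=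
  {f | besovNorm Φ φ α p q f < ∞}

/-! ### Dilation and shear matrices -/

/-- The diagonal matrix `A_{(i)}`, with entry `4` in position `i` and `2` in the others. -/
def dilationMatrix {d : ℕ} (i : Fin d) : GL (Fin d) ℝ where
  val := Matrix.diagonal fun k => if k = i then 4 else 2
  inv := Matrix.diagonal fun k => if k = i then 4⁻¹ else 2⁻¹
  val_inv := by
    rw [Matrix.diagonal_mul_diagonal, ← Matrix.diagonal_one]
    congr 1
    funext k
    split_ifs <;> norm_num
  inv_val := by
    rw [Matrix.diagonal_mul_diagonal, ← Matrix.diagonal_one]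
    congr 1
    funext k
    split_ifs <;> norm_num

/-- The matrix whose `i`-th row carries the shear parameters off the diagonal and whose other
entries vanish. -/
def shearPart {d : ℕ} (i : Fin d) (l : {k : Fin d // k ≠ i} → ℤ) :
    Matrix (Fin d) (Fin d) ℝ :=
  Matrix.of fun r k => if h : r = i ∧ k ≠ i then (l ⟨k, h.2⟩ : ℝ) else 0

theorem shearPart_mul {d : ℕ} (i : Fin d) (l l' : {k : Fin d // k ≠ i} → ℤ) :
    shearPart i l * shearPart i l' = 0 := by
  ext r k
  simp only [Matrix.mul_apply, Matrix.zero_apply]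
  refine Finset.sum_eq_zero fun m _ => ?_
  by_cases hm : m = i <;> simp [shearPart, hm]

theorem shearPart_neg {d : ℕ} (i : Fin d) (l : {k : Fin d // k ≠ i} → ℤ) :
    shearPart i (-l) = -shearPart i l := by
  ext r k
  simp only [shearPart, Matrix.of_apply, Matrix.neg_apply]
  split_ifs <;> simp

/-- The shear matrix `B_{(i)}^{[ℓ]}`: the identity with the parameters `ℓ` added to the
off-diagonal entries of row `i`. -/
def shearMatrix {d : ℕ} (i : Fin d) (l : {k : Fin d // k ≠ i} → ℤ) : GL (Fin d) ℝ where
  val := 1 + shearPart i l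
  inv := 1 + shearPart i (-l)
  val_inv := by
    rw [shearPart_neg, add_mul, mul_add, mul_add, mul_neg (shearPart i l), shearPart_mul]
    simp
  inv_val := by
    rw [shearPart_neg, add_mul, mul_add, mul_add, neg_mul _ (shearPart i l), shearPart_mul]
    simp

/-! ### Shearlet generators -/

/-- The generators of a system of shearlets on the cones: univariate profiles `ψ̂₁`, `ψ̂₂` and a
low-frequency function `Ψ`.  Away from the (null) boundaries of the cones `D^{(i)}` and of the
cube `R = [-1/8, 1/8]^d`, these conditions give the Parseval frame identity
`|Ψ̂(ξ)|² χ_R(ξ) + ∑_i ∑_j ∑_ℓ |ψ̂^{(i)}(ξ A_{(i)}^{-j} B_{(i)}^{[-ℓ]})|² χ_{D^{(i)}}(ξ) = 1`. -/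
structure ShearletGenerator (d : ℕ) where
  /-- the profile `ψ̂₁` in the radial variable -/
  psi1 : ℝ → ℂ
  /-- the profile `ψ̂₂` in the slope variables -/
  psi2 : ℝ → ℂ
  /-- the low-frequency function `Ψ` -/
  Psi : 𝓢(Rd d, ℂ)
  contDiff_psi1 : ContDiff ℝ (⊤ : ℕ∞) psi1
  contDiff_psi2 : ContDiff ℝ (⊤ : ℕ∞) psi2
  support_psi1 : tsupport psi1 ⊆ Set.Icc (-(1 / 2)) (-(1 / 16)) ∪ Set.Icc (1 / 16) (1 / 2)
  support_psi2 : tsupport psi2 ⊆ Set.Icc (-1) 1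
  sum_psi1 : ∀ ω : ℝ, 1 / 8 ≤ |ω| → HasSum (fun j : ℕ => ‖psi1 (ω / 2 ^ (2 * j))‖ ^ 2) 1
  sum_psi2 : ∀ ω : ℝ, |ω| ≤ 1 →
    ‖psi2 (ω - 1)‖ ^ 2 + ‖psi2 ω‖ ^ 2 + ‖psi2 (ω + 1)‖ ^ 2 = 1
  support_Psi : tsupport (𝓕 Psi : 𝓢(Rd d, ℂ)) ⊆ {ξ | ∀ i, |ξ i| ≤ 1 / 4}
  norm_Psi : ∀ ξ : Rd d, (∀ i, |ξ i| ≤ 1 / 8) → ‖(𝓕 Psi : 𝓢(Rd d, ℂ)) ξ‖ = 1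

variable {d : ℕ}

/-- `ψ̂^{(i)}(ξ) = ψ̂₁(ξ_i) ∏_{k ≠ i} ψ̂₂(ξ_k / ξ_i)`. -/
def ShearletGenerator.psiHat (G : ShearletGenerator d) (i : Fin d) (ξ : Rd d) : ℂ :=
  G.psi1 (ξ i) * ∏ k ∈ Finset.univ.erase i, G.psi2 (ξ k / ξ i)

theorem ShearletGenerator.psi1_eq_zero (G : ShearletGenerator d) {t : ℝ}
    (ht : |t| < 1 / 16 ∨ 1 / 2 < |t|) : G.psi1 t = 0 := by
  by_contra h
  have h1 := G.support_psi1 (subset_tsupport _ h)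
  simp only [Set.mem_union, Set.mem_Icc] at h1
  rcases h1 with h1 | h1
  · rw [abs_of_neg (by linarith)] at ht
    rcases ht with ht | ht <;> linarith
  · rw [abs_of_pos (by linarith)] at ht
    rcases ht with ht | ht <;> linarith

theorem ShearletGenerator.psi2_eq_zero (G : ShearletGenerator d) {t : ℝ}
    (ht : 1 < |t|) : G.psi2 t = 0 := by
  by_contra h
  have h1 := G.support_psi2 (subset_tsupport _ h)
  exact absurd (abs_le.2 h1) (not_le.2 ht)

theorem ShearletGenerator.contDiff_psiHat (G : ShearletGenerator d) (i : Fin d) :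
    ContDiff ℝ (⊤ : ℕ∞) (G.psiHat i) := by
  have hc : ∀ k : Fin d, ContDiff ℝ (⊤ : ℕ∞) (fun ξ : Rd d => ξ k) := fun k => by fun_prop
  rw [contDiff_iff_contDiffAt]
  intro ξ
  by_cases h : ξ i = 0
  · have h0 : G.psiHat i =ᶠ[nhds ξ] fun _ => 0 := by
      have h1 : {η : Rd d | |η i| < 1 / 16} ∈ nhds ξ := by
        refine IsOpen.mem_nhds ?_ (by simp [h])
        exact isOpen_lt ((hc i).continuous.abs) continuous_const
      filter_upwards [h1] with η hη
      simp [ShearletGenerator.psiHat, G.psi1_eq_zero (Or.inl hη)]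
    exact contDiffAt_const.congr_of_eventuallyEq h0
  · unfold ShearletGenerator.psiHat
    refine ContDiffAt.mul ?_ ?_
    · exact (G.contDiff_psi1.comp (hc i)).contDiffAt
    · refine contDiffAt_prod fun k _ => ?_
      exact G.contDiff_psi2.contDiffAt.comp ξ ((hc k).contDiffAt.div (hc i).contDiffAt h)

theorem ShearletGenerator.hasCompactSupport_psiHat (G : ShearletGenerator d) (i : Fin d) :
    HasCompactSupport (G.psiHat i) := by
  refine HasCompactSupport.of_support_subset_isCompact
    (isCompact_closedBall (0 : Rd d) (Real.sqrt (∑ _k : Fin d, (1 / 2 : ℝ) ^ 2))) ?_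
  intro ξ hξ
  have h1 : |ξ i| ≤ 1 / 2 := by
    by_contra h
    exact hξ (by simp [ShearletGenerator.psiHat, G.psi1_eq_zero (Or.inr (not_le.1 h))])
  have h2 : 0 < |ξ i| := by
    by_contra h
    exact hξ (by
      simp [ShearletGenerator.psiHat,
        G.psi1_eq_zero (t := ξ i) (Or.inl (lt_of_le_of_lt (not_lt.1 h) (by norm_num)))])
  have h3 : ∀ k, |ξ k| ≤ 1 / 2 := by
    intro k
    by_cases hk : k = i
    · rw [hk]; exact h1
    · by_contra h
      refine hξ ?_
      have h4 : 1 < |ξ k / ξ i| := by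
        rw [abs_div, one_lt_div h2]
        exact lt_of_le_of_lt h1 (not_le.1 h)
      have h5 : ∏ m ∈ Finset.univ.erase i, G.psi2 (ξ m / ξ i) = 0 :=
        Finset.prod_eq_zero (i := k) (by simp [hk]) (G.psi2_eq_zero h4)
      simp [ShearletGenerator.psiHat, h5]
  rw [mem_closedBall_zero_iff, EuclideanSpace.norm_eq]
  refine Real.sqrt_le_sqrt (Finset.sum_le_sum fun k _ => ?_)
  exact pow_le_pow_left₀ (norm_nonneg _) (h3 k) 2

/-- The shearlet `ψ^{(i)}`, the Schwartz function with Fourier transform `ψ̂^{(i)}`. -/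
def ShearletGenerator.psi (G : ShearletGenerator d) (i : Fin d) : 𝓢(Rd d, ℂ) :=
  𝓕⁻ ((G.hasCompactSupport_psiHat i).toSchwartzMap (G.contDiff_psiHat i))

/-! ### Shear anisotropic inhomogeneous Besov spaces -/

/-- The indices `(i, j, ℓ)`: a direction, a scale `j ≥ 0`, and shear parameters with
`|ℓ_k| ≤ 2^j` for all `k`. -/
abbrev ShearIndex (d : ℕ) : Type :=
  Σ i : Fin d, Σ j : ℕ, {l : {k : Fin d // k ≠ i} → ℤ // ∀ k, |l k| ≤ 2 ^ j}

/-- `ψ^{(i)}_{A_{(i)}^{-j} B_{(i)}^{-[ℓ]}}`. -/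
def ShearletGenerator.psiDilated (G : ShearletGenerator d) (I : ShearIndex d) : 𝓢(Rd d, ℂ) :=
  matrixDilate ((dilationMatrix I.1 ^ I.2.1)⁻¹ * (shearMatrix I.1 I.2.2.1)⁻¹) (G.psi I.1)

/-- The quasi-norm of `B^{α,q}_p(AB)`:
`‖f ∗ Ψ‖_{L^p} + (∑_{i,j,ℓ} (|Q_j|^{-α} ‖f ∗ ψ^{(i)}_{A^{-j} B^{-[ℓ]}}‖_{L^p})^q)^{1/q}`, where
`|Q_j| = 2^{-(d+1)j}`, with value `∞` off the space. -/
def shearBesovNorm (G : ShearletGenerator d) (α : ℝ) (p q : ℝ≥0∞) (f : 𝓢'(Rd d, ℂ)) : ℝ≥0∞ :=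
  MeasureTheory.eLpNorm (conv f G.Psi) p MeasureTheory.volume +
    lqNorm q (fun I : ShearIndex d =>
      ENNReal.ofReal (((2 : ℝ) ^ (-(((d : ℝ) + 1) * (I.2.1 : ℝ)))) ^ (-α)) *
        MeasureTheory.eLpNorm (conv f (G.psiDilated I)) p MeasureTheory.volume)

/-- The shear anisotropic inhomogeneous Besov space `B^{α,q}_p(AB)`. -/
def shearBesovSpace (G : ShearletGenerator d) (α : ℝ) (p q : ℝ≥0∞) : Set (𝓢'(Rd d, ℂ)) :=
  {f | shearBesovNorm G α p q f < ∞}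

end

end ShearBesov

/-! Put r = min(1, p). The piece φ_ν ∗ f lives on the annulus |ξ| ~ 2^ν, while a shearlet at scale j
lives where |ξ_i| ~ 4^j and resolves the slopes ξ_k / ξ_i to accuracy 2^{-j}. When 4^j ~ 2^ν, about
2^{ν(d-1)/2} angular windows of aperture ~ 2^{-ν/2} cover the annulus, and on each window one shear
can be chosen for which the slope factors of the shearlet stay away from zero. Dividing by these
factors writes φ̂(2^{-ν} ξ) as a sum, over the windows and boundedly many j, of a multiplier times a
shearlet transform (`exists_window_decomposition`).

Such multipliers act boundedly for every 0 < p ≤ ∞. In its own linear coordinates the shearlet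
transform is supported in the cube [-1/2, 1/2]^d, so the multiplier m may be replaced by its Fourier
series there. Each exponential is a translation, which preserves L^p quasi-norms, and r-th powers of
these are subadditive; the constant is ∑ |m̂(n)|^r over ℤ^d (`hasSum_multiplier`,
`eLpNorm_conv_multiplier_le`). It is uniform in ν, the window and j because all the multipliers are
slices of finitely many functions, smooth jointly in the frequency and in a parameter confined to a
fixed ball (`contDiff_windowSymbol`, `norm_windowParam_le`, `exists_fourier_decay_of_contDiff`).
Compactness thus replaces derivative estimates.

Counting windows by volume (`card_annulus_le`) gives ‖φ_ν ∗ f‖^r ≤ C 2^{ν(d-1)/2} (2^{-(d+1)α₂ν/2}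
‖f‖)^r, where ‖f‖ is the shear quasi-norm. After weighting by 2^{να₁} this decays geometrically as
soon as 2α₁ + (d-1) max(1, 1/p) < (d+1)α₂, which the hypothesis implies. Hence a bound for each
single shearlet coefficient is enough, and the ℓ^q sum over ν comes from the decay. The function Φ
and the finitely many small ν have fixed compact frequency support, which finitely many frame
elements cover (`exists_eLpNorm_conv_le`). -/

open Filter Topology MeasureTheory

namespace ShearBesov

/-! ### Series and translations in the Schwartz space -/

section SchwartzSeries

variable {E F : Type*} [NormedAddCommGroup E] [NormedSpace ℝ E]
  [NormedAddCommGroup F] [NormedSpace ℝ F]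

theorem hasSum_iteratedFDeriv_schwartz [CompleteSpace F] {ι : Type*} {u : ι → 𝓢(E, F)}
    {g : 𝓢(E, F)} (hu : ∀ l : ℕ, Summable fun i => SchwartzMap.seminorm ℝ 0 l (u i))
    (hg : ∀ x, HasSum (fun i => u i x) (g x)) (l : ℕ) (x : E) :
    HasSum (fun i => iteratedFDeriv ℝ l (u i) x) (iteratedFDeriv ℝ l g x) := by
  have h1 : (g : E → F) = fun y => ∑' i, u i y := funext fun y => (hg y).tsum_eq.symm
  have h2 : ∀ (k : ℕ) (i : ι) (x : E),
      ‖iteratedFDeriv ℝ k (u i) x‖ ≤ SchwartzMap.seminorm ℝ 0 k (u i) := fun k i x =>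
    SchwartzMap.norm_iteratedFDeriv_le_seminorm ℝ (u i) k x
  have h3 := iteratedFDeriv_tsum_apply (𝕜 := ℝ) (f := fun i => (u i : E → F)) (N := (⊤ : ℕ∞))
    (v := fun k i => SchwartzMap.seminorm ℝ 0 k (u i))
    (fun i => (u i).smooth ⊤) (fun k _ => hu k) (fun k i x _ => h2 k i x) (k := l) le_top x
  rw [h1, h3]
  exact (Summable.of_norm_bounded (hu l) (fun i => h2 l i x)).hasSum

/-- The sum is already known to be a Schwartz function, so completeness of the Schwartz space plays
no role: each seminorm of the remainder is at most the tail of a convergent numerical series. -/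
theorem hasSum_schwartz_of_summable_seminorm [CompleteSpace F] {ι : Type*} {u : ι → 𝓢(E, F)} {g : 𝓢(E, F)}
    (hu : ∀ k l : ℕ, Summable fun i => SchwartzMap.seminorm ℝ k l (u i))
    (hg : ∀ x, HasSum (fun i => u i x) (g x)) : HasSum u g := by
  have hnn : ∀ k l i, 0 ≤ SchwartzMap.seminorm ℝ k l (u i) := fun k l i => apply_nonneg _ _
  have hd := hasSum_iteratedFDeriv_schwartz (hu 0) hg
  refine ((schwartz_withSeminorms ℝ E F).tendsto_nhds _ _).2 ?_
  rintro ⟨k, l⟩ ε hε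
  have htail := tendsto_tsum_compl_atTop_zero (fun i => SchwartzMap.seminorm ℝ k l (u i))
  filter_upwards [htail.eventually (gt_mem_nhds hε)] with s hs
  refine lt_of_le_of_lt ?_ hs
  change SchwartzMap.seminorm ℝ k l _ ≤ _
  refine SchwartzMap.seminorm_le_bound ℝ k l _ (tsum_nonneg fun i => hnn _ _ _) fun x => ?_
  have h3 : iteratedFDeriv ℝ l (⇑(∑ i ∈ s, u i - g)) x =
      -∑' i : {i // i ∉ s}, iteratedFDeriv ℝ l (u i) x := by
    have h4 : ⇑(∑ i ∈ s, u i - g) = (fun y => ∑ i ∈ s, u i y) - ⇑g := by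
      funext y
      simp
    have h6 : ContDiffAt ℝ l (fun y => ∑ i ∈ s, u i y) x :=
      ContDiff.contDiffAt (ContDiff.sum fun i _ => (u i).smooth l)
    have h7 : iteratedFDeriv ℝ l (fun y => ∑ i ∈ s, u i y) x =
        ∑ i ∈ s, iteratedFDeriv ℝ l (u i) x :=
      iteratedFDeriv_fun_sum_apply fun i _ => ((u i).smooth l).contDiffAt
    have h5 := (hd l x).summable.sum_add_tsum_compl (s := s)
    rw [(hd l x).tsum_eq] at h5
    rw [h4, iteratedFDeriv_sub_apply h6 (g.smooth l).contDiffAt, h7, ← h5]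
    exact sub_add_cancel_left _ _
  rw [h3, norm_neg]
  have h6 : Summable fun i : {i // i ∉ s} => SchwartzMap.seminorm ℝ k l (u i) :=
    (hu k l).subtype _
  have h8 : ∀ i, ‖iteratedFDeriv ℝ l (u i) x‖ ≤ SchwartzMap.seminorm ℝ 0 l (u i) := fun i =>
    SchwartzMap.norm_iteratedFDeriv_le_seminorm ℝ (u i) l x
  have h9 : Summable fun i => ‖iteratedFDeriv ℝ l (u i) x‖ :=
    Summable.of_nonneg_of_le (fun i => norm_nonneg _) h8 (hu 0 l)
  have h7 : Summable fun i : {i // i ∉ s} => ‖iteratedFDeriv ℝ l (u i) x‖ := h9.subtype _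
  have h10 : ‖∑' i : {i // i ∉ s}, iteratedFDeriv ℝ l (u i) x‖ ≤
      ∑' i : {i // i ∉ s}, ‖iteratedFDeriv ℝ l (u i) x‖ := norm_tsum_le_tsum_norm h7
  have h11 : ∑' i : {i // i ∉ s}, ‖x‖ ^ k * ‖iteratedFDeriv ℝ l (u i) x‖ ≤
      ∑' i : {i // i ∉ s}, SchwartzMap.seminorm ℝ k l (u i) :=
    (h7.mul_left (‖x‖ ^ k)).tsum_le_tsum
      (fun i => SchwartzMap.le_seminorm ℝ k l (u i) x) h6
  rw [tsum_mul_left] at h11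
  exact (mul_le_mul_of_nonneg_left h10 (pow_nonneg (norm_nonneg x) k)).trans h11

/-- The growth in `a` is only polynomial, so rapidly decreasing Fourier coefficients can absorb it.
-/
theorem seminorm_compSubConst_le (h : 𝓢(E, F)) (k l : ℕ) (a : E) :
    SchwartzMap.seminorm ℝ k l (SchwartzMap.compSubConstCLM ℝ a h) ≤
      2 ^ k * (SchwartzMap.seminorm ℝ k l h + SchwartzMap.seminorm ℝ 0 l h) * (1 + ‖a‖) ^ k := by
  refine SchwartzMap.seminorm_le_bound ℝ k l _ (by positivity) fun x => ?_
  have h1 : iteratedFDeriv ℝ l (⇑(SchwartzMap.compSubConstCLM ℝ a h)) x =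
      iteratedFDeriv ℝ l h (x - a) := iteratedFDeriv_comp_sub l a x
  rw [h1]
  have h2 : ‖x‖ ^ k ≤ 2 ^ k * (‖x - a‖ ^ k + 1) * (1 + ‖a‖) ^ k := by
    have h3 : ‖x‖ ≤ (‖x - a‖ + 1) * (1 + ‖a‖) := by
      have := norm_sub_norm_le x a
      nlinarith [norm_nonneg (x - a), norm_nonneg a, mul_nonneg (norm_nonneg (x - a)) (norm_nonneg a)]
    calc ‖x‖ ^ k ≤ ((‖x - a‖ + 1) * (1 + ‖a‖)) ^ k := by gcongr
      _ = (‖x - a‖ + 1) ^ k * (1 + ‖a‖) ^ k := mul_pow _ _ _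
      _ ≤ _ := by
        gcongr
        refine (add_pow_le (norm_nonneg _) zero_le_one k).trans ?_
        rw [one_pow]
        gcongr
        · norm_num
        · omega
  have h4 := SchwartzMap.le_seminorm ℝ k l h (x - a)
  have h5 := SchwartzMap.le_seminorm ℝ 0 l h (x - a)
  rw [pow_zero, one_mul] at h5
  calc ‖x‖ ^ k * ‖iteratedFDeriv ℝ l h (x - a)‖
      ≤ (2 ^ k * (‖x - a‖ ^ k + 1) * (1 + ‖a‖) ^ k) * ‖iteratedFDeriv ℝ l h (x - a)‖ := by gcongr
    _ = 2 ^ k * (‖x - a‖ ^ k * ‖iteratedFDeriv ℝ l h (x - a)‖ + ‖iteratedFDeriv ℝ l h (x - a)‖)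
        * (1 + ‖a‖) ^ k := by ring
    _ ≤ _ := by gcongr

/-- At the origin the mean value inequality gives a bound O(‖a‖) in every seminorm; other base
points follow by composing translations. This makes f ∗ g continuous, hence measurable. -/
theorem continuous_compSubConst (h : 𝓢(E, F)) :
    Continuous fun a : E => SchwartzMap.compSubConstCLM ℝ a h := by
  have key : Tendsto (fun a : E => SchwartzMap.compSubConstCLM ℝ a h) (𝓝 0) (𝓝 h) := by
    refine ((schwartz_withSeminorms ℝ E F).tendsto_nhds _ _).2 ?_
    rintro ⟨k, l⟩ ε hε
    have hb : ∀ a : E, ‖a‖ ≤ 1 → SchwartzMap.seminorm ℝ k l (SchwartzMap.compSubConstCLM ℝ a h - h) ≤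
        4 ^ k * (SchwartzMap.seminorm ℝ k (l + 1) h + SchwartzMap.seminorm ℝ 0 (l + 1) h) * ‖a‖ := by
      intro a ha
      refine SchwartzMap.seminorm_le_bound ℝ k l _ (by positivity) fun x => ?_
      have h1 : iteratedFDeriv ℝ l (⇑(SchwartzMap.compSubConstCLM ℝ a h - h)) x =
          iteratedFDeriv ℝ l h (x - a) - iteratedFDeriv ℝ l h x := by
        have h2 : ⇑(SchwartzMap.compSubConstCLM ℝ a h - h) = (fun y => h (y - a)) - ⇑h := by
          funext y; simp
        rw [h2, iteratedFDeriv_sub_apply, iteratedFDeriv_comp_sub]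
        · exact ((h.smooth l).comp (contDiff_id.sub contDiff_const)).contDiffAt
        · exact (h.smooth l).contDiffAt
      rw [h1]
      -- The weight stays at the endpoint x while the derivative is taken at z, so that division by
      -- ‖x‖^k gives a bound constant along the segment. The two weights are comparable because ‖x -
      -- z‖ ≤ 1.
      have h3 : ∀ z ∈ segment ℝ x (x - a), ‖fderiv ℝ (iteratedFDeriv ℝ l h) z‖ * ‖x‖ ^ k ≤
          4 ^ k * (SchwartzMap.seminorm ℝ k (l + 1) h + SchwartzMap.seminorm ℝ 0 (l + 1) h) := by
        intro z hz
        rw [norm_fderiv_iteratedFDeriv]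
        have hz1 : ‖x - z‖ ≤ 1 := by
          rw [segment_eq_image] at hz
          obtain ⟨θ, ⟨h0, h1⟩, rfl⟩ := hz
          have : x - ((1 - θ) • x + θ • (x - a)) = θ • a := by module
          dsimp only
          rw [this, norm_smul, Real.norm_of_nonneg h0]
          nlinarith [norm_nonneg a]
        have hz2 : ‖x‖ ^ k ≤ 4 ^ k * (‖z‖ ^ k + 1) := by
          have h5 : ‖x‖ ≤ ‖z‖ + 1 := by
            have := norm_sub_norm_le x z
            linarith
          calc ‖x‖ ^ k ≤ (‖z‖ + 1) ^ k := by gcongr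
            _ ≤ 2 ^ (k - 1) * (‖z‖ ^ k + 1 ^ k) := add_pow_le (norm_nonneg _) zero_le_one k
            _ ≤ 2 ^ k * (‖z‖ ^ k + 1) := by
              rw [one_pow]
              gcongr
              · norm_num
              · omega
            _ ≤ _ := by gcongr; norm_num
        have h4 := SchwartzMap.le_seminorm ℝ k (l + 1) h z
        have h5 := SchwartzMap.le_seminorm ℝ 0 (l + 1) h z
        rw [pow_zero, one_mul] at h5
        calc ‖iteratedFDeriv ℝ (l + 1) h z‖ * ‖x‖ ^ k
            ≤ ‖iteratedFDeriv ℝ (l + 1) h z‖ * (4 ^ k * (‖z‖ ^ k + 1)) := by gcongr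
          _ = 4 ^ k * (‖z‖ ^ k * ‖iteratedFDeriv ℝ (l + 1) h z‖ + ‖iteratedFDeriv ℝ (l + 1) h z‖) := by
            ring
          _ ≤ _ := by gcongr
      rcases eq_or_lt_of_le (pow_nonneg (norm_nonneg x) k) with h0 | h0
      · rw [← h0, zero_mul]; positivity
      have h6 := (convex_segment x (x - a)).norm_image_sub_le_of_norm_fderiv_le (𝕜 := ℝ)
        (f := iteratedFDeriv ℝ l h) (x := x) (y := x - a)
        (C := 4 ^ k * (SchwartzMap.seminorm ℝ k (l + 1) h + SchwartzMap.seminorm ℝ 0 (l + 1) h) / ‖x‖ ^ k)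
        (fun z _ => ((h.smooth ⊤).differentiable_iteratedFDeriv
          (by exact_mod_cast WithTop.coe_lt_coe.2 (WithTop.coe_lt_top l))) z)
        (fun z hz => by rw [le_div_iff₀ h0]; exact h3 z hz)
        (left_mem_segment ℝ _ _) (right_mem_segment ℝ _ _)
      have h7 : ‖x - a - x‖ = ‖a‖ := by rw [sub_sub_cancel_left, norm_neg]
      rw [h7, div_mul_eq_mul_div, le_div_iff₀ h0] at h6
      linarith
    have h8 : Tendsto (fun a : E => 4 ^ k * (SchwartzMap.seminorm ℝ k (l + 1) h +
        SchwartzMap.seminorm ℝ 0 (l + 1) h) * ‖a‖) (𝓝 0) (𝓝 0) := by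
      have : Continuous fun a : E => 4 ^ k * (SchwartzMap.seminorm ℝ k (l + 1) h +
        SchwartzMap.seminorm ℝ 0 (l + 1) h) * ‖a‖ := by fun_prop
      simpa using this.tendsto 0
    filter_upwards [h8.eventually (gt_mem_nhds hε), Metric.closedBall_mem_nhds (0 : E) one_pos]
      with a ha1 ha2
    exact lt_of_le_of_lt (hb a (by simpa using ha2)) ha1
  refine continuous_iff_continuousAt.2 fun a₀ => ?_
  have h1 : (fun a : E => SchwartzMap.compSubConstCLM ℝ a h) = fun a : E =>
      SchwartzMap.compSubConstCLM ℝ a₀ (SchwartzMap.compSubConstCLM ℝ (a - a₀) h) := by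
    funext a
    rw [SchwartzMap.compSubConstCLM_comp]
    simp
  rw [ContinuousAt, h1]
  have h2 : Tendsto (fun a : E => a - a₀) (𝓝 a₀) (𝓝 0) := by
    have : Continuous fun a : E => a - a₀ := by fun_prop
    simpa using this.tendsto a₀
  have h3 := ((SchwartzMap.compSubConstCLM ℝ (F := F) a₀).continuous.tendsto h).comp (key.comp h2)
  simpa [Function.comp_def] using h3

end SchwartzSeries

/-! ### Sums over the integer lattice -/

/-- The points of `ℤ^d`, as elements of `ℝ^d`. -/
noncomputable def latticePt {d : ℕ} (n : Fin d → ℤ) : Rd d := WithLp.toLp 2 fun k => (n k : ℝ)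

@[simp]
theorem latticePt_apply {d : ℕ} (n : Fin d → ℤ) (k : Fin d) : latticePt n k = n k := rfl

theorem latticePt_injective {d : ℕ} : Function.Injective (latticePt (d := d)) := by
  intro n n' h
  funext k
  have := congrArg (fun v : Rd d => v k) h
  simpa using this

theorem summable_latticePt_pow (d N : ℕ) (hN : d < N) :
    Summable fun n : Fin d → ℤ => ((1 + ‖latticePt n‖) ^ N)⁻¹ := by
  classical
  let b := (EuclideanSpace.basisFun (Fin d) ℝ).toBasis
  let L : Submodule ℤ (Rd d) := Submodule.span ℤ (Set.range b)
  have hmem : ∀ n : Fin d → ℤ, latticePt n ∈ L := by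
    intro n
    have : latticePt n = ∑ k, n k • b k := by
      ext i
      simp [b, Finset.sum_apply, Pi.single_apply]
    rw [this]
    exact Submodule.sum_mem _ fun k _ => Submodule.smul_mem _ _ (Submodule.subset_span ⟨k, rfl⟩)
  have hfr : Module.finrank ℤ L = d := by
    rw [ZLattice.rank ℝ L]
    simp
  have h1 := ZLattice.summable_norm_pow_inv (L := L) N (by omega)
  have h2 : Summable fun n : Fin d → ℤ => (‖latticePt n‖ ^ N)⁻¹ := by
    have := h1.comp_injective (i := fun n : Fin d → ℤ => (⟨latticePt n, hmem n⟩ : L))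
      (fun n n' h => latticePt_injective (congrArg Subtype.val h))
    simpa [Function.comp_def] using this
  -- The comparison term ‖n‖^{-N} is 0 at n = 0 by convention, so that point is dominated separately
  -- by an indicator.
  have h3 : Summable fun n : Fin d → ℤ => if n = 0 then (1 : ℝ) else 0 :=
    summable_of_ne_finset_zero (s := {0}) (fun n hn => by simpa using hn)
  refine Summable.of_nonneg_of_le (fun n => by positivity) (fun n => ?_) (h2.add h3)
  by_cases hn : n = 0
  · have : ((1 + ‖latticePt n‖) ^ N)⁻¹ ≤ 1 :=
      inv_le_one_of_one_le₀ (one_le_pow₀ (by linarith [norm_nonneg (latticePt n)]))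
    simp only [hn, if_true] at this ⊢
    have : 0 ≤ (‖latticePt (0 : Fin d → ℤ)‖ ^ N)⁻¹ := by positivity
    linarith
  · rw [if_neg hn, add_zero]
    have : 0 < ‖latticePt n‖ := by
      rw [norm_pos_iff]
      intro h
      exact hn (latticePt_injective (h.trans (by ext; simp)))
    gcongr
    linarith

theorem one_add_pow_mul_norm_fourier_le {d : ℕ} (m : 𝓢(Rd d, ℂ)) (N : ℕ) :
    ∃ C : ℝ, ∀ ξ : Rd d, (1 + ‖ξ‖) ^ N * ‖𝓕 m ξ‖ ≤ C := by
  refine ⟨2 ^ N * (Finset.Iic (N, 0)).sup (fun m => SchwartzMap.seminorm ℝ m.1 m.2) (𝓕 m), fun ξ => ?_⟩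
  have := SchwartzMap.one_add_le_sup_seminorm_apply (𝕜 := ℝ) (m := (N, 0)) le_rfl le_rfl (𝓕 m) ξ
  simpa using this

theorem summable_fourier_latticePt {d : ℕ} (m : 𝓢(Rd d, ℂ)) (K : ℕ) :
    Summable fun n : Fin d → ℤ => ‖𝓕 m (latticePt n)‖ * (1 + ‖latticePt n‖) ^ K := by
  obtain ⟨C, hC⟩ := one_add_pow_mul_norm_fourier_le m (d + 1 + K)
  refine Summable.of_nonneg_of_le (fun n => by positivity) (fun n => ?_)
    ((summable_latticePt_pow d (d + 1) (by omega)).mul_left C)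
  have h1 := hC (latticePt n)
  rw [pow_add] at h1
  have h2 : 0 < (1 + ‖latticePt n‖) ^ (d + 1) := by positivity
  rw [← div_eq_mul_inv, le_div_iff₀ h2]
  linarith

/-! ### Fourier series on the unit cube and Fourier multipliers -/

section FourierSeries

variable {d : ℕ}

/-- Mean value inequality along the k-th axis up to the nearest face, where m vanishes. This rate
gives continuity of the periodization across the faces. -/
theorem norm_le_of_vanishing_slab (m : 𝓢(Rd d, ℂ))
    (hm : ∀ η : Rd d, (∃ k, 1 / 2 ≤ |η k|) → m η = 0) (η : Rd d) (k : Fin d) (hk : |η k| ≤ 1 / 2) :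
    ‖m η‖ ≤ SchwartzMap.seminorm ℝ 0 1 m * (1 / 2 - |η k|) := by
  obtain ⟨σ, hσ, hσ'⟩ : ∃ σ : ℝ, |σ| = 1 ∧ η k = σ * |η k| := by
    rcases le_total 0 (η k) with h | h
    · exact ⟨1, by simp, by rw [abs_of_nonneg h]; ring⟩
    · exact ⟨-1, by simp, by rw [abs_of_nonpos h]; ring⟩
  set ζ : Rd d := η + (σ * (1 / 2 - |η k|)) • EuclideanSpace.single k (1 : ℝ) with hζ
  have h1 : m ζ = 0 := by
    refine hm ζ ⟨k, ?_⟩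
    have : ζ k = σ * (1 / 2) := by
      simp only [hζ, PiLp.add_apply, PiLp.smul_apply, PiLp.single_apply, if_true,
        smul_eq_mul, mul_one]
      nth_rewrite 1 [hσ']
      ring
    rw [this, abs_mul, hσ]
    norm_num
  have h2 := Convex.norm_image_sub_le_of_norm_fderiv_le (𝕜 := ℝ) (f := m) (s := Set.univ)
    (C := SchwartzMap.seminorm ℝ 0 1 m) (x := ζ) (y := η)
    (fun x _ => (m.smooth 1).differentiable (by simp) x)
    (fun x _ => by
      rw [← norm_iteratedFDeriv_one]
      exact SchwartzMap.norm_iteratedFDeriv_le_seminorm ℝ m 1 x)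
    convex_univ (Set.mem_univ _) (Set.mem_univ _)
  rw [h1, sub_zero] at h2
  refine h2.trans (le_of_eq ?_)
  congr 1
  rw [hζ, sub_add_cancel_left, norm_neg, norm_smul, Real.norm_eq_abs, abs_mul, hσ,
    abs_of_nonneg (by linarith : (0 : ℝ) ≤ 1 / 2 - |η k|)]
  simp

/-- The representative in `(-1/2, 1/2]^d` of a point of the torus. -/
noncomputable def torusRep (t : UnitAddTorus (Fin d)) : Rd d :=
  WithLp.toLp 2 fun i => (AddCircle.equivIoc (1 : ℝ) (-(1 / 2)) (t i)).1

theorem abs_torusRep (t : UnitAddTorus (Fin d)) (i : Fin d) :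
    |torusRep t i| = ‖t i‖ ∧ |torusRep t i| ≤ 1 / 2 := by
  have h := (AddCircle.equivIoc (1 : ℝ) (-(1 / 2)) (t i)).2
  have h1 : |torusRep t i| ≤ 1 / 2 := by
    rw [abs_le]
    change _ ≤ (AddCircle.equivIoc (1 : ℝ) (-(1 / 2)) (t i)).1 ∧
      (AddCircle.equivIoc (1 : ℝ) (-(1 / 2)) (t i)).1 ≤ _
    constructor <;> linarith [h.1, h.2]
  refine ⟨?_, h1⟩
  rw [← (AddCircle.norm_coe_eq_abs_iff (p := (1 : ℝ)) one_ne_zero).2 (by simpa using h1)]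
  congr 1
  exact AddCircle.coe_equivIoc

theorem torusRep_coe (x : Fin d → ℝ) (hx : ∀ i, x i ∈ Set.Ioc (-(1 / 2) : ℝ) (-(1 / 2) + 1)) :
    torusRep (fun i => (x i : UnitAddCircle)) = WithLp.toLp 2 x := by
  unfold torusRep
  congr 1
  funext i
  rw [AddCircle.equivIoc_coe_of_mem (hx i)]

/-- A function vanishing off the open unit cube, as a continuous function on the torus. -/
noncomputable def toTorus (m : 𝓢(Rd d, ℂ)) (hm : ∀ η : Rd d, (∃ k, 1 / 2 ≤ |η k|) → m η = 0) :
    C(UnitAddTorus (Fin d), ℂ) where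
  toFun t := m (torusRep t)
  continuous_toFun := by
    refine continuous_iff_continuousAt.2 fun t => ?_
    -- The representative jumps on the seam of the torus. There m is 0 and the slab estimate
    -- squeezes nearby values to 0; off the seam the representative is continuous.
    by_cases h : ∃ k, |torusRep t k| = 1 / 2
    · obtain ⟨k, hk⟩ := h
      rw [ContinuousAt, hm (torusRep t) ⟨k, hk.ge⟩]
      refine squeeze_zero_norm (a := fun t' : UnitAddTorus (Fin d) =>
        SchwartzMap.seminorm ℝ 0 1 m * (1 / 2 - ‖t' k‖)) (fun t' => ?_) ?_
      · rw [← (abs_torusRep t' k).1]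
        exact norm_le_of_vanishing_slab m hm _ k (abs_torusRep t' k).2
      · have : Continuous fun t' : UnitAddTorus (Fin d) =>
          SchwartzMap.seminorm ℝ 0 1 m * (1 / 2 - ‖t' k‖) := by fun_prop
        have h2 := this.tendsto t
        rwa [← (abs_torusRep t k).1, hk, sub_self, mul_zero] at h2
    · push Not at h
      have h1 : ContinuousAt (torusRep (d := d)) t := by
        refine (PiLp.continuous_toLp 2 _).continuousAt.comp (continuousAt_pi.2 fun i => ?_)
        refine ContinuousAt.comp (f := fun t' : UnitAddTorus (Fin d) => t' i)
          (g := fun s : UnitAddCircle => (AddCircle.equivIoc (1 : ℝ) (-(1 / 2)) s).1) ?_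
          (continuous_apply i).continuousAt
        refine continuous_subtype_val.continuousAt.comp (AddCircle.continuousAt_equivIoc 1 _ ?_)
        intro h2
        refine h i ?_
        rw [(abs_torusRep t i).1, h2]
        rw [(AddCircle.norm_coe_eq_abs_iff (p := (1 : ℝ)) one_ne_zero).2] <;> norm_num
      exact m.continuous.continuousAt.comp h1

/-- The character `η ↦ e^{2πi n·η}`. -/
noncomputable def latticeChar (n : Fin d → ℤ) (η : Rd d) : ℂ := (Real.fourierChar (inner ℝ (latticePt n) η) : ℂ)

theorem mFourier_coe_eq (n : Fin d → ℤ) (x : Fin d → ℝ) :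
    UnitAddTorus.mFourier n (fun i => (x i : UnitAddCircle)) = latticeChar n (WithLp.toLp 2 x) := by
  simp only [UnitAddTorus.mFourier, ContinuousMap.coe_mk, fourier_coe_apply, latticeChar,
    Real.fourierChar_apply, ← Complex.exp_sum]
  congr 1
  simp only [PiLp.inner_apply, latticePt_apply, Complex.ofReal_mul, Complex.ofReal_sum, Finset.mul_sum,
    Finset.sum_mul]
  refine Finset.sum_congr rfl fun i _ => ?_
  simp
  ring

/-- Since m vanishes off the cube, the integral over one period is the integral over ℝ^d. -/
theorem mFourierCoeff_toTorus (m : 𝓢(Rd d, ℂ))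
    (hm : ∀ η : Rd d, (∃ k, 1 / 2 ≤ |η k|) → m η = 0) (n : Fin d → ℤ) :
    UnitAddTorus.mFourierCoeff (toTorus m hm) n = 𝓕 m (latticePt n) := by
  rw [UnitAddTorus.mFourierCoeff_eq_integral _ _ (fun _ => -(1 / 2))]
  have h1 : ∫ x : Fin d → ℝ in {x | ∀ i, x i ∈ Set.Ioc (-(1 / 2) : ℝ) (-(1 / 2) + 1)},
      UnitAddTorus.mFourier (-n) (fun i => (x i : UnitAddCircle)) •
        toTorus m hm (fun i => (x i : UnitAddCircle)) =
      ∫ x : Fin d → ℝ in {x | ∀ i, x i ∈ Set.Ioc (-(1 / 2) : ℝ) (-(1 / 2) + 1)},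
        latticeChar (-n) (WithLp.toLp 2 x) • m (WithLp.toLp 2 x) := by
    refine setIntegral_congr_fun ?_ fun x hx => ?_
    · exact MeasurableSet.univ_pi' fun i => measurableSet_Ioc
    · simp only [mFourier_coe_eq]
      congr 1
      change m (torusRep _) = _
      rw [torusRep_coe x hx]
  rw [h1, setIntegral_eq_integral_of_forall_compl_eq_zero]
  · have h2 := (PiLp.volume_preserving_toLp (Fin d)).integral_comp
      (MeasurableEquiv.toLp 2 (Fin d → ℝ)).measurableEmbedding
      (fun v : Rd d => latticeChar (-n) v • m v)
    rw [h2]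
    change _ = 𝓕 (m : Rd d → ℂ) (latticePt n)
    rw [Real.fourier_eq]
    refine integral_congr_ae (Eventually.of_forall fun v => ?_)
    have h3 : latticePt (-n) = -latticePt n := by ext; simp
    simp only [latticeChar, h3, inner_neg_left, Circle.smul_def, real_inner_comm]
  · intro x hx
    rw [hm, smul_zero]
    simp only [Set.mem_ofPred_eq, not_forall, Set.mem_Ioc, not_and_or, not_lt, not_le] at hx
    obtain ⟨i, hi⟩ := hx
    refine ⟨i, ?_⟩
    change _ ≤ |x i|
    rcases hi with hi | hi
    · rw [abs_of_nonpos (by linarith)]; linarith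
    · rw [abs_of_pos (by linarith)]; linarith

theorem hasSum_fourier_cube (m : 𝓢(Rd d, ℂ))
    (hm : ∀ η : Rd d, (∃ k, 1 / 2 ≤ |η k|) → m η = 0) (η : Rd d) (hη : ∀ k, |η k| ≤ 1 / 2) :
    HasSum (fun n : Fin d → ℤ => 𝓕 m (latticePt n) * latticeChar n η) (m η) := by
  have hs : Summable (UnitAddTorus.mFourierCoeff (toTorus m hm)) := by
    have : UnitAddTorus.mFourierCoeff (toTorus m hm) = fun n => 𝓕 m (latticePt n) :=
      funext fun n => mFourierCoeff_toTorus m hm n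
    rw [this]
    exact Summable.of_norm (by simpa using summable_fourier_latticePt m 0)
  have h1 := UnitAddTorus.hasSum_mFourier_series_apply_of_summable hs
    (fun i => (η i : UnitAddCircle))
  simp only [mFourierCoeff_toTorus, mFourier_coe_eq, smul_eq_mul] at h1
  have h2 : toTorus m hm (fun i => (η i : UnitAddCircle)) = m η := by
    -- On a face the representative may lie on the opposite face, but m vanishes at both points.
    by_cases h : ∃ k, 1 / 2 ≤ |η k|
    · rw [hm η h]
      refine hm _ ?_
      obtain ⟨k, hk⟩ := h
      refine ⟨k, ?_⟩
      rw [(abs_torusRep _ k).1,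
        (AddCircle.norm_coe_eq_abs_iff (p := (1 : ℝ)) one_ne_zero).2 (by simpa using hη k)]
      exact hk
    · push Not at h
      change m (torusRep _) = _
      rw [torusRep_coe (fun i => η i) fun i => ?_]
      have := abs_lt.1 (h i)
      constructor <;> linarith [this.1, this.2]
  rw [h2] at h1
  exact h1

/-- The multiplication of the Fourier transform of `h` by `m`. -/
noncomputable def multiplier (m h : 𝓢(Rd d, ℂ)) : 𝓢(Rd d, ℂ) :=
  𝓕⁻ (SchwartzMap.pairing (ContinuousLinearMap.mul ℂ ℂ) m (𝓕 h))

theorem fourier_multiplier (m h : 𝓢(Rd d, ℂ)) (ξ : Rd d) :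
    𝓕 (multiplier m h) ξ = m ξ * 𝓕 h ξ := by
  rw [multiplier, FourierTransform.fourier_fourierInv_eq]
  simp

/-- On the cube carrying 𝓕 h the symbol m equals its Fourier series, and multiplying 𝓕 h by a
character translates h. Convergence holds in the Schwartz topology, so a tempered distribution may
be applied term by term. -/
theorem hasSum_multiplier (m h : 𝓢(Rd d, ℂ))
    (hm : ∀ η : Rd d, (∃ k, 1 / 2 ≤ |η k|) → m η = 0)
    (hh : ∀ η : Rd d, (∃ k, 1 / 2 < |η k|) → 𝓕 h η = 0) :
    HasSum (fun n : Fin d → ℤ => 𝓕 m (latticePt n) •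
      SchwartzMap.compSubConstCLM ℂ (-latticePt n) h) (multiplier m h) := by
  refine hasSum_schwartz_of_summable_seminorm (fun k l => ?_) fun x => ?_
  · refine Summable.of_nonneg_of_le (fun n => apply_nonneg _ _) (fun n => ?_)
      ((summable_fourier_latticePt m k).mul_left
        (2 ^ k * (SchwartzMap.seminorm ℝ k l h + SchwartzMap.seminorm ℝ 0 l h)))
    have h1 : SchwartzMap.seminorm ℝ k l (𝓕 m (latticePt n) •
        SchwartzMap.compSubConstCLM ℂ (-latticePt n) h) = ‖𝓕 m (latticePt n)‖ *
        SchwartzMap.seminorm ℝ k l (SchwartzMap.compSubConstCLM ℝ (-latticePt n) h) :=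
      map_smul_eq_mul (SchwartzMap.seminorm ℂ k l) _ _
    rw [h1]
    have h2 := seminorm_compSubConst_le h k l (-latticePt n)
    rw [norm_neg] at h2
    calc _ ≤ ‖𝓕 m (latticePt n)‖ * (2 ^ k * (SchwartzMap.seminorm ℝ k l h +
          SchwartzMap.seminorm ℝ 0 l h) * (1 + ‖latticePt n‖) ^ k) := by gcongr
      _ = _ := by ring
  -- The pointwise identity comes from Fourier inversion; absolute summability of the coefficients
  -- and integrability of 𝓕 h justify exchanging sum and integral.
  · have hinv : ∀ x, h x = ∫ v, Real.fourierChar (inner ℝ v x) • 𝓕 h v := by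
      intro x
      have h0 : h x = 𝓕⁻ (𝓕 h) x := by rw [FourierTransform.fourierInv_fourier_eq]
      rw [h0, SchwartzMap.fourierInv_coe, Real.fourierInv_eq]
    have hx : multiplier m h x = ∫ v, Real.fourierChar (inner ℝ v x) • (m v * 𝓕 h v) := by
      rw [multiplier, SchwartzMap.fourierInv_coe, Real.fourierInv_eq]
      simp
    have hterm : ∀ n : Fin d → ℤ, (𝓕 m (latticePt n) •
        SchwartzMap.compSubConstCLM ℂ (-latticePt n) h) x =
        ∫ v, 𝓕 m (latticePt n) * (latticeChar n v * (Real.fourierChar (inner ℝ v x) • 𝓕 h v)) := by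
      intro n
      rw [integral_const_mul]
      simp only [smul_apply, SchwartzMap.compSubConstCLM_apply, smul_eq_mul, sub_neg_eq_add]
      rw [hinv]
      congr 1
      refine integral_congr_ae (Eventually.of_forall fun v => ?_)
      simp only [latticeChar, inner_add_right, AddChar.map_add_eq_mul, Circle.smul_def,
        Circle.coe_mul, smul_eq_mul, real_inner_comm]
      ring
    rw [hx]
    simp only [hterm]
    have hnorm : ∀ n v, ‖𝓕 m (latticePt n) * (latticeChar n v *
        (Real.fourierChar (inner ℝ v x) • 𝓕 h v))‖ = ‖𝓕 m (latticePt n)‖ * ‖𝓕 h v‖ := by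
      intro n v
      rw [norm_mul, norm_mul, latticeChar, Circle.norm_coe, one_mul, Circle.norm_smul]
    have hint : ∀ n, Integrable (fun v => 𝓕 m (latticePt n) * (latticeChar n v *
        (Real.fourierChar (inner ℝ v x) • 𝓕 h v))) := by
      intro n
      refine Integrable.mono (g := fun v => 𝓕 m (latticePt n) * 𝓕 h v)
        ((𝓕 h).integrable.const_mul _) ?_ (Eventually.of_forall fun v => ?_)
      · refine Continuous.aestronglyMeasurable ?_
        have := (𝓕 h).continuous
        simp only [latticeChar, Circle.smul_def]
        have h2 : Continuous fun t : ℝ => (Real.fourierChar t : ℂ) :=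
          continuous_subtype_val.comp Real.continuous_fourierChar
        have h3 : Continuous fun v : Rd d => (Real.fourierChar (inner ℝ (latticePt n) v) : ℂ) :=
          h2.comp (by fun_prop)
        have h4 : Continuous fun v : Rd d => (Real.fourierChar (inner ℝ v x) : ℂ) :=
          h2.comp (by fun_prop)
        exact continuous_const.mul (h3.mul (h4.smul this))
      · rw [hnorm, norm_mul]
    have hs := hasSum_integral_of_summable_integral_norm hint (by
      simp only [hnorm, integral_const_mul]
      simpa using (summable_fourier_latticePt m 0).mul_right (∫ v, ‖𝓕 h v‖))
    convert hs using 1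
    refine integral_congr_ae (Eventually.of_forall fun v => ?_)
    dsimp only
    by_cases hv : ∃ k, 1 / 2 < |v k|
    · simp [hh v hv]
    · push Not at hv
      have h5 := ((hasSum_fourier_cube m hm v hv).mul_right
        (Real.fourierChar (inner ℝ v x) • 𝓕 h v)).tsum_eq
      simp only [mul_assoc] at h5
      rw [h5]
      simp only [Circle.smul_def, smul_eq_mul]
      ring

end FourierSeries

/-! ### Subadditivity of powers of the L^p quasi-norm -/

section Lp

/-- The exponent `min(1, p)`, for which the `r`-th power of the `L^p` quasi-norm is subadditive. -/
noncomputable def subExp (p : ℝ≥0∞) : ℝ := (min 1 p).toReal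

theorem subExp_pos {p : ℝ≥0∞} (hp : 0 < p) : 0 < subExp p :=
  ENNReal.toReal_pos (by simp [hp.ne']) (by simp)

theorem subExp_le_one (p : ℝ≥0∞) : subExp p ≤ 1 :=
  ENNReal.toReal_mono ENNReal.one_ne_top (min_le_left 1 p)

variable {α : Type*} [MeasurableSpace α] {μ : Measure α} {p : ℝ≥0∞}

/-- For p ≥ 1 the exponent is 1 and this is Minkowski's inequality; for p ≤ 1 it is the integral of
(a + b)^p ≤ a^p + b^p. -/
theorem eLpNorm_add_rpow_le (hp : 0 < p) {f g : α → ℂ} (hf : AEStronglyMeasurable f μ)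
    (hg : AEStronglyMeasurable g μ) :
    eLpNorm (f + g) p μ ^ subExp p ≤ eLpNorm f p μ ^ subExp p + eLpNorm g p μ ^ subExp p := by
  rcases le_total 1 p with h | h
  · rw [subExp, min_eq_left h]
    simpa using eLpNorm_add_le hf hg h
  · have hr := subExp_pos hp
    have hr1 := subExp_le_one p
    have hpt : p ≠ ∞ := (h.trans_lt ENNReal.one_lt_top).ne
    have hpr : p.toReal = subExp p := by rw [subExp, min_eq_right h]
    have key : ∀ u : α → ℂ, eLpNorm u p μ ^ subExp p = ∫⁻ x, ‖u x‖ₑ ^ subExp p ∂μ := by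
      intro u
      rw [eLpNorm_eq_lintegral_rpow_enorm_toReal hp.ne' hpt, hpr, ← ENNReal.rpow_mul,
        one_div_mul_cancel hr.ne', ENNReal.rpow_one]
    rw [key, key, key, ← lintegral_add_left' (hf.enorm.pow_const _)]
    refine lintegral_mono fun x => ?_
    refine le_trans ?_ (ENNReal.rpow_add_le_add_rpow _ _ hr.le hr1)
    exact ENNReal.rpow_le_rpow (enorm_add_le _ _) hr.le

theorem eLpNorm_sum_rpow_le (hp : 0 < p) {ι : Type*} (s : Finset ι) {f : ι → α → ℂ}
    (hf : ∀ i, AEStronglyMeasurable (f i) μ) :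
    eLpNorm (fun x => ∑ i ∈ s, f i x) p μ ^ subExp p ≤ ∑ i ∈ s, eLpNorm (f i) p μ ^ subExp p := by
  classical
  induction s using Finset.induction_on with
  | empty => simp [ENNReal.zero_rpow_of_pos (subExp_pos hp)]
  | insert i s hi ih =>
    simp only [Finset.sum_insert hi]
    refine (eLpNorm_add_rpow_le hp (hf i) ?_).trans (by gcongr)
    exact Finset.aestronglyMeasurable_fun_sum s fun i _ => hf i

/-- Fatou's lemma along the finite partial sums. -/
theorem eLpNorm_hasSum_rpow_le (hp : 0 < p) {ι : Type*} [Countable ι] {f : ι → α → ℂ}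
    {g : α → ℂ} (hf : ∀ i, AEStronglyMeasurable (f i) μ)
    (hg : ∀ x, HasSum (fun i => f i x) (g x)) :
    eLpNorm g p μ ^ subExp p ≤ ∑' i, eLpNorm (f i) p μ ^ subExp p := by
  have hr := subExp_pos hp
  have h1 : eLpNorm g p μ ≤ (∑' i, eLpNorm (f i) p μ ^ subExp p) ^ (subExp p)⁻¹ := by
    refine Lp.eLpNorm_le_of_ae_tendsto (u := (atTop : Filter (Finset ι)))
      (f := fun s x => ∑ i ∈ s, f i x) (Eventually.of_forall fun s => ?_)
      (fun s => Finset.aestronglyMeasurable_fun_sum s fun i _ => hf i)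
      (Eventually.of_forall fun x => hg x)
    rw [ENNReal.le_rpow_inv_iff hr]
    exact (eLpNorm_sum_rpow_le hp s hf).trans (ENNReal.sum_le_tsum s)
  rwa [ENNReal.le_rpow_inv_iff hr] at h1

end Lp

/-! ### Convolution, matrix dilations and the multiplier bound -/

section Conv

variable {d : ℕ}

/-- `g ↦ (f ∗ g)(x)` as a continuous linear functional. -/
noncomputable def convCLM (f : 𝓢'(Rd d, ℂ)) (x : Rd d) : 𝓢(Rd d, ℂ) →L[ℂ] ℂ :=
  (show 𝓢(Rd d, ℂ) →L[ℂ] ℂ from f).comp ((SchwartzMap.compSubConstCLM ℂ x).comp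
    (SchwartzMap.compCLMOfContinuousLinearEquiv ℂ (ContinuousLinearEquiv.neg ℝ)))

theorem convCLM_apply (f : 𝓢'(Rd d, ℂ)) (x : Rd d) (g : 𝓢(Rd d, ℂ)) :
    convCLM f x g = conv f g x := rfl

theorem conv_compSubConst (f : 𝓢'(Rd d, ℂ)) (g : 𝓢(Rd d, ℂ)) (a x : Rd d) :
    conv f (SchwartzMap.compSubConstCLM ℂ a g) x = conv f g (x - a) := by
  unfold conv
  congr 1
  ext y
  simp only [SchwartzMap.compSubConstCLM_apply, SchwartzMap.compCLMOfContinuousLinearEquiv_apply,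
    Function.comp_apply, ContinuousLinearEquiv.neg_apply]
  congr 1
  abel

theorem continuous_conv (f : 𝓢'(Rd d, ℂ)) (g : 𝓢(Rd d, ℂ)) : Continuous (conv f g) :=
  (show 𝓢(Rd d, ℂ) →L[ℂ] ℂ from f).continuous.comp (continuous_compSubConst _)

theorem eLpNorm_conv_compSubConst (f : 𝓢'(Rd d, ℂ)) (g : 𝓢(Rd d, ℂ)) (a : Rd d) (p : ℝ≥0∞) :
    eLpNorm (conv f (SchwartzMap.compSubConstCLM ℂ a g)) p volume = eLpNorm (conv f g) p volume := by
  have h : conv f (SchwartzMap.compSubConstCLM ℂ a g) = conv f g ∘ fun x => x - a :=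
    funext fun x => conv_compSubConst f g a x
  rw [h]
  exact eLpNorm_comp_measurePreserving (continuous_conv f g).aestronglyMeasurable
    (measurePreserving_sub_right volume a)

/-- The dilation by a matrix as a continuous linear map. -/
noncomputable def matrixDilateCLM (M : GL (Fin d) ℝ) : 𝓢(Rd d, ℂ) →L[ℂ] 𝓢(Rd d, ℂ) :=
  ((|(M : Matrix (Fin d) (Fin d) ℝ).det|⁻¹ : ℝ) : ℂ) •
    SchwartzMap.compCLMOfContinuousLinearEquiv ℂ (glEquiv M⁻¹)

theorem matrixDilateCLM_apply (M : GL (Fin d) ℝ) (g : 𝓢(Rd d, ℂ)) :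
    matrixDilateCLM M g = matrixDilate M g := rfl

theorem matrixDilate_apply (M : GL (Fin d) ℝ) (g : 𝓢(Rd d, ℂ)) (x : Rd d) :
    matrixDilate M g x =
      ((|(M : Matrix (Fin d) (Fin d) ℝ).det|⁻¹ : ℝ) : ℂ) * g (glEquiv M⁻¹ x) := rfl

theorem glEquiv_apply (M : GL (Fin d) ℝ) (x : Rd d) :
    glEquiv M x = Matrix.toEuclideanLin (M : Matrix (Fin d) (Fin d) ℝ) x := rfl

theorem glEquiv_inv_apply_apply (M : GL (Fin d) ℝ) (x : Rd d) :
    glEquiv M⁻¹ (glEquiv M x) = x :=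
  (glEquiv M).symm_apply_apply x

theorem matrixDilate_compSubConst (M : GL (Fin d) ℝ) (g : 𝓢(Rd d, ℂ)) (a : Rd d) :
    matrixDilate M (SchwartzMap.compSubConstCLM ℂ a g) =
      SchwartzMap.compSubConstCLM ℂ (glEquiv M a) (matrixDilate M g) := by
  ext x
  simp only [matrixDilate_apply, SchwartzMap.compSubConstCLM_apply, map_sub,
    glEquiv_inv_apply_apply]

/-- Dilating a translate gives a translate of the dilate, and translations preserve the L^p
quasi-norm. The constant therefore depends on m alone, neither on M nor on f. -/
theorem eLpNorm_conv_multiplier_le {p : ℝ≥0∞} (hp : 0 < p) (f : 𝓢'(Rd d, ℂ)) (M : GL (Fin d) ℝ)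
    (m h : 𝓢(Rd d, ℂ)) (hm : ∀ η : Rd d, (∃ k, 1 / 2 ≤ |η k|) → m η = 0)
    (hh : ∀ η : Rd d, (∃ k, 1 / 2 < |η k|) → 𝓕 h η = 0) :
    eLpNorm (conv f (matrixDilate M (multiplier m h))) p volume ^ subExp p ≤
      (∑' n : Fin d → ℤ, ‖𝓕 m (latticePt n)‖ₑ ^ subExp p) *
        eLpNorm (conv f (matrixDilate M h)) p volume ^ subExp p := by
  have hs : ∀ x, HasSum (fun n : Fin d → ℤ => conv f (𝓕 m (latticePt n) •
      SchwartzMap.compSubConstCLM ℂ (glEquiv M (-latticePt n)) (matrixDilate M h)) x)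
      (conv f (matrixDilate M (multiplier m h)) x) := by
    intro x
    have h1 := (hasSum_multiplier m h hm hh).mapL ((convCLM f x).comp (matrixDilateCLM M))
    simp only [ContinuousLinearMap.comp_apply, map_smul, matrixDilateCLM_apply,
      matrixDilate_compSubConst] at h1
    simp only [← convCLM_apply, map_smul]
    exact h1
  refine (eLpNorm_hasSum_rpow_le hp
    (fun n => (continuous_conv f _).aestronglyMeasurable) hs).trans (le_of_eq ?_)
  rw [← ENNReal.tsum_mul_right]
  refine tsum_congr fun n => ?_
  have h2 : conv f (𝓕 m (latticePt n) •
      SchwartzMap.compSubConstCLM ℂ (glEquiv M (-latticePt n)) (matrixDilate M h)) =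
      𝓕 m (latticePt n) • conv f
      (SchwartzMap.compSubConstCLM ℂ (glEquiv M (-latticePt n)) (matrixDilate M h)) := by
    funext x
    rw [← convCLM_apply, map_smul]
    rfl
  rw [h2, eLpNorm_const_smul, eLpNorm_conv_compSubConst,
    ENNReal.mul_rpow_of_nonneg _ _ (subExp_pos hp).le]

theorem tsum_fourier_latticePt_lt_top {p : ℝ≥0∞} (hp : 0 < p) (d : ℕ) :
    ∃ N : ℕ, ∀ B : ℝ, ∃ C : ℝ≥0∞, C ≠ ∞ ∧ ∀ m : 𝓢(Rd d, ℂ),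
      (∀ n : Fin d → ℤ, (1 + ‖latticePt n‖) ^ N * ‖𝓕 m (latticePt n)‖ ≤ B) →
      ∑' n : Fin d → ℤ, ‖𝓕 m (latticePt n)‖ₑ ^ subExp p ≤ C := by
  have hr := subExp_pos hp
  -- With N r ≥ d + 1 the r-th powers of coefficients of size (1 + ‖n‖)^{-N} are summable over ℤ^d.
  obtain ⟨N, hN⟩ := exists_nat_ge (((d : ℝ) + 1) / subExp p)
  rw [div_le_iff₀ hr] at hN
  refine ⟨N, fun B => ⟨∑' n : Fin d → ℤ, ENNReal.ofReal
    (|B| ^ subExp p * ((1 + ‖latticePt n‖) ^ (d + 1))⁻¹), ?_, fun m hm => ?_⟩⟩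
  · have := (summable_latticePt_pow d (d + 1) (by omega)).mul_left (|B| ^ subExp p)
    rw [← ENNReal.ofReal_tsum_of_nonneg (fun n => by positivity) this]
    exact ENNReal.ofReal_ne_top
  · refine ENNReal.tsum_le_tsum fun n => ?_
    have h1 : (0 : ℝ) < 1 + ‖latticePt n‖ := by positivity
    have h2 : ‖𝓕 m (latticePt n)‖ ≤ |B| * ((1 + ‖latticePt n‖) ^ N)⁻¹ := by
      rw [← div_eq_mul_inv, le_div_iff₀ (by positivity)]
      linarith [hm n, le_abs_self B]
    rw [← ofReal_norm, ENNReal.ofReal_rpow_of_nonneg (norm_nonneg _) hr.le]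
    refine ENNReal.ofReal_le_ofReal ?_
    calc ‖𝓕 m (latticePt n)‖ ^ subExp p
        ≤ (|B| * ((1 + ‖latticePt n‖) ^ N)⁻¹) ^ subExp p :=
          Real.rpow_le_rpow (norm_nonneg _) h2 hr.le
      _ = |B| ^ subExp p * ((1 + ‖latticePt n‖) ^ ((N : ℝ) * subExp p))⁻¹ := by
          rw [Real.mul_rpow (abs_nonneg B) (by positivity), Real.inv_rpow (by positivity),
            ← Real.rpow_natCast, ← Real.rpow_mul h1.le]
      _ ≤ _ := by
          gcongr
          rw [← Real.rpow_natCast]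
          refine Real.rpow_le_rpow_of_exponent_le (by linarith [norm_nonneg (latticePt n)]) ?_
          push_cast
          exact hN

theorem tsum_fourier_latticePt_ne_top {p : ℝ≥0∞} (hp : 0 < p) (m : 𝓢(Rd d, ℂ)) :
    ∑' n : Fin d → ℤ, ‖𝓕 m (latticePt n)‖ₑ ^ subExp p ≠ ∞ := by
  obtain ⟨N, hN⟩ := tsum_fourier_latticePt_lt_top hp d
  obtain ⟨B, hB⟩ := one_add_pow_mul_norm_fourier_le m N
  obtain ⟨C, hC, h⟩ := hN B
  exact ne_top_of_le_ne_top hC (h m fun n => hB _)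

theorem inner_glEquiv (M : GL (Fin d) ℝ) (w ξ : Rd d) :
    inner ℝ (glEquiv M w) ξ =
      inner ℝ w (Matrix.toEuclideanLin (M : Matrix (Fin d) (Fin d) ℝ).transpose ξ) := by
  have h := Matrix.toEuclideanLin_conjTranspose_eq_adjoint (M : Matrix (Fin d) (Fin d) ℝ)
  rw [Matrix.conjTranspose_eq_transpose_of_trivial] at h
  rw [h, LinearMap.adjoint_inner_right, glEquiv_apply]

theorem det_toEuclideanLin (M : Matrix (Fin d) (Fin d) ℝ) :
    LinearMap.det (Matrix.toEuclideanLin M) = M.det := by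
  rw [Matrix.toEuclideanLin_eq_toLin_orthonormal, LinearMap.det_toLin]

theorem fourier_matrixDilate (M : GL (Fin d) ℝ) (g : 𝓢(Rd d, ℂ)) (ξ : Rd d) :
    𝓕 (matrixDilate M g) ξ =
      𝓕 g (Matrix.toEuclideanLin (M : Matrix (Fin d) (Fin d) ℝ).transpose ξ) := by
  set c : ℝ := |(M : Matrix (Fin d) (Fin d) ℝ).det| with hc
  have hdet : (M : Matrix (Fin d) (Fin d) ℝ).det ≠ 0 := by
    rw [← Matrix.GeneralLinearGroup.val_det_apply]
    exact Units.ne_zero _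
  have hc0 : c ≠ 0 := by simpa [hc] using hdet
  have hdet' : ((M⁻¹ : GL (Fin d) ℝ) : Matrix (Fin d) (Fin d) ℝ).det =
      ((M : Matrix (Fin d) (Fin d) ℝ).det)⁻¹ := by
    rw [Matrix.coe_units_inv, Matrix.det_nonsing_inv, Ring.inverse_eq_inv']
  have hmap : Measure.map (glEquiv M⁻¹) (volume : Measure (Rd d)) = ENNReal.ofReal c • volume := by
    have h := Measure.map_linearMap_addHaar_eq_smul_addHaar (volume : Measure (Rd d))
      (f := Matrix.toEuclideanLin ((M⁻¹ : GL (Fin d) ℝ) : Matrix (Fin d) (Fin d) ℝ))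
      (by rw [det_toEuclideanLin, hdet']; exact inv_ne_zero hdet)
    rw [det_toEuclideanLin, hdet', inv_inv] at h
    exact h
  have h1 := (glEquiv M⁻¹).toHomeomorph.toMeasurableEquiv.measurableEmbedding.integral_map
    (μ := (volume : Measure (Rd d)))
    (fun w => Real.fourierChar (-inner ℝ (glEquiv M w) ξ) • (((c⁻¹ : ℝ) : ℂ) * g w))
  change ∫ y, _ ∂(Measure.map (glEquiv M⁻¹) (volume : Measure (Rd d))) =
    ∫ x, Real.fourierChar (-inner ℝ (glEquiv M (glEquiv M⁻¹ x)) ξ) •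
      (((c⁻¹ : ℝ) : ℂ) * g (glEquiv M⁻¹ x)) at h1
  rw [hmap, integral_smul_measure] at h1
  have h3 : ∀ x, glEquiv M (glEquiv M⁻¹ x) = x := fun x => (glEquiv M).apply_symm_apply x
  simp only [h3] at h1
  rw [SchwartzMap.fourier_coe, SchwartzMap.fourier_coe, Real.fourier_eq, Real.fourier_eq]
  simp only [matrixDilate_apply]
  rw [← hc, ← h1, ENNReal.toReal_ofReal (abs_nonneg _), ← integral_smul]
  refine integral_congr_ae (Eventually.of_forall fun v => ?_)
  simp only [inner_glEquiv, Circle.smul_def, smul_eq_mul, Complex.real_smul]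
  have hc1 : (c : ℂ) ≠ 0 := by exact_mod_cast hc0
  push_cast
  field_simp
  rw [← hc]

theorem fourier_dyadicDilate (ν : ℕ) (g : 𝓢(Rd d, ℂ)) (ξ : Rd d) :
    𝓕 (dyadicDilate ν g) ξ = 𝓕 g (((2 : ℝ) ^ ν)⁻¹ • ξ) := by
  have h2 : ∀ v, dyadicDilate ν g v = (2 : ℂ) ^ (d * ν) * g ((2 : ℝ) ^ ν • v) := fun v => rfl
  rw [SchwartzMap.fourier_coe, SchwartzMap.fourier_coe, Real.fourier_eq, Real.fourier_eq]
  simp only [h2]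
  have h1 := Measure.integral_comp_smul_of_nonneg (volume : Measure (Rd d))
    (fun w => Real.fourierChar (-inner ℝ w (((2 : ℝ) ^ ν)⁻¹ • ξ)) • g w) ((2 : ℝ) ^ ν)
    (hR := by positivity)
  have h4 : (2 : ℝ) ^ ν ≠ 0 := by positivity
  simp only [inner_smul_left, inner_smul_right, conj_trivial, finrank_euclideanSpace,
    Fintype.card_fin, inv_mul_cancel_left₀ h4] at h1
  rw [eq_inv_smul_iff₀ (by positivity), ← integral_smul] at h1
  simp only [inner_smul_right]
  rw [← h1]
  refine integral_congr_ae (Eventually.of_forall fun v => ?_)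
  simp only [Circle.smul_def, smul_eq_mul, Complex.real_smul]
  push_cast
  rw [← pow_mul, mul_comm ν d]
  ring

end Conv

/-! ### Symbol decompositions, shear coordinates and the frequency cover -/

section Decomposition

variable {d : ℕ}

/-- The transpose of an invertible matrix. -/
def glTranspose (M : GL (Fin d) ℝ) : GL (Fin d) ℝ where
  val := (M : Matrix (Fin d) (Fin d) ℝ).transpose
  inv := ((M⁻¹ : GL (Fin d) ℝ) : Matrix (Fin d) (Fin d) ℝ).transpose
  val_inv := by rw [← Matrix.transpose_mul, Units.inv_mul, Matrix.transpose_one]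
  inv_val := by rw [← Matrix.transpose_mul, Units.mul_inv, Matrix.transpose_one]

theorem fourier_matrixDilate' (M : GL (Fin d) ℝ) (g : 𝓢(Rd d, ℂ)) (ξ : Rd d) :
    𝓕 (matrixDilate M g) ξ = 𝓕 g (glEquiv (glTranspose M) ξ) :=
  fourier_matrixDilate M g ξ

/-- By injectivity of the Fourier transform the symbol identity is an identity of test functions, to
which the multiplier bound applies termwise. Every later L^p estimate is thereby reduced to an
algebraic identity between symbols. -/
theorem eLpNorm_conv_decomposition_le {p : ℝ≥0∞} (hp : 0 < p) (f : 𝓢'(Rd d, ℂ)) {ι : Type*}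
    (s : Finset ι) (M : ι → GL (Fin d) ℝ) (m h : ι → 𝓢(Rd d, ℂ)) (g : 𝓢(Rd d, ℂ))
    (hm : ∀ t, ∀ η : Rd d, (∃ k, 1 / 2 ≤ |η k|) → m t η = 0)
    (hh : ∀ t, ∀ η : Rd d, (∃ k, 1 / 2 < |η k|) → 𝓕 (h t) η = 0)
    (hg : ∀ ξ, 𝓕 g ξ = ∑ t ∈ s, m t (glEquiv (glTranspose (M t)) ξ) *
      𝓕 (h t) (glEquiv (glTranspose (M t)) ξ)) :
    eLpNorm (conv f g) p volume ^ subExp p ≤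
      ∑ t ∈ s, (∑' n : Fin d → ℤ, ‖𝓕 (m t) (latticePt n)‖ₑ ^ subExp p) *
        eLpNorm (conv f (matrixDilate (M t) (h t))) p volume ^ subExp p := by
  have h1 : g = ∑ t ∈ s, matrixDilate (M t) (multiplier (m t) (h t)) := by
    have h2 : 𝓕 g = 𝓕 (∑ t ∈ s, matrixDilate (M t) (multiplier (m t) (h t))) := by
      ext ξ
      have h3 : 𝓕 (∑ t ∈ s, matrixDilate (M t) (multiplier (m t) (h t))) =
          ∑ t ∈ s, 𝓕 (matrixDilate (M t) (multiplier (m t) (h t))) :=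
        map_sum (SchwartzMap.fourierTransformCLM ℂ) _ _
      rw [h3, hg ξ, sum_apply]
      refine Finset.sum_congr rfl fun t _ => ?_
      rw [fourier_matrixDilate', fourier_multiplier]
    have h4 := congrArg (fun u : 𝓢(Rd d, ℂ) => (𝓕⁻ u : 𝓢(Rd d, ℂ))) h2
    simpa only [FourierTransform.fourierInv_fourier_eq] using h4
  have h2 : conv f g = fun x => ∑ t ∈ s, conv f (matrixDilate (M t) (multiplier (m t) (h t))) x := by
    funext x
    conv_lhs => rw [h1]
    simp only [← convCLM_apply, map_sum]
  rw [h2]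
  refine (eLpNorm_sum_rpow_le hp s
    fun t => (continuous_conv f _).aestronglyMeasurable).trans (Finset.sum_le_sum fun t _ => ?_)
  exact eLpNorm_conv_multiplier_le hp f (M t) (m t) (h t) (hm t) (hh t)

theorem le_lqNorm {ι : Type} {q : ℝ≥0∞} (hq : 0 < q) (a : ι → ℝ≥0∞) (i : ι) :
    a i ≤ lqNorm q a := by
  unfold lqNorm
  split_ifs with h
  · exact le_iSup a i
  · rw [ENNReal.le_rpow_inv_iff (ENNReal.toReal_pos hq.ne' h)]
    exact ENNReal.le_tsum (f := fun i => a i ^ q.toReal) i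

variable (G : ShearletGenerator d)

theorem ShearletGenerator.fourier_psi (i : Fin d) (ξ : Rd d) : 𝓕 (G.psi i) ξ = G.psiHat i ξ := by
  rw [ShearletGenerator.psi, FourierTransform.fourier_fourierInv_eq]
  rfl

/-- Approach t from outside along (1 + 1/(n+1)) t. Vanishing at the endpoints of the supports is
what makes the profiles vanish on the faces of the unit cube. -/
theorem eq_zero_of_forall_lt {u : ℝ → ℂ} (hu : Continuous u) {a t : ℝ}
    (h : ∀ t, a < |t| → u t = 0) (ht : a ≤ |t|) (ha : 0 < a) : u t = 0 := by
  have h1 : Tendsto (fun n : ℕ => u ((1 + 1 / ((n : ℝ) + 1)) * t)) atTop (𝓝 (u ((1 + 0) * t))) :=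
    (hu.tendsto _).comp ((tendsto_const_nhds.add tendsto_one_div_add_atTop_nhds_zero_nat).mul_const t)
  rw [add_zero, one_mul] at h1
  refine tendsto_nhds_unique h1 (tendsto_const_nhds.congr fun n => (h _ ?_).symm)
  have h2 : (0 : ℝ) < 1 / ((n : ℝ) + 1) := by positivity
  rw [abs_mul, abs_of_pos (by linarith : (0 : ℝ) < 1 + 1 / ((n : ℝ) + 1))]
  nlinarith

theorem ShearletGenerator.psi2_eq_zero' {t : ℝ} (ht : 1 ≤ |t|) : G.psi2 t = 0 :=
  eq_zero_of_forall_lt G.contDiff_psi2.continuous (fun _ h => G.psi2_eq_zero h) ht one_pos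

theorem ShearletGenerator.psi1_eq_zero' {t : ℝ} (ht : 1 / 2 ≤ |t|) : G.psi1 t = 0 :=
  eq_zero_of_forall_lt G.contDiff_psi1.continuous (fun _ h => G.psi1_eq_zero (Or.inr h)) ht
    (by norm_num)

/-- Three consecutive translates have squares summing to 1, so one is at least 1/3. As `psi2`
vanishes outside (-1, 1), the shift satisfies |x - l| < 1, and integrality improves |l| < N + 1 to
|l| ≤ N: the allowed shears suffice up to the edge of the cone. -/
theorem ShearletGenerator.exists_shear (x : ℝ) (N : ℕ) (hx : |x| ≤ N) :
    ∃ l : ℤ, |l| ≤ N ∧ 1 / 3 ≤ ‖G.psi2 (x - l)‖ ^ 2 := by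
  have key : ∃ l : ℤ, 1 / 3 ≤ ‖G.psi2 (x - l)‖ ^ 2 := by
    have h0 := Int.floor_le x
    have h1 := Int.lt_floor_add_one x
    have h2 := G.sum_psi2 (x - ⌊x⌋) (by rw [abs_le]; constructor <;> linarith)
    by_contra! h
    have h3 := h (⌊x⌋ + 1)
    have h4 := h ⌊x⌋
    have h5 := h (⌊x⌋ - 1)
    push_cast at h3 h5
    rw [show x - (⌊x⌋ + 1 : ℝ) = x - ⌊x⌋ - 1 by ring] at h3
    rw [show x - (⌊x⌋ - 1 : ℝ) = x - ⌊x⌋ + 1 by ring] at h5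
    linarith
  obtain ⟨l, hl⟩ := key
  refine ⟨l, ?_, hl⟩
  have h1 : |x - l| < 1 := by
    by_contra! h
    rw [G.psi2_eq_zero' h] at hl
    norm_num at hl
  have h2 : |(l : ℝ)| < N + 1 := by
    calc |(l : ℝ)| = |x - (x - l)| := by congr 1; ring
      _ ≤ |x| + |x - l| := abs_sub _ _
      _ < N + 1 := by linarith
  have h3 : |l| < (N : ℤ) + 1 := by exact_mod_cast h2
  omega

theorem ShearletGenerator.psiHat_eq_zero {i : Fin d} {η : Rd d} (h : ∃ k, 1 / 2 ≤ |η k|) :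
    G.psiHat i η = 0 := by
  obtain ⟨k, hk⟩ := h
  unfold ShearletGenerator.psiHat
  by_cases hi : 1 / 2 ≤ |η i|
  · rw [G.psi1_eq_zero' hi, zero_mul]
  by_cases hi' : |η i| < 1 / 16
  · rw [G.psi1_eq_zero (Or.inl hi'), zero_mul]
  push Not at hi hi'
  have hki : k ≠ i := by
    rintro rfl
    linarith
  rw [Finset.prod_eq_zero (i := k) (by simp [hki]), mul_zero]
  refine G.psi2_eq_zero' ?_
  rw [abs_div, one_le_div (by linarith)]
  linarith

/-- The matrix `A_{(i)}^{-j} B_{(i)}^{-[ℓ]}`. -/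
noncomputable def shearletMatrix (I : ShearIndex d) : GL (Fin d) ℝ :=
  (dilationMatrix I.1 ^ I.2.1)⁻¹ * (shearMatrix I.1 I.2.2.1)⁻¹

theorem ShearletGenerator.psiDilated_eq (I : ShearIndex d) :
    G.psiDilated I = matrixDilate (shearletMatrix I) (G.psi I.1) := rfl

/-- The linear change of variables `ξ ↦ ξ A_{(i)}^{-j} B_{(i)}^{-[ℓ]}`. -/
noncomputable def shearCoord (I : ShearIndex d) : Rd d ≃L[ℝ] Rd d :=
  glEquiv (glTranspose (shearletMatrix I))

theorem shearCoord_apply (I : ShearIndex d) (ξ : Rd d) (k : Fin d) :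
    shearCoord I ξ k = if h : k = I.1 then ξ I.1 / 4 ^ I.2.1 else
      ξ k / 2 ^ I.2.1 - I.2.2.1 ⟨k, h⟩ * (ξ I.1 / 4 ^ I.2.1) := by
  obtain ⟨i, j, l⟩ := I
  have h1 : (((dilationMatrix i ^ j)⁻¹ : GL (Fin d) ℝ) : Matrix (Fin d) (Fin d) ℝ) =
      Matrix.diagonal fun k => (if k = i then (4 : ℝ)⁻¹ else 2⁻¹) ^ j := by
    rw [← inv_pow, Units.val_pow_eq_pow_val]
    change (Matrix.diagonal fun k => if k = i then (4 : ℝ)⁻¹ else 2⁻¹) ^ j = _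
    rw [Matrix.diagonal_pow]
    rfl
  have h2 : (((shearMatrix i l.1)⁻¹ : GL (Fin d) ℝ) : Matrix (Fin d) (Fin d) ℝ) =
      1 + shearPart i (-l.1) := rfl
  have h3 : ((glTranspose (shearletMatrix ⟨i, j, l⟩) : GL (Fin d) ℝ) : Matrix (Fin d) (Fin d) ℝ) =
      ((Matrix.diagonal fun k => (if k = i then (4 : ℝ)⁻¹ else 2⁻¹) ^ j) *
        (1 + shearPart i (-l.1))).transpose := by
    rw [← h1, ← h2]; rfl
  rw [shearCoord, glEquiv_apply, h3]
  simp only [Matrix.toLpLin_apply, Matrix.mulVec, dotProduct, Matrix.transpose_apply,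
    Matrix.diagonal_mul, Matrix.add_apply, shearPart, Matrix.of_apply, Matrix.one_apply]
  by_cases hk : k = i
  · subst hk
    rw [Finset.sum_eq_single k]
    · simp [mul_comm, div_eq_mul_inv]
    · intro c _ hc
      simp [hc]
    · simp
  · rw [dif_neg hk]
    rw [Finset.sum_eq_add k i hk]
    · simp [hk, Ne.symm hk]
      ring
    · rintro c - ⟨hc1, hc2⟩
      simp [hc1, hc2]
    · simp
    · simp

theorem shearCoord_self (I : ShearIndex d) (ξ : Rd d) :
    shearCoord I ξ I.1 = ξ I.1 / 4 ^ I.2.1 := by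
  rw [shearCoord_apply, dif_pos rfl]

/-- The scaling by 4^j in one direction and 2^j in the others magnifies slopes by 2^j, and the shear
translates them. -/
theorem shearCoord_div (I : ShearIndex d) (ξ : Rd d) (hξ : ξ I.1 ≠ 0) (k : Fin d) (hk : k ≠ I.1) :
    shearCoord I ξ k / shearCoord I ξ I.1 = 2 ^ I.2.1 * (ξ k / ξ I.1) - I.2.2.1 ⟨k, hk⟩ := by
  rw [shearCoord_self, shearCoord_apply, dif_neg hk]
  have h4 : (4 : ℝ) ^ I.2.1 = 2 ^ I.2.1 * 2 ^ I.2.1 := by rw [← mul_pow]; norm_num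
  have h2 : (2 : ℝ) ^ I.2.1 ≠ 0 := by positivity
  rw [h4]
  field_simp

theorem ShearletGenerator.fourier_psiDilated (I : ShearIndex d) (ξ : Rd d) :
    𝓕 (G.psiDilated I) ξ = G.psiHat I.1 (shearCoord I ξ) := by
  rw [G.psiDilated_eq, fourier_matrixDilate', G.fourier_psi]
  rfl

/-- Outside the small cube, let i be the largest coordinate. All slopes are then at most 1, so the
partition in `psi1` supplies a scale and `exists_shear` a shear. -/
theorem ShearletGenerator.exists_psiDilated_ne_zero (ξ : Rd d) :
    𝓕 G.Psi ξ ≠ 0 ∨ ∃ I : ShearIndex d, 𝓕 (G.psiDilated I) ξ ≠ 0 := by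
  by_cases h : ∀ i, |ξ i| ≤ 1 / 8
  · left
    intro h0
    have := G.norm_Psi ξ h
    rw [h0] at this
    simp at this
  right
  push Not at h
  obtain ⟨i₀, hi₀⟩ := h
  obtain ⟨i, -, hi⟩ := Finset.exists_max_image Finset.univ (fun i => |ξ i|) ⟨i₀, Finset.mem_univ _⟩
  have hi1 : 1 / 8 < |ξ i| := hi₀.trans_le (hi i₀ (Finset.mem_univ _))
  have hne : ξ i ≠ 0 := by
    rw [← abs_pos]; linarith
  obtain ⟨j, hj⟩ : ∃ j : ℕ, G.psi1 (ξ i / 2 ^ (2 * j)) ≠ 0 := by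
    by_contra! h
    have := G.sum_psi1 (ξ i) hi1.le
    simp only [h] at this
    norm_num at this
    exact zero_ne_one (this.unique hasSum_zero).symm
  have hl : ∀ k : Fin d, ∃ l : ℤ, |l| ≤ 2 ^ j ∧ 1 / 3 ≤ ‖G.psi2 (2 ^ j * (ξ k / ξ i) - l)‖ ^ 2 := by
    intro k
    have := G.exists_shear (2 ^ j * (ξ k / ξ i)) (2 ^ j) ?_
    · exact_mod_cast this
    · rw [abs_mul, abs_div, abs_of_pos (by positivity : (0 : ℝ) < 2 ^ j)]
      push_cast
      have : |ξ k| / |ξ i| ≤ 1 := div_le_one_of_le₀ (hi k (Finset.mem_univ _)) (abs_nonneg _)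
      nlinarith [pow_pos (two_pos : (0 : ℝ) < 2) j]
  choose l hl1 hl2 using hl
  let I : ShearIndex d := ⟨i, j, fun k => l k, fun k => hl1 k⟩
  refine ⟨I, ?_⟩
  rw [G.fourier_psiDilated]
  unfold ShearletGenerator.psiHat
  refine mul_ne_zero ?_ (Finset.prod_ne_zero_iff.2 fun k hk => ?_)
  · rw [shearCoord_self]
    have : (4 : ℝ) ^ j = 2 ^ (2 * j) := by rw [pow_mul]; norm_num
    change G.psi1 (ξ i / 4 ^ j) ≠ 0
    rwa [this]
  · rw [shearCoord_div I ξ hne k (by simpa using hk)]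
    intro h0
    have := hl2 k
    change G.psi2 (2 ^ j * (ξ k / ξ i) - l k) = 0 at h0
    rw [h0] at this
    norm_num at this

theorem eLpNorm_psiDilated_le {q : ℝ≥0∞} (hq : 0 < q) (α : ℝ) (p : ℝ≥0∞) (f : 𝓢'(Rd d, ℂ))
    (I : ShearIndex d) :
    eLpNorm (conv f (G.psiDilated I)) p volume ≤
      ENNReal.ofReal ((2 : ℝ) ^ (-(((d : ℝ) + 1) * I.2.1 * α))) * shearBesovNorm G α p q f := by
  have h1 := le_lqNorm hq (fun I : ShearIndex d =>
      ENNReal.ofReal (((2 : ℝ) ^ (-(((d : ℝ) + 1) * (I.2.1 : ℝ)))) ^ (-α)) *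
        MeasureTheory.eLpNorm (conv f (G.psiDilated I)) p MeasureTheory.volume) I
  have h2 := h1.trans (le_add_self : _ ≤ shearBesovNorm G α p q f)
  rw [← Real.rpow_mul two_pos.le] at h2
  refine le_trans (le_of_eq ?_) (mul_le_mul_right h2 _)
  rw [← mul_assoc, ← ENNReal.ofReal_mul (by positivity), ← Real.rpow_add two_pos]
  rw [show -(((d : ℝ) + 1) * I.2.1 * α) + -((d + 1) * (I.2.1 : ℝ)) * -α = 0 by ring]
  simp

end Decomposition

/-! ### Test functions with compact frequency support -/

section CompactFrequency

variable {d : ℕ} (G : ShearletGenerator d)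

theorem glEquiv_one (x : Rd d) : glEquiv (1 : GL (Fin d) ℝ) x = x := by
  rw [glEquiv_apply]
  ext i
  simp

theorem matrixDilate_one (g : 𝓢(Rd d, ℂ)) : matrixDilate 1 g = g := by
  ext x
  rw [matrixDilate_apply, inv_one, glEquiv_one]
  simp

/-- The generators `Ψ` (for `none`) and `ψ^{(i)}` of the frame elements. -/
noncomputable def ShearletGenerator.frameGen : Option (ShearIndex d) → 𝓢(Rd d, ℂ)
  | none => G.Psi
  | some I => G.psi I.1

/-- The dilations of the frame elements. -/
noncomputable def frameMatrix : Option (ShearIndex d) → GL (Fin d) ℝ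
  | none => 1
  | some I => shearletMatrix I

theorem ShearletGenerator.fourier_frameGen_eq_zero (t : Option (ShearIndex d)) {η : Rd d}
    (h : ∃ k, 1 / 2 ≤ |η k|) : 𝓕 (G.frameGen t) η = 0 := by
  cases t with
  | none =>
    obtain ⟨k, hk⟩ := h
    by_contra h0
    have := G.support_Psi (subset_tsupport _ h0) k
    linarith
  | some I => exact (G.fourier_psi I.1 η).trans (G.psiHat_eq_zero h)

theorem ShearletGenerator.hasCompactSupport_fourier_frameGen (t : Option (ShearIndex d)) :
    HasCompactSupport (𝓕 (G.frameGen t) : 𝓢(Rd d, ℂ)) := by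
  refine HasCompactSupport.of_support_subset_isCompact
    (isCompact_closedBall (0 : Rd d) (Real.sqrt (∑ _k : Fin d, (1 / 2 : ℝ) ^ 2))) fun ξ hξ => ?_
  have h3 : ∀ k, |ξ k| ≤ 1 / 2 := by
    intro k
    by_contra! h
    exact hξ (G.fourier_frameGen_eq_zero t ⟨k, h.le⟩)
  rw [mem_closedBall_zero_iff, EuclideanSpace.norm_eq]
  refine Real.sqrt_le_sqrt (Finset.sum_le_sum fun k _ => ?_)
  exact pow_le_pow_left₀ (norm_nonneg _) (h3 k) 2

/-- By compactness finitely many frame transforms u_t have no common zero on the support of 𝓕 g.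
Dividing 𝓕 g by ∑ |u_t|² and multiplying by the conjugate of u_t gives the multipliers. No
uniformity is sought, as g is fixed. -/
theorem ShearletGenerator.exists_decomposition (g : 𝓢(Rd d, ℂ)) (hg : HasCompactSupport (𝓕 g : 𝓢(Rd d, ℂ))) :
    ∃ (F : Finset (Option (ShearIndex d))) (m : Option (ShearIndex d) → 𝓢(Rd d, ℂ)),
      (∀ t, ∀ η : Rd d, (∃ k, 1 / 2 ≤ |η k|) → m t η = 0) ∧
      ∀ ξ, 𝓕 g ξ = ∑ t ∈ F, m t (glEquiv (glTranspose (frameMatrix t)) ξ) *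
        𝓕 (G.frameGen t) (glEquiv (glTranspose (frameMatrix t)) ξ) := by
  set L : Option (ShearIndex d) → Rd d ≃L[ℝ] Rd d :=
    fun t => glEquiv (glTranspose (frameMatrix t)) with hL
  set u : Option (ShearIndex d) → Rd d → ℂ := fun t ξ => 𝓕 (G.frameGen t) (L t ξ) with hu
  have husm : ∀ t, ContDiff ℝ (⊤ : ℕ∞) (u t) := fun t =>
    ((𝓕 (G.frameGen t)).smooth ⊤).comp (L t).contDiff
  have hcov : ∀ ξ, ∃ t, u t ξ ≠ 0 := by
    intro ξ
    rcases G.exists_psiDilated_ne_zero ξ with h | ⟨I, h⟩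
    · refine ⟨none, ?_⟩
      change 𝓕 G.Psi (glEquiv (glTranspose 1) ξ) ≠ 0
      have h1 : glTranspose (1 : GL (Fin d) ℝ) = 1 := by
        exact Units.ext Matrix.transpose_one
      rwa [h1, glEquiv_one]
    · refine ⟨some I, ?_⟩
      rw [G.psiDilated_eq, fourier_matrixDilate'] at h
      exact h
  obtain ⟨F, hF⟩ := IsCompact.elim_finite_subcover (s := tsupport (𝓕 g : 𝓢(Rd d, ℂ))) hg
    (fun t => {ξ | u t ξ ≠ 0})
    (fun t => isOpen_ne_fun (husm t).continuous continuous_const)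
    (fun ξ _ => Set.mem_iUnion.2 (hcov ξ))
  set W : Rd d → ℂ := fun ξ => ∑ t ∈ F, (starRingEnd ℂ) (u t ξ) * u t ξ with hW
  have hWsm : ContDiff ℝ (⊤ : ℕ∞) W := by
    refine ContDiff.sum fun t _ => ContDiff.mul ?_ (husm t)
    exact Complex.conjCLE.contDiff.comp (husm t)
  have hW0 : ∀ ξ ∈ tsupport (𝓕 g : 𝓢(Rd d, ℂ)), W ξ ≠ 0 := by
    intro ξ hξ
    obtain ⟨t, ht, h0⟩ := Set.mem_iUnion₂.1 (hF hξ)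
    have h1 : W ξ = ((∑ t ∈ F, ‖u t ξ‖ ^ 2 : ℝ) : ℂ) := by
      rw [hW]
      push_cast
      exact Finset.sum_congr rfl fun t _ => Complex.conj_mul' _
    rw [h1]
    have h2 : 0 < ∑ t ∈ F, ‖u t ξ‖ ^ 2 := by
      refine Finset.sum_pos' (fun t _ => by positivity) ⟨t, ht, ?_⟩
      have := norm_pos_iff.2 h0
      positivity
    exact_mod_cast h2.ne'
  set κ : Rd d → ℂ := fun ξ => 𝓕 g ξ * (W ξ)⁻¹ with hκ
  have hκsm : ContDiff ℝ (⊤ : ℕ∞) κ := by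
    rw [contDiff_iff_contDiffAt]
    intro ξ
    by_cases hξ : ξ ∈ tsupport (𝓕 g : 𝓢(Rd d, ℂ))
    · exact ((𝓕 g).smooth ⊤).contDiffAt.mul (hWsm.contDiffAt.inv (hW0 ξ hξ))
    · have h0 : κ =ᶠ[𝓝 ξ] fun _ => 0 := by
        filter_upwards [(isClosed_tsupport (𝓕 g : 𝓢(Rd d, ℂ))).isOpen_compl.mem_nhds hξ] with η hη
        rw [hκ]
        simp only
        rw [image_eq_zero_of_notMem_tsupport hη, zero_mul]
      exact contDiffAt_const.congr_of_eventuallyEq h0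
  have hmsm : ∀ t, ContDiff ℝ (⊤ : ℕ∞)
      (fun η => (starRingEnd ℂ) (𝓕 (G.frameGen t) η) * κ ((L t).symm η)) := fun t =>
    (Complex.conjCLE.contDiff.comp ((𝓕 (G.frameGen t)).smooth ⊤)).mul
      (hκsm.comp (L t).symm.contDiff)
  have hmcs : ∀ t, HasCompactSupport
      (fun η => (starRingEnd ℂ) (𝓕 (G.frameGen t) η) * κ ((L t).symm η)) := fun t =>
    ((G.hasCompactSupport_fourier_frameGen t).comp_left (g := starRingEnd ℂ) (map_zero _)).mul_right
  refine ⟨F, fun t => (hmcs t).toSchwartzMap (hmsm t), fun t η hη => ?_, fun ξ => ?_⟩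
  · change (starRingEnd ℂ) (𝓕 (G.frameGen t) η) * κ ((L t).symm η) = 0
    rw [G.fourier_frameGen_eq_zero t hη]
    simp
  · have h1 : ∀ t ∈ F, (hmcs t).toSchwartzMap (hmsm t) (glEquiv (glTranspose (frameMatrix t)) ξ) *
        𝓕 (G.frameGen t) (glEquiv (glTranspose (frameMatrix t)) ξ) =
        (starRingEnd ℂ) (u t ξ) * u t ξ * κ ξ := by
      intro t _
      change (starRingEnd ℂ) (u t ξ) * κ ((L t).symm (L t ξ)) * u t ξ = _
      rw [ContinuousLinearEquiv.symm_apply_apply]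
      ring
    rw [Finset.sum_congr rfl h1, ← Finset.sum_mul]
    change _ = W ξ * (𝓕 g ξ * (W ξ)⁻¹)
    by_cases hξ : ξ ∈ tsupport (𝓕 g : 𝓢(Rd d, ℂ))
    · rw [mul_left_comm, mul_inv_cancel₀ (hW0 ξ hξ), mul_one]
    · rw [image_eq_zero_of_notMem_tsupport hξ]
      simp

theorem eLpNorm_frame_le {q : ℝ≥0∞} (hq : 0 < q) (α : ℝ) (p : ℝ≥0∞) (t : Option (ShearIndex d)) :
    ∃ D : ℝ≥0∞, D ≠ ∞ ∧ ∀ f : 𝓢'(Rd d, ℂ),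
      eLpNorm (conv f (matrixDilate (frameMatrix t) (G.frameGen t))) p volume ≤
        D * shearBesovNorm G α p q f := by
  cases t with
  | none =>
    refine ⟨1, ENNReal.one_ne_top, fun f => ?_⟩
    change eLpNorm (conv f (matrixDilate 1 G.Psi)) p volume ≤ _
    rw [matrixDilate_one, one_mul]
    exact le_self_add
  | some I => exact ⟨_, ENNReal.ofReal_ne_top, fun f => eLpNorm_psiDilated_le G hq α p f I⟩

theorem exists_eLpNorm_conv_le {p q : ℝ≥0∞} (hp : 0 < p) (hq : 0 < q) (α : ℝ) (g : 𝓢(Rd d, ℂ))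
    (hg : HasCompactSupport (𝓕 g : 𝓢(Rd d, ℂ))) :
    ∃ C : ℝ≥0∞, C ≠ ∞ ∧ ∀ f : 𝓢'(Rd d, ℂ),
      eLpNorm (conv f g) p volume ≤ C * shearBesovNorm G α p q f := by
  have hr := subExp_pos hp
  obtain ⟨F, m, hm, hdec⟩ := G.exists_decomposition g hg
  choose D hD hDle using fun t => eLpNorm_frame_le G hq α p t
  refine ⟨(∑ t ∈ F, (∑' n : Fin d → ℤ, ‖𝓕 (m t) (latticePt n)‖ₑ ^ subExp p) *
    D t ^ subExp p) ^ (subExp p)⁻¹, ?_, fun f => ?_⟩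
  · refine ENNReal.rpow_ne_top_of_nonneg (inv_nonneg.2 hr.le) (ENNReal.sum_ne_top.2 fun t _ => ?_)
    exact ENNReal.mul_ne_top (tsum_fourier_latticePt_ne_top hp (m t))
      (ENNReal.rpow_ne_top_of_nonneg hr.le (hD t))
  · rw [← ENNReal.rpow_le_rpow_iff hr, ENNReal.mul_rpow_of_nonneg _ _ hr.le,
      ENNReal.rpow_inv_rpow hr.ne', Finset.sum_mul]
    refine (eLpNorm_conv_decomposition_le hp f F frameMatrix m G.frameGen g hm
      (fun t η ⟨k, hk⟩ => G.fourier_frameGen_eq_zero t ⟨k, hk.le⟩) hdec).trans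
      (Finset.sum_le_sum fun t _ => ?_)
    rw [mul_assoc, ← ENNReal.mul_rpow_of_nonneg _ _ hr.le]
    gcongr
    exact hDle t f

end CompactFrequency

/-! ### Partition of unity and dual profiles -/

section Profiles

/-- A smooth bump whose integer translates sum to one. -/
noncomputable def bump (x : ℝ) : ℝ := Real.smoothTransition (x + 1) - Real.smoothTransition x

theorem contDiff_bump : ContDiff ℝ (⊤ : ℕ∞) bump :=
  (Real.smoothTransition.contDiff.comp (contDiff_id.add contDiff_const)).sub
    Real.smoothTransition.contDiff

theorem bump_eq_zero {x : ℝ} (hx : 1 ≤ |x|) : bump x = 0 := by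
  unfold bump
  rcases le_abs.1 hx with h | h
  · rw [Real.smoothTransition.one_of_one_le h, Real.smoothTransition.one_of_one_le (by linarith),
      sub_self]
  · rw [Real.smoothTransition.zero_of_nonpos (by linarith),
      Real.smoothTransition.zero_of_nonpos (by linarith), sub_self]

/-- The sum telescopes to two values of the smooth step, which are 1 and 0. -/
theorem sum_bump (x : ℝ) (N : ℕ) (hx : |x| ≤ N) :
    ∑ n ∈ Finset.Icc (-(N : ℤ)) N, bump (x - n) = 1 := by
  have key : ∀ K : ℕ, ∑ n ∈ Finset.Icc (-(K : ℤ)) K, bump (x - n) =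
      Real.smoothTransition (x + K + 1) - Real.smoothTransition (x - K) := by
    intro K
    induction K with
    | zero => simp [bump]
    | succ K ih =>
      have h1 : Finset.Icc (-((K + 1 : ℕ) : ℤ)) ((K + 1 : ℕ) : ℤ) =
          insert (-((K : ℤ) + 1)) (insert ((K : ℤ) + 1) (Finset.Icc (-(K : ℤ)) K)) := by
        ext n
        simp only [Finset.mem_Icc, Finset.mem_insert]
        omega
      rw [h1, Finset.sum_insert, Finset.sum_insert, ih]
      · unfold bump
        push_cast
        ring_nf
      · simp
      · simp only [Finset.mem_insert, Finset.mem_Icc]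
        omega
  rw [key, Real.smoothTransition.one_of_one_le, Real.smoothTransition.zero_of_nonpos, sub_zero]
  · linarith [le_abs_self x]
  · linarith [neg_abs_le x]

/-- A smooth function on the line, equal to `1 / t` for `t ≥ 1/16`. -/
noncomputable def cutInv (t : ℝ) : ℝ := Real.smoothTransition (32 * t - 1) * t⁻¹

theorem contDiff_cutInv : ContDiff ℝ (⊤ : ℕ∞) cutInv := by
  rw [contDiff_iff_contDiffAt]
  intro t
  by_cases ht : t < 1 / 32
  · have h0 : cutInv =ᶠ[𝓝 t] fun _ => 0 := by
      filter_upwards [Iio_mem_nhds ht] with x hx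
      rw [cutInv, Real.smoothTransition.zero_of_nonpos, zero_mul]
      have : x < 1 / 32 := hx
      linarith
    exact contDiffAt_const.congr_of_eventuallyEq h0
  · have h1 : t ≠ 0 := by
      rintro rfl
      norm_num at ht
    exact (Real.smoothTransition.contDiff.comp
      ((contDiff_const.mul contDiff_id).sub contDiff_const)).contDiffAt.mul (contDiffAt_id.inv h1)

theorem cutInv_mul {t : ℝ} (ht : 1 / 16 ≤ t) : cutInv t * t = 1 := by
  rw [cutInv, Real.smoothTransition.one_of_one_le (by linarith), one_mul,
    inv_mul_cancel₀ (by linarith)]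

variable {d : ℕ} (G : ShearletGenerator d)

/-- A smooth function, inverse to `ψ̂₂` where `|ψ̂₂| ≥ 1/4` and vanishing with `ψ̂₂`. -/
noncomputable def ShearletGenerator.psi2Inv (x : ℝ) : ℂ :=
  (starRingEnd ℂ) (G.psi2 x) * (cutInv (‖G.psi2 x‖ ^ 2) : ℝ)

theorem ShearletGenerator.contDiff_psi2Inv : ContDiff ℝ (⊤ : ℕ∞) G.psi2Inv := by
  refine (Complex.conjCLE.contDiff.comp G.contDiff_psi2).mul ?_
  exact Complex.ofRealCLM.contDiff.comp (contDiff_cutInv.comp (G.contDiff_psi2.norm_sq ℝ))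

theorem ShearletGenerator.psi2Inv_mul {x : ℝ} (hx : 1 / 4 ≤ ‖G.psi2 x‖) :
    G.psi2Inv x * G.psi2 x = 1 := by
  have h1 : (1 : ℝ) / 16 ≤ ‖G.psi2 x‖ ^ 2 := by nlinarith
  have h2 := cutInv_mul h1
  rw [ShearletGenerator.psi2Inv, mul_right_comm, Complex.conj_mul', mul_comm]
  exact_mod_cast h2

theorem ShearletGenerator.psi2Inv_eq_zero {x : ℝ} (hx : 1 ≤ |x|) : G.psi2Inv x = 0 := by
  rw [ShearletGenerator.psi2Inv, G.psi2_eq_zero' hx]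
  simp

/-- The part of `ψ̂₁` on the half-line of sign `σ`. -/
noncomputable def ShearletGenerator.psi1Half (σ : ℝ) (x : ℝ) : ℂ := if 0 < σ * x then G.psi1 x else 0

/-- The cut at 0 is harmless because ψ̂₁ vanishes near 0. Fixing the sign of ξ_i makes ξ/‖ξ‖ a
function of the slopes. -/
theorem ShearletGenerator.contDiff_psi1Half (σ : ℝ) : ContDiff ℝ (⊤ : ℕ∞) (G.psi1Half σ) := by
  rw [contDiff_iff_contDiffAt]
  intro x
  rcases lt_trichotomy (σ * x) 0 with h | h | h
  · have h1 : ∀ᶠ y in 𝓝 x, σ * y < 0 :=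
      (continuous_const.mul continuous_id).continuousAt.eventually (gt_mem_nhds h)
    refine (contDiffAt_const (c := 0)).congr_of_eventuallyEq ?_
    filter_upwards [h1] with y hy
    rw [ShearletGenerator.psi1Half, if_neg hy.not_gt]
  · refine (contDiffAt_const (c := 0)).congr_of_eventuallyEq ?_
    rcases mul_eq_zero.1 h with h0 | h0
    · filter_upwards with y
      simp [ShearletGenerator.psi1Half, h0]
    · have h1 : ∀ᶠ y in 𝓝 x, |y| < 1 / 16 :=
        continuous_abs.continuousAt.eventually (gt_mem_nhds (by rw [h0]; norm_num))
      filter_upwards [h1] with y hy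
      rw [ShearletGenerator.psi1Half, G.psi1_eq_zero (Or.inl hy), ite_self]
  · have h1 : ∀ᶠ y in 𝓝 x, 0 < σ * y :=
      (continuous_const.mul continuous_id).continuousAt.eventually (lt_mem_nhds h)
    refine G.contDiff_psi1.contDiffAt.congr_of_eventuallyEq ?_
    filter_upwards [h1] with y hy
    rw [ShearletGenerator.psi1Half, if_pos hy]

theorem ShearletGenerator.psi1Half_eq_zero (σ : ℝ) {x : ℝ} (hx : |x| < 1 / 16 ∨ 1 / 2 ≤ |x|) :
    G.psi1Half σ x = 0 := by
  rw [ShearletGenerator.psi1Half]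
  have : G.psi1 x = 0 := by
    rcases hx with hx | hx
    · exact G.psi1_eq_zero (Or.inl hx)
    · exact G.psi1_eq_zero' hx
  rw [this, ite_self]

/-- The dual profile to `ψ̂^{(i)}` on the half-space of sign `σ`. -/
noncomputable def ShearletGenerator.dualHat (i : Fin d) (σ : ℝ) (η : Rd d) : ℂ :=
  (starRingEnd ℂ) (G.psi1Half σ (η i)) * ∏ k ∈ Finset.univ.erase i, G.psi2Inv (η k / η i)

theorem ShearletGenerator.dualHat_eq_zero {i : Fin d} (σ : ℝ) {η : Rd d}
    (h : ∃ k, 1 / 2 ≤ |η k|) : G.dualHat i σ η = 0 := by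
  obtain ⟨k, hk⟩ := h
  unfold ShearletGenerator.dualHat
  by_cases hi : |η i| < 1 / 16 ∨ 1 / 2 ≤ |η i|
  · rw [G.psi1Half_eq_zero σ hi, map_zero, zero_mul]
  push Not at hi
  have hki : k ≠ i := by
    rintro rfl
    linarith
  rw [Finset.prod_eq_zero (i := k) (by simp [hki]), mul_zero]
  refine G.psi2Inv_eq_zero ?_
  rw [abs_div, one_le_div (by linarith)]
  linarith

end Profiles

/-! ### Uniform Fourier decay over compact parameter sets -/

section UniformDecay

variable {d : ℕ} {P : Type*} [NormedAddCommGroup P] [NormedSpace ℝ P]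

/-- A derivative of the slice at θ is the full derivative of F restricted to the first factor, and
the latter is bounded on a compact product containing all the relevant points. -/
theorem exists_seminorm_le_of_contDiff {F : Rd d × P → ℂ} (hF : ContDiff ℝ (⊤ : ℕ∞) F)
    (hF0 : ∀ η θ, (∃ k, 1 / 2 ≤ |η k|) → F (η, θ) = 0) {Θ : Set P} (hΘ : IsCompact Θ) (k l : ℕ) :
    ∃ B : ℝ, 0 ≤ B ∧ ∀ θ ∈ Θ, ∀ m : 𝓢(Rd d, ℂ), (∀ η, m η = F (η, θ)) →
      SchwartzMap.seminorm ℝ k l m ≤ B := by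
  set R : ℝ := Real.sqrt (∑ _k : Fin d, (1 / 2 : ℝ) ^ 2) with hR
  have hsub : ∀ m : 𝓢(Rd d, ℂ), (∀ η, (∃ k, 1 / 2 ≤ |η k|) → m η = 0) →
      tsupport m ⊆ Metric.closedBall 0 R := by
    intro m hm
    refine closure_minimal (fun ξ hξ => ?_) Metric.isClosed_closedBall
    have h3 : ∀ k, |ξ k| ≤ 1 / 2 := by
      intro k
      by_contra! h
      exact hξ (hm ξ ⟨k, h.le⟩)
    rw [mem_closedBall_zero_iff, EuclideanSpace.norm_eq]
    refine Real.sqrt_le_sqrt (Finset.sum_le_sum fun k _ => ?_)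
    exact pow_le_pow_left₀ (norm_nonneg _) (h3 k) 2
  have hcont : Continuous (iteratedFDeriv ℝ l F) :=
    hF.continuous_iteratedFDeriv (by exact_mod_cast le_top)
  obtain ⟨B, hB⟩ := ((isCompact_closedBall (0 : Rd d) R).prod hΘ).exists_bound_of_continuousOn
    hcont.continuousOn
  refine ⟨R ^ k * |B|, by positivity, fun θ hθ m hm => ?_⟩
  refine SchwartzMap.seminorm_le_bound ℝ k l m (by positivity) fun x => ?_
  by_cases hx : x ∈ Metric.closedBall (0 : Rd d) R
  · have h1 : iteratedFDeriv ℝ l m x = (iteratedFDeriv ℝ l F (x, θ)).compContinuousLinearMap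
        fun _ => ContinuousLinearMap.inl ℝ (Rd d) P := by
      have h2 : (m : Rd d → ℂ) = (fun z => F (z + (0, θ))) ∘ ContinuousLinearMap.inl ℝ (Rd d) P := by
        funext η
        simp [hm]
      rw [h2, ContinuousLinearMap.iteratedFDeriv_comp_right (i := l) (n := (⊤ : ℕ∞)),
        iteratedFDeriv_comp_add_right]
      · simp
      · exact hF.comp (contDiff_id.add contDiff_const)
      · exact_mod_cast le_top
    have h3 : ‖iteratedFDeriv ℝ l m x‖ ≤ |B| := by
      rw [h1]
      refine (ContinuousMultilinearMap.norm_compContinuousLinearMap_le _ _).trans ?_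
      have h4 : ∏ _i : Fin l, ‖ContinuousLinearMap.inl ℝ (Rd d) P‖ ≤ 1 :=
        Finset.prod_le_one (fun _ _ => norm_nonneg _)
          fun _ _ => ContinuousLinearMap.norm_inl_le_one ℝ (Rd d) P
      have h5 := hB (x, θ) ⟨hx, hθ⟩
      calc _ ≤ ‖iteratedFDeriv ℝ l F (x, θ)‖ * 1 := by gcongr
        _ ≤ |B| := by rw [mul_one]; exact h5.trans (le_abs_self B)
    gcongr
    simpa using hx
  · have h1 : iteratedFDeriv ℝ l m x = 0 := by
      have h2 := tsupport_iteratedFDeriv_subset (𝕜 := ℝ) (f := m) l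
      refine image_eq_zero_of_notMem_tsupport fun h => hx (hsub m ?_ (h2 h))
      intro η hη
      rw [hm, hF0 η θ hη]
    rw [h1, norm_zero, mul_zero]
    positivity

/-- The Fourier transform is continuous on the Schwartz space, so uniform seminorm bounds for the
slices pass to their transforms. -/
theorem exists_fourier_decay_of_contDiff {F : Rd d × P → ℂ} (hF : ContDiff ℝ (⊤ : ℕ∞) F)
    (hF0 : ∀ η θ, (∃ k, 1 / 2 ≤ |η k|) → F (η, θ) = 0) {Θ : Set P} (hΘ : IsCompact Θ) (N : ℕ) :
    ∃ B : ℝ, ∀ θ ∈ Θ, ∀ m : 𝓢(Rd d, ℂ), (∀ η, m η = F (η, θ)) →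
      ∀ ξ, (1 + ‖ξ‖) ^ N * ‖𝓕 m ξ‖ ≤ B := by
  choose B hB0 hB using fun kl : ℕ × ℕ => exists_seminorm_le_of_contDiff hF hF0 hΘ kl.1 kl.2
  have key : ∀ k l : ℕ, ∃ B' : ℝ, 0 ≤ B' ∧ ∀ θ ∈ Θ, ∀ m : 𝓢(Rd d, ℂ), (∀ η, m η = F (η, θ)) →
      SchwartzMap.seminorm ℝ k l (𝓕 m) ≤ B' := by
    intro k l
    let q : Seminorm ℝ 𝓢(Rd d, ℂ) :=
      (SchwartzMap.seminorm ℝ k l).comp (SchwartzMap.fourierTransformCLM ℝ).toLinearMap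
    have hq : Continuous q :=
      ((schwartz_withSeminorms ℝ (Rd d) ℂ).continuous_seminorm (k, l)).comp
        (SchwartzMap.fourierTransformCLM ℝ).continuous
    obtain ⟨s, C, -, hC⟩ := Seminorm.bound_of_continuous (schwartz_withSeminorms ℝ (Rd d) ℂ) q hq
    refine ⟨C * ∑ kl ∈ s, B kl, mul_nonneg C.2 (Finset.sum_nonneg fun kl _ => hB0 kl),
      fun θ hθ m hm => (hC m).trans ?_⟩
    change (C : ℝ) * (s.sup (schwartzSeminormFamily ℝ (Rd d) ℂ)) m ≤ _
    refine mul_le_mul_of_nonneg_left ?_ C.2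
    refine Seminorm.finset_sup_apply_le (Finset.sum_nonneg fun kl _ => hB0 kl) fun kl hkl => ?_
    exact (hB kl θ hθ m hm).trans (Finset.single_le_sum (f := B) (fun kl _ => hB0 kl) hkl)
  choose B' hB0' hB' using fun kl : ℕ × ℕ => key kl.1 kl.2
  refine ⟨2 ^ N * ∑ kl ∈ Finset.Iic (N, 0), B' kl, fun θ hθ m hm ξ => ?_⟩
  have h1 := SchwartzMap.one_add_le_sup_seminorm_apply (𝕜 := ℝ) (m := (N, 0)) le_rfl le_rfl (𝓕 m) ξ
  rw [norm_iteratedFDeriv_zero] at h1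
  refine h1.trans ?_
  gcongr
  refine Seminorm.finset_sup_apply_le (Finset.sum_nonneg fun kl _ => hB0' kl) fun kl hkl => ?_
  exact (hB' kl θ hθ m hm).trans (Finset.single_le_sum (f := B') (fun kl _ => hB0' kl) hkl)

end UniformDecay

/-! ### The window multipliers in shear coordinates -/

section Symbol

variable {d : ℕ}

/-- The point with `i`-th coordinate `1` and the other coordinates those of `u`. -/
noncomputable def axisPt (i : Fin d) (u : Rd d) : Rd d :=
  WithLp.toLp 2 fun k => if k = i then 1 else u k

/-- The slopes `η_k / η_i`, `k ≠ i`. -/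
noncomputable def slopePt (i : Fin d) (η : Rd d) : Rd d :=
  WithLp.toLp 2 fun k => if k = i then 0 else η k / η i

theorem norm_pos_of_coord_eq_one {i : Fin d} {x : Rd d} (h : x i = 1) : 1 ≤ ‖x‖ := by
  have := PiLp.norm_apply_le x i
  rw [h] at this
  simpa using this

theorem axisPt_self (i : Fin d) (u : Rd d) : axisPt i u i = 1 := by simp [axisPt]

theorem axisPt_add_self (i : Fin d) (u η : Rd d) (t : ℝ) :
    (axisPt i u + t • slopePt i η) i = 1 := by simp [axisPt, slopePt]

/-- The difference quotient `t⁻¹ (x_k / |x| - w_k / |w|)` for `x = w + t y`, `w = axisPt i u`,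
`y = slopePt i η`, written so that it is smooth at `t = 0`. -/
noncomputable def directionQuot (i k : Fin d) (t : ℝ) (u η : Rd d) : ℝ :=
  slopePt i η k * ‖axisPt i u + t • slopePt i η‖⁻¹ -
    axisPt i u k * (2 * inner ℝ (axisPt i u) (slopePt i η) + t * ‖slopePt i η‖ ^ 2) *
      (‖axisPt i u + t • slopePt i η‖ * ‖axisPt i u‖ *
        (‖axisPt i u + t • slopePt i η‖ + ‖axisPt i u‖))⁻¹

/-- With a = ‖x‖ and b = ‖w‖, write 1/a - 1/b = -(a² - b²)/(ab(a + b)); the factor t divides a² - b²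
= t (2⟨w, y⟩ + t ‖y‖²). -/
theorem mul_directionQuot (i k : Fin d) (t : ℝ) (u η : Rd d) :
    t * directionQuot i k t u η = (axisPt i u + t • slopePt i η) k / ‖axisPt i u + t • slopePt i η‖ -
      axisPt i u k / ‖axisPt i u‖ := by
  have ha := norm_pos_of_coord_eq_one (axisPt_add_self i u η t)
  have hb := norm_pos_of_coord_eq_one (axisPt_self i u)
  have h := norm_add_sq_real (axisPt i u) (t • slopePt i η)
  rw [inner_smul_right, norm_smul, mul_pow, Real.norm_eq_abs, sq_abs] at h
  have hk : (axisPt i u + t • slopePt i η) k = axisPt i u k + t * slopePt i η k := rfl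
  rw [directionQuot, hk]
  set a := ‖axisPt i u + t • slopePt i η‖
  set b := ‖axisPt i u‖
  have ha' : a ≠ 0 := by positivity
  have hb' : b ≠ 0 := by positivity
  have hab : a + b ≠ 0 := by positivity
  have h2 : t * (2 * inner ℝ (axisPt i u) (slopePt i η) + t * ‖slopePt i η‖ ^ 2) =
      (a - b) * (a + b) := by linear_combination -h
  have h3 : t * (axisPt i u k * (2 * inner ℝ (axisPt i u) (slopePt i η) + t * ‖slopePt i η‖ ^ 2) *
      (a * b * (a + b))⁻¹) = axisPt i u k * ((a - b) * (a + b)) * (a * b * (a + b))⁻¹ := by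
    rw [← h2]; ring
  rw [mul_sub, h3]
  field_simp
  ring

variable (G : ShearletGenerator d)

/-- The parameters `(a, t, u, s, c)` of `windowSymbol`. -/
abbrev SymbolParam (d : ℕ) : Type := ℝ × ℝ × Rd d × ℝ × Rd d

/-- The Fourier multiplier attached to a window, in the coordinates of a frame element. -/
noncomputable def ShearletGenerator.windowSymbol (φ : 𝓢(Rd d, ℂ)) (i : Fin d) (σ : ℝ)
    (z : Rd d × SymbolParam d) : ℂ :=
  G.dualHat i σ z.1 *
    𝓕 φ (z.2.1 • z.1 i • (axisPt i z.2.2.2.1 + z.2.2.1 • slopePt i z.1)) *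
    ((∏ k, bump (σ * (z.2.2.2.2.1 * directionQuot i k z.2.2.1 z.2.2.2.1 z.1) +
      z.2.2.2.2.2 k) : ℝ) : ℂ)

/-- Joint smoothness includes t = 0, the limit of large scales. The window variable A ω_k - n_k,
with A large, has been split into (A t) times a smooth quotient plus a constant c, both of which
remain bounded. The norms in denominators are at least 1, and near η_i = 0 the dual profile
vanishes. -/
theorem ShearletGenerator.contDiff_windowSymbol (φ : 𝓢(Rd d, ℂ)) (i : Fin d) (σ : ℝ) :
    ContDiff ℝ (⊤ : ℕ∞) (G.windowSymbol φ i σ) := by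
  rw [contDiff_iff_contDiffAt]
  intro z
  have hc : ∀ k : Fin d, ContDiff ℝ (⊤ : ℕ∞) (fun z : Rd d × SymbolParam d => z.1 k) := fun k => by
    fun_prop
  by_cases hz : z.1 i = 0
  · have h1 : ∀ᶠ y : Rd d × SymbolParam d in 𝓝 z, |y.1 i| < 1 / 16 :=
      (hc i).continuous.abs.continuousAt.eventually (gt_mem_nhds (by simp [hz]))
    refine (contDiffAt_const (c := 0)).congr_of_eventuallyEq ?_
    filter_upwards [h1] with y hy
    rw [ShearletGenerator.windowSymbol, ShearletGenerator.dualHat,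
      G.psi1Half_eq_zero σ (Or.inl hy)]
    simp
  · have hdual : ContDiffAt ℝ (⊤ : ℕ∞) (fun z : Rd d × SymbolParam d => G.dualHat i σ z.1) z := by
      unfold ShearletGenerator.dualHat
      refine ContDiffAt.mul ?_ ?_
      · exact (Complex.conjCLE.contDiff.comp ((G.contDiff_psi1Half σ).comp (hc i))).contDiffAt
      · refine contDiffAt_prod fun k _ => ?_
        exact G.contDiff_psi2Inv.contDiffAt.comp z ((hc k).contDiffAt.div (hc i).contDiffAt hz)
    have hw : ContDiffAt ℝ (⊤ : ℕ∞) (fun z : Rd d × SymbolParam d => axisPt i z.2.2.2.1) z := by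
      rw [contDiffAt_euclidean]
      intro k
      by_cases hk : k = i
      · simpa [axisPt, hk] using contDiffAt_const
      · simp only [axisPt, hk, if_false]
        fun_prop
    have hy : ContDiffAt ℝ (⊤ : ℕ∞) (fun z : Rd d × SymbolParam d => slopePt i z.1) z := by
      rw [contDiffAt_euclidean]
      intro k
      by_cases hk : k = i
      · simpa [slopePt, hk] using contDiffAt_const
      · simp only [slopePt, hk, if_false]
        exact (hc k).contDiffAt.div (hc i).contDiffAt hz
    have ht : ContDiffAt ℝ (⊤ : ℕ∞) (fun z : Rd d × SymbolParam d => z.2.2.1) z := by fun_prop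
    have hs : ContDiffAt ℝ (⊤ : ℕ∞) (fun z : Rd d × SymbolParam d => z.2.2.2.2.1) z := by fun_prop
    have ha : ContDiffAt ℝ (⊤ : ℕ∞) (fun z : Rd d × SymbolParam d => z.2.1) z := by fun_prop
    have hx := hw.add (ht.smul hy)
    have hx1 := norm_pos_of_coord_eq_one (axisPt_add_self i z.2.2.2.1 z.1 z.2.2.1)
    have hw1 := norm_pos_of_coord_eq_one (axisPt_self i z.2.2.2.1)
    have hnx := hx.norm ℝ (norm_pos_iff.1 (lt_of_lt_of_le one_pos hx1))
    have hnw := hw.norm ℝ (norm_pos_iff.1 (lt_of_lt_of_le one_pos hw1))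
    unfold ShearletGenerator.windowSymbol
    refine (hdual.mul ?_).mul ?_
    · exact ((𝓕 φ).smooth ⊤).contDiffAt.comp z (ha.smul ((hc i).contDiffAt.smul hx))
    · have hprod : ContDiffAt ℝ (⊤ : ℕ∞) (fun z : Rd d × SymbolParam d =>
          ∏ k, bump (σ * (z.2.2.2.2.1 * directionQuot i k z.2.2.1 z.2.2.2.1 z.1) +
            z.2.2.2.2.2 k)) z := ?_
      · exact Complex.ofRealCLM.contDiff.contDiffAt.comp z hprod
      refine contDiffAt_prod fun k _ => ?_
      refine contDiff_bump.contDiffAt.comp z ((contDiffAt_const.mul (hs.mul ?_)).add (by fun_prop))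
      unfold directionQuot
      have hyk := contDiffAt_euclidean.1 hy k
      have hwk := contDiffAt_euclidean.1 hw k
      refine (hyk.mul (hnx.inv (by positivity))).sub ((hwk.mul ?_).mul (ContDiffAt.inv ?_ ?_))
      · exact (contDiffAt_const.mul (hw.inner ℝ hy)).add (ht.mul (hy.norm_sq ℝ))
      · exact (hnx.mul hnw).mul (hnx.add hnw)
      · positivity

/-- The parameters of `windowSymbol` belonging to a frame element and a window. -/
noncomputable def windowParam (I : ShearIndex d) (ν : ℕ) (A σ : ℝ) (n : Fin d → ℤ) :
    SymbolParam d :=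
  let u : Rd d := WithLp.toLp 2 fun k => if h : k ≠ I.1 then I.2.2.1 ⟨k, h⟩ / 2 ^ I.2.1 else 0
  (4 ^ I.2.1 / 2 ^ ν, (2 ^ I.2.1)⁻¹, u, A * (2 ^ I.2.1)⁻¹,
    WithLp.toLp 2 fun k => σ * (A * (axisPt I.1 u k / ‖axisPt I.1 u‖)) - n k)

theorem eq_smul_axisPt (I : ShearIndex d) (ν : ℕ) (A σ : ℝ) (n : Fin d → ℤ) (ξ : Rd d)
    (hξ : ξ I.1 ≠ 0) :
    ξ = ξ I.1 • (axisPt I.1 (windowParam I ν A σ n).2.2.1 +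
      (windowParam I ν A σ n).2.1 • slopePt I.1 (shearCoord I ξ)) := by
  ext k
  by_cases hk : k = I.1
  · simp [axisPt, slopePt, hk]
  · simp only [windowParam, axisPt, slopePt, PiLp.smul_apply, PiLp.add_apply, hk, if_false,
      smul_eq_mul, shearCoord_div I ξ hξ k hk, dif_pos (show k ≠ I.1 from hk)]
    have h2 : (2 : ℝ) ^ I.2.1 ≠ 0 := by positivity
    field_simp
    ring

theorem ShearletGenerator.windowSymbol_shearCoord (φ : 𝓢(Rd d, ℂ)) (I : ShearIndex d) (ν : ℕ)
    (A σ : ℝ) (hσ : |σ| = 1) (n : Fin d → ℤ) (ξ : Rd d) :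
    G.windowSymbol φ I.1 σ (shearCoord I ξ, windowParam I ν A σ n) =
      G.dualHat I.1 σ (shearCoord I ξ) * 𝓕 φ (((2 : ℝ) ^ ν)⁻¹ • ξ) *
        ((∏ k, bump (A * (ξ k / ‖ξ‖) - n k) : ℝ) : ℂ) := by
  -- On the wrong half-space both sides vanish. Otherwise ξ = ξ_i X with σ ξ_i > 0, so that ξ/‖ξ‖ =
  -- σ X/‖X‖.
  by_cases hs : 0 < σ * shearCoord I ξ I.1
  swap
  · have : G.dualHat I.1 σ (shearCoord I ξ) = 0 := by
      rw [ShearletGenerator.dualHat, ShearletGenerator.psi1Half, if_neg hs]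
      simp
    simp only [ShearletGenerator.windowSymbol, this, zero_mul]
  rw [shearCoord_self] at hs
  have h4 : (0 : ℝ) < 4 ^ I.2.1 := by positivity
  have hs' : 0 < σ * ξ I.1 := by
    rw [← mul_div_assoc] at hs
    exact (div_pos_iff_of_pos_right h4).1 hs
  have hξ : ξ I.1 ≠ 0 := by
    intro h
    rw [h, mul_zero] at hs'
    exact lt_irrefl _ hs'
  have hX := eq_smul_axisPt I ν A σ n ξ hξ
  rw [ShearletGenerator.windowSymbol]
  congr 2
  · congr 1
    dsimp only
    rw [shearCoord_self, div_eq_mul_inv, mul_comm, mul_smul, ← hX, smul_smul]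
    congr 1
    simp only [windowParam]
    field_simp
  · congr 1
    funext k
    congr 1
    have hq := mul_directionQuot I.1 k (windowParam I ν A σ n).2.1 (windowParam I ν A σ n).2.2.1
      (shearCoord I ξ)
    set X := axisPt I.1 (windowParam I ν A σ n).2.2.1 +
      (windowParam I ν A σ n).2.1 • slopePt I.1 (shearCoord I ξ) with hXdef
    have h1 : ξ k / ‖ξ‖ = σ * (X k / ‖X‖) := by
      have h2 : ξ k = ξ I.1 * X k := by
        conv_lhs => rw [hX]
        rfl
      have h3 : ‖ξ‖ = σ * ξ I.1 * ‖X‖ := by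
        conv_lhs => rw [hX]
        rw [norm_smul, Real.norm_eq_abs, ← abs_of_pos hs', abs_mul, hσ, one_mul]
      have h5 : σ * σ = 1 := by
        rw [← abs_mul_abs_self, hσ, one_mul]
      have hX1 := norm_pos_of_coord_eq_one
        (axisPt_add_self I.1 (windowParam I ν A σ n).2.2.1 (shearCoord I ξ) (windowParam I ν A σ n).2.1)
      have hX0 : ‖X‖ ≠ 0 := by positivity
      have hσ0 : σ ≠ 0 := by
        rintro rfl
        simp at hσ
      rw [h2, h3]
      field_simp
      linear_combination -(X k) * h5
    rw [h1]
    have h6 : (windowParam I ν A σ n).2.2.2.1 = A * (windowParam I ν A σ n).2.1 := rfl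
    have h7 : (windowParam I ν A σ n).2.2.2.2 k = σ * (A * (axisPt I.1 (windowParam I ν A σ n).2.2.1 k /
      ‖axisPt I.1 (windowParam I ν A σ n).2.2.1‖)) - n k := rfl
    dsimp only
    rw [h6, h7, mul_assoc A, hq]
    ring

end Symbol

/-! ### Geometry and number of the windows on the sphere -/

section Windows

variable {d : ℕ}

theorem norm_le_sqrt_mul {x : Rd d} {r : ℝ} (hr : 0 ≤ r) (h : ∀ k, |x k| ≤ r) :
    ‖x‖ ≤ Real.sqrt d * r := by
  rw [EuclideanSpace.norm_eq]
  calc Real.sqrt (∑ k, ‖x k‖ ^ 2) ≤ Real.sqrt (∑ _k : Fin d, r ^ 2) := by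
        refine Real.sqrt_le_sqrt (Finset.sum_le_sum fun k _ => ?_)
        exact pow_le_pow_left₀ (norm_nonneg _) (h k) 2
    _ = Real.sqrt d * r := by
        rw [Finset.sum_const, Finset.card_univ, Fintype.card_fin, nsmul_eq_mul,
          Real.sqrt_mul (Nat.cast_nonneg d), Real.sqrt_sq hr]

/-- The lattice points whose window of size `1/A` meets the unit sphere in `ω`. -/
def IsWindowPt (A : ℝ) (n : Fin d → ℤ) (ω : Rd d) : Prop :=
  ‖ω‖ = 1 ∧ ∀ k, |A * ω k - n k| < 1

theorem IsWindowPt.norm_sub_le {A : ℝ} {n : Fin d → ℤ} {ω : Rd d} (hA : 0 ≤ A)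
    (h : IsWindowPt A n ω) : |A - ‖latticePt n‖| ≤ Real.sqrt d := by
  have h1 : ‖A • ω - latticePt n‖ ≤ Real.sqrt d * 1 :=
    norm_le_sqrt_mul zero_le_one fun k => (h.2 k).le
  have h2 := abs_norm_sub_norm_le (A • ω) (latticePt n)
  rw [norm_smul, h.1, mul_one, Real.norm_of_nonneg hA] at h2
  linarith

/-- Balls of radius 1/2 around lattice points are disjoint and lie in a shell of radius A and
thickness 2(R + 1), whose volume is O(A^{d-1}). -/
theorem card_annulus_le (d : ℕ) (hd : 0 < d) (R : ℝ) (hR : 0 ≤ R) :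
    ∃ K : ℝ, 0 ≤ K ∧ ∀ (A : ℝ) (s : Finset (Fin d → ℤ)), R + 1 ≤ A →
      (∀ n ∈ s, |A - ‖latticePt n‖| ≤ R) → (s.card : ℝ) ≤ K * A ^ (d - 1) := by
  have : Nonempty (Fin d) := ⟨⟨0, hd⟩⟩
  -- The factor 2^d offsets the volume of a ball of radius 1/2; the rest bounds (A + R + 1)^d - (A -
  -- R - 1)^d, using A + R + 1 ≤ 2A.
  refine ⟨2 ^ d * (2 * (R + 1) * d * 2 ^ (d - 1)), by positivity, fun A s hA hs => ?_⟩
  set μ : Measure (Rd d) := volume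
  set v := μ.real (Metric.ball 0 1) with hv
  have hv0 : 0 < v := by
    rw [hv, Measure.real]
    exact ENNReal.toReal_pos (Metric.measure_ball_pos μ 0 one_pos).ne' measure_ball_lt_top.ne
  have hball : ∀ (x : Rd d) (r : ℝ), 0 ≤ r → μ.real (Metric.ball x r) = r ^ d * v := by
    intro x r hr
    rw [Measure.real, Measure.addHaar_ball μ x hr, ENNReal.toReal_mul,
      ENNReal.toReal_ofReal (by positivity), finrank_euclideanSpace, Fintype.card_fin]
    rfl
  have hdisj : Set.PairwiseDisjoint (s : Set (Fin d → ℤ))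
      fun n => Metric.ball (latticePt n) (1 / 2 : ℝ) := by
    intro n _ n' _ hnn
    refine Metric.ball_disjoint_ball ?_
    have : ∃ k, n k ≠ n' k := by
      by_contra! h
      exact hnn (funext h)
    obtain ⟨k, hk⟩ := this
    have h1 := PiLp.norm_apply_le (latticePt n - latticePt n') k
    rw [dist_eq_norm]
    have h2 : (1 : ℝ) ≤ ‖(latticePt n - latticePt n') k‖ := by
      rw [PiLp.sub_apply, latticePt_apply, latticePt_apply, Real.norm_eq_abs]
      have : 1 ≤ |n k - n' k| := Int.one_le_abs (sub_ne_zero.2 hk)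
      exact_mod_cast this
    linarith
  have h1 : μ.real (⋃ n ∈ s, Metric.ball (latticePt n) (1 / 2 : ℝ)) = s.card * ((1 / 2) ^ d * v) := by
    rw [measureReal_biUnion_finset hdisj (fun n _ => measurableSet_ball)
      (fun n _ => measure_ball_lt_top.ne)]
    simp only [hball _ _ (by norm_num : (0 : ℝ) ≤ 1 / 2), Finset.sum_const, nsmul_eq_mul]
  have h2 : (⋃ n ∈ s, Metric.ball (latticePt n) (1 / 2 : ℝ)) ⊆
      Metric.ball 0 (A + (R + 1)) \ Metric.ball 0 (A - (R + 1)) := by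
    intro x hx
    simp only [Set.mem_iUnion, Metric.mem_ball, exists_prop] at hx
    obtain ⟨n, hn, hx⟩ := hx
    have h3 := abs_le.1 (hs n hn)
    have h4 : |‖x‖ - ‖latticePt n‖| < 1 / 2 :=
      (abs_norm_sub_norm_le _ _).trans_lt (by rwa [dist_eq_norm] at hx)
    have h5 := abs_lt.1 h4
    constructor
    · rw [mem_ball_zero_iff]; linarith
    · rw [mem_ball_zero_iff]; linarith
  have h3 : μ.real (Metric.ball 0 (A + (R + 1)) \ Metric.ball 0 (A - (R + 1))) =
      (A + (R + 1)) ^ d * v - (A - (R + 1)) ^ d * v := by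
    rw [measureReal_sdiff (Metric.ball_subset_ball (by linarith)) measurableSet_ball,
      hball _ _ (by linarith), hball _ _ (by linarith)]
  have h4 := measureReal_mono h2 (μ := μ)
    (measure_ne_top_of_subset Set.sdiff_subset measure_ball_lt_top.ne)
  rw [h1, h3, ← sub_mul, ← mul_assoc] at h4
  have h5 := le_of_mul_le_mul_right h4 hv0
  have h6 : (A + (R + 1)) ^ d - (A - (R + 1)) ^ d ≤ 2 * (R + 1) * d * (2 * A) ^ (d - 1) := by
    have h7 := abs_pow_sub_pow_le (A + (R + 1)) (A - (R + 1)) d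
    rw [show A + (R + 1) - (A - (R + 1)) = 2 * (R + 1) by ring,
      abs_of_nonneg (by linarith : 0 ≤ 2 * (R + 1)), abs_of_nonneg (by linarith : 0 ≤ A + (R + 1)),
      abs_of_nonneg (by linarith : 0 ≤ A - (R + 1)), max_eq_left (by linarith)] at h7
    refine (le_abs_self _).trans (h7.trans ?_)
    gcongr
    · linarith
    · linarith
  have h7 := h5.trans h6
  rw [mul_pow] at h7
  have h8 : (s.card : ℝ) = 2 ^ d * (s.card * (1 / 2) ^ d) := by
    rw [mul_left_comm, ← mul_pow]; norm_num
  rw [h8]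
  calc _ ≤ 2 ^ d * (2 * (R + 1) * d * (2 ^ (d - 1) * A ^ (d - 1))) := by gcongr
    _ = _ := by ring

/-- The `i`-th coordinate of `n` is the largest one in absolute value. -/
def IsDominant (n : Fin d → ℤ) (i : Fin d) : Prop := ∀ k, |n k| ≤ |n i|

theorem IsDominant.abs_cast_le {n : Fin d → ℤ} {i : Fin d} (hi : IsDominant n i) (k : Fin d) :
    |(n k : ℝ)| ≤ |(n i : ℝ)| := by
  exact_mod_cast hi k

theorem exists_isDominant (hd : 0 < d) (n : Fin d → ℤ) : ∃ i, IsDominant n i := by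
  obtain ⟨i, -, hi⟩ := Finset.exists_max_image Finset.univ (fun i => |n i|) ⟨⟨0, hd⟩, Finset.mem_univ _⟩
  exact ⟨i, fun k => hi k (Finset.mem_univ _)⟩

section Geometry

variable {A : ℝ} {n : Fin d → ℤ} {i : Fin d} {ω : Rd d}

theorem IsDominant.lower (hd : 0 < d) (hA : 4 * Real.sqrt d ≤ A)
    (hi : IsDominant n i) (h : IsWindowPt A n ω) :
    A / Real.sqrt d - 1 ≤ |(n i : ℝ)| := by
  have hsd : 0 < Real.sqrt d := Real.sqrt_pos.2 (by exact_mod_cast hd)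
  have h1 := (abs_le.1 (h.norm_sub_le (by linarith))).2
  have h2 : ‖latticePt n‖ ≤ Real.sqrt d * |(n i : ℝ)| :=
    norm_le_sqrt_mul (abs_nonneg _) fun k => by
      rw [latticePt_apply]
      exact hi.abs_cast_le k
  have h3 : A ≤ Real.sqrt d * (|(n i : ℝ)| + 1) := by linarith
  rw [sub_le_iff_le_add, div_le_iff₀ hsd]
  linarith

theorem IsDominant.ne_zero (hd : 0 < d) (hA : 4 * Real.sqrt d ≤ A)
    (hi : IsDominant n i) (h : IsWindowPt A n ω) : n i ≠ 0 := by
  have hsd : 0 < Real.sqrt d := Real.sqrt_pos.2 (by exact_mod_cast hd)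
  intro h0
  have h1 := IsDominant.lower hd hA hi h
  have h2 : 4 ≤ A / Real.sqrt d := by rwa [le_div_iff₀ hsd]
  rw [h0] at h1
  norm_num at h1
  linarith

theorem IsDominant.coord_lower (hd : 0 < d) (hA : 4 * Real.sqrt d ≤ A)
    (hi : IsDominant n i) (h : IsWindowPt A n ω) :
    1 / (2 * Real.sqrt d) ≤ |ω i| := by
  have hsd : 0 < Real.sqrt d := Real.sqrt_pos.2 (by exact_mod_cast hd)
  have hA0 : 0 < A := by linarith
  have h1 := IsDominant.lower hd hA hi h
  have h2 : |(n i : ℝ)| - 1 ≤ A * |ω i| := by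
    have h3 := abs_sub_abs_le_abs_sub (n i : ℝ) (A * ω i)
    rw [abs_sub_comm, abs_mul, abs_of_pos hA0] at h3
    linarith [h.2 i]
  have h4 : 4 ≤ A / Real.sqrt d := by rwa [le_div_iff₀ hsd]
  have h5 : A / Real.sqrt d / 2 ≤ A * |ω i| := by linarith
  have h6 : A / Real.sqrt d / 2 = A * (1 / (2 * Real.sqrt d)) := by field_simp
  rw [h6] at h5
  exact le_of_mul_le_mul_left h5 hA0

theorem IsDominant.sign_pos (hd : 0 < d) (hA : 4 * Real.sqrt d ≤ A)
    (hi : IsDominant n i) (h : IsWindowPt A n ω) : 0 < (n i).sign * ω i := by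
  have hsd : 0 < Real.sqrt d := Real.sqrt_pos.2 (by exact_mod_cast hd)
  have hA0 : 0 < A := by linarith
  have h1 := abs_lt.1 (h.2 i)
  rcases lt_or_gt_of_ne (IsDominant.ne_zero hd hA hi h) with h0 | h0
  · rw [Int.sign_eq_neg_one_of_neg h0]
    have : (n i : ℝ) ≤ -1 := by exact_mod_cast Int.le_sub_one_of_lt h0
    have h2 : A * ω i < 0 := by linarith
    have h3 : ω i < 0 := by
      by_contra! h4
      nlinarith
    push_cast
    linarith
  · rw [Int.sign_eq_one_of_pos h0]
    have : (1 : ℝ) ≤ (n i : ℝ) := by exact_mod_cast h0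
    have h2 : 0 < A * ω i := by linarith
    have h3 : 0 < ω i := by
      by_contra! h4
      nlinarith
    push_cast
    linarith

/-- Cross-multiplying leaves a numerator of size 2|n_i| over A |ω_i| |n_i|. Magnified by 2^j ~
2^{ν/2}, the error stays small once A is a large multiple of 2^{ν/2}. -/
theorem IsDominant.slope_sub_le (hd : 0 < d) (hA : 4 * Real.sqrt d ≤ A)
    (hi : IsDominant n i) (h : IsWindowPt A n ω) (k : Fin d) :
    |ω k / ω i - n k / n i| ≤ 4 * Real.sqrt d / A := by
  have hsd : 0 < Real.sqrt d := Real.sqrt_pos.2 (by exact_mod_cast hd)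
  have hA0 : 0 < A := by linarith
  have hni : (n i : ℝ) ≠ 0 := by exact_mod_cast IsDominant.ne_zero hd hA hi h
  have h1 := IsDominant.coord_lower hd hA hi h
  have h0 : 0 < |ω i| := lt_of_lt_of_le (by positivity) h1
  have hω : ω i ≠ 0 := abs_pos.1 h0
  have h2 : |ω k / ω i - n k / n i| =
      |(A * ω k - n k) * n i - n k * (A * ω i - n i)| / (A * |ω i| * |(n i : ℝ)|) := by
    rw [← abs_of_pos hA0, ← abs_mul, ← abs_mul, ← abs_div, abs_of_pos hA0]
    congr 1
    field_simp
    ring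
  have h3 : |(A * ω k - n k) * n i - n k * (A * ω i - n i)| ≤ 2 * |(n i : ℝ)| := by
    refine (abs_sub _ _).trans ?_
    rw [abs_mul, abs_mul]
    have hm : |(n k : ℝ)| ≤ |(n i : ℝ)| := hi.abs_cast_le k
    nlinarith [h.2 k, h.2 i, abs_nonneg (n i : ℝ), abs_nonneg (A * ω i - n i),
      abs_nonneg (A * ω k - n k), abs_nonneg (n k : ℝ)]
  have hn0 : 0 < |(n i : ℝ)| := abs_pos.2 hni
  rw [h2]
  calc _ ≤ 2 * |(n i : ℝ)| / (A * (1 / (2 * Real.sqrt d)) * |(n i : ℝ)|) := by gcongr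
    _ = _ := by
      field_simp
      norm_num

end Geometry

/-- A square of at least 1/3 forces modulus at least 1/2, and uniform continuity loses at most 1/4.
A shear chosen at the window's lattice direction then works on the whole window. -/
theorem ShearletGenerator.exists_modulus (G : ShearletGenerator d) :
    ∃ δ : ℝ, 0 < δ ∧ ∀ x y : ℝ, |x - y| ≤ δ → 1 / 3 ≤ ‖G.psi2 x‖ ^ 2 → 1 / 4 ≤ ‖G.psi2 y‖ := by
  have hcs : HasCompactSupport G.psi2 := isCompact_Icc.of_isClosed_subset (isClosed_tsupport _)
    G.support_psi2
  have hu := hcs.uniformContinuous_of_continuous G.contDiff_psi2.continuous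
  obtain ⟨δ, hδ, h⟩ := Metric.uniformContinuous_iff.1 hu (1 / 4) (by norm_num)
  refine ⟨δ / 2, by positivity, fun x y hxy hx => ?_⟩
  have h1 : ‖G.psi2 x - G.psi2 y‖ < 1 / 4 := by
    rw [← dist_eq_norm]
    refine h ?_
    rw [Real.dist_eq]
    linarith
  have h2 : 1 / 2 ≤ ‖G.psi2 x‖ := by
    by_contra! h3
    nlinarith [norm_nonneg (G.psi2 x)]
  have h3 := norm_sub_norm_le (G.psi2 x) (G.psi2 y)
  linarith

end Windows

/-! ### Adapted shears -/

section WindowDecomposition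

variable {d : ℕ} (G : ShearletGenerator d)

theorem norm_normalize_sub_le {E : Type*} [NormedAddCommGroup E] [NormedSpace ℝ E] {w v : E}
    (hw : 1 ≤ ‖w‖) (hv : v ≠ 0) : ‖‖w‖⁻¹ • w - ‖v‖⁻¹ • v‖ ≤ 2 * ‖w - v‖ := by
  have hw0 : 0 < ‖w‖ := by linarith
  have hv0 : 0 < ‖v‖ := norm_pos_iff.2 hv
  have h1 : ‖w‖⁻¹ • w - ‖v‖⁻¹ • v = ‖w‖⁻¹ • (w - v) + (‖w‖⁻¹ - ‖v‖⁻¹) • v := by module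
  have h2 : (‖w‖⁻¹ - ‖v‖⁻¹) * ‖v‖ = ‖w‖⁻¹ * (‖v‖ - ‖w‖) := by field_simp
  have h3 : ‖w‖⁻¹ ≤ 1 := inv_le_one_of_one_le₀ hw
  have h4 : |‖v‖ - ‖w‖| ≤ ‖w - v‖ := by
    rw [abs_sub_comm]; exact abs_norm_sub_norm_le w v
  have h5 : ‖(‖w‖⁻¹ - ‖v‖⁻¹) • v‖ ≤ 1 * ‖w - v‖ := by
    rw [norm_smul, Real.norm_eq_abs, ← abs_of_pos hv0, ← abs_mul, abs_of_pos hv0, h2, abs_mul,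
      abs_of_pos (inv_pos.2 hw0)]
    gcongr
  have h6 : ‖‖w‖⁻¹ • (w - v)‖ ≤ 1 * ‖w - v‖ := by
    rw [norm_smul, norm_inv, norm_norm]
    gcongr
  rw [h1]
  linarith [norm_add_le (‖w‖⁻¹ • (w - v)) ((‖w‖⁻¹ - ‖v‖⁻¹) • v)]

/-- The shear parameters of `I` are adapted to the direction `n / n_i`. -/
def ShearletGenerator.IsAdapted (n : Fin d → ℤ) (I : ShearIndex d) : Prop :=
  IsDominant n I.1 ∧
    ∀ k : {k : Fin d // k ≠ I.1}, 1 / 3 ≤ ‖G.psi2 (2 ^ I.2.1 * ((n k : ℝ) / n I.1) - I.2.2.1 k)‖ ^ 2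

/-- The direction i is chosen before the scale j, so the sum over j for a given window involves a
single coordinate ξ_i. -/
theorem ShearletGenerator.exists_isAdapted (hd : 0 < d) (n : Fin d → ℤ) :
    ∃ i : Fin d, ∀ j : ℕ, ∃ I : ShearIndex d, I.1 = i ∧ I.2.1 = j ∧ G.IsAdapted n I := by
  obtain ⟨i, hi⟩ := exists_isDominant hd n
  refine ⟨i, fun j => ?_⟩
  have h : ∀ k : {k : Fin d // k ≠ i}, ∃ l : ℤ, |l| ≤ (2 ^ j : ℕ) ∧
      1 / 3 ≤ ‖G.psi2 (2 ^ j * ((n k : ℝ) / n i) - l)‖ ^ 2 := by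
    intro k
    refine G.exists_shear _ (2 ^ j) ?_
    have h1 : |(n k : ℝ) / n i| ≤ 1 := by
      rw [abs_div]
      exact div_le_one_of_le₀ (hi.abs_cast_le k) (abs_nonneg _)
    rw [abs_mul, abs_of_pos (by positivity : (0 : ℝ) < 2 ^ j)]
    push_cast
    exact mul_le_of_le_one_right (by positivity) h1
  choose l hl1 hl2 using h
  exact ⟨⟨i, j, l, fun k => by exact_mod_cast hl1 k⟩, rfl, rfl, hi, hl2⟩

variable {G} {A : ℝ} {n : Fin d → ℤ} {I : ShearIndex d}

/-- Only the last parameter, σ A w/‖w‖ - n, is delicate. Adaptedness puts w within √d 2^{-j} of v =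
n/n_i, so replacing w/‖w‖ by v/‖v‖ costs O(A 2^{-j}); the remaining radial error is |A - ‖n‖| ≤ √d.
-/
theorem ShearletGenerator.IsAdapted.norm_windowParam_le {ω : Rd d} {ν : ℕ} {S a : ℝ} (hd : 0 < d)
    (hA : 4 * Real.sqrt d ≤ A) (hI : G.IsAdapted n I) (h : IsWindowPt A n ω)
    (ha : 4 ^ I.2.1 / 2 ^ ν ≤ a) (hS : A * (2 ^ I.2.1)⁻¹ ≤ S) (hS1 : 1 ≤ S) :
    ‖windowParam I ν A ((n I.1).sign : ℝ) n‖ ≤ max a (Real.sqrt d * (2 * S) + Real.sqrt d) := by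
  have hsd : 0 ≤ Real.sqrt d := Real.sqrt_nonneg _
  have hsd1 : 1 ≤ Real.sqrt d := Real.one_le_sqrt.2 (by exact_mod_cast hd)
  have hA0 : 0 ≤ A := by linarith
  have h2 : (1 : ℝ) ≤ 2 ^ I.2.1 := one_le_pow₀ (by norm_num)
  have hn := IsDominant.ne_zero hd hA hI.1 h
  have hnR : (n I.1 : ℝ) ≠ 0 := by exact_mod_cast hn
  have hu : ‖(windowParam I ν A ((n I.1).sign : ℝ) n).2.2.1‖ ≤ Real.sqrt d * 1 := by
    refine norm_le_sqrt_mul zero_le_one fun k => ?_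
    simp only [windowParam]
    split_ifs with hk
    · rw [abs_div, abs_of_pos (by positivity : (0 : ℝ) < 2 ^ I.2.1)]
      refine div_le_one_of_le₀ ?_ (by positivity)
      exact_mod_cast I.2.2.2 ⟨k, hk⟩
    · simp
  set u := (windowParam I ν A ((n I.1).sign : ℝ) n).2.2.1 with hudef
  have hc : ‖(windowParam I ν A ((n I.1).sign : ℝ) n).2.2.2.2‖ ≤
      Real.sqrt d * (2 * S) + Real.sqrt d := by
    set w := axisPt I.1 u with hw
    set v : Rd d := WithLp.toLp 2 fun k => (n k : ℝ) / n I.1 with hv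
    have hvi : v I.1 = 1 := div_self hnR
    have hw1 : 1 ≤ ‖w‖ := norm_pos_of_coord_eq_one (axisPt_self I.1 u)
    have hv1 : 1 ≤ ‖v‖ := norm_pos_of_coord_eq_one hvi
    have hv0 : v ≠ 0 := norm_pos_iff.1 (by linarith)
    have hwv : ‖w - v‖ ≤ Real.sqrt d * (2 ^ I.2.1)⁻¹ := by
      refine norm_le_sqrt_mul (by positivity) fun k => ?_
      by_cases hk : k = I.1
      · subst hk
        rw [PiLp.sub_apply, hvi, hw, axisPt_self, sub_self, abs_zero]
        positivity
      · have h3 := hI.2 ⟨k, hk⟩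
        have h4 : |2 ^ I.2.1 * ((n k : ℝ) / n I.1) - I.2.2.1 ⟨k, hk⟩| < 1 := by
          by_contra! h5
          rw [G.psi2_eq_zero' h5] at h3
          norm_num at h3
        have h5 : (w - v) k = -((2 ^ I.2.1 * ((n k : ℝ) / n I.1) - I.2.2.1 ⟨k, hk⟩) * (2 ^ I.2.1)⁻¹) := by
          simp only [hw, hv, hudef, PiLp.sub_apply, axisPt, hk, if_false, windowParam,
            dif_pos (show k ≠ I.1 from hk)]
          field_simp
          ring
        rw [h5, abs_neg, abs_mul, abs_of_pos (by positivity : (0 : ℝ) < (2 ^ I.2.1)⁻¹)]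
        exact mul_le_of_le_one_left (by positivity) h4.le
    have hlat : latticePt n = (n I.1 : ℝ) • v := by
      ext k
      rw [latticePt_apply, PiLp.smul_apply, smul_eq_mul]
      simp only [hv]
      field_simp
    have hσ : |((n I.1).sign : ℝ)| = 1 := by
      rcases lt_or_gt_of_ne hn with h0 | h0
      · rw [Int.sign_eq_neg_one_of_neg h0]; norm_num
      · rw [Int.sign_eq_one_of_pos h0]; norm_num
    have hσn : ((n I.1).sign : ℝ) * |(n I.1 : ℝ)| = n I.1 := by
      exact_mod_cast Int.sign_mul_abs (n I.1)
    have hnorm : ‖latticePt n‖ = |(n I.1 : ℝ)| * ‖v‖ := by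
      rw [hlat, norm_smul, Real.norm_eq_abs]
    have hceq : (windowParam I ν A ((n I.1).sign : ℝ) n).2.2.2.2 =
        (((n I.1).sign : ℝ) * A) • (‖w‖⁻¹ • w - ‖v‖⁻¹ • v) +
          (((n I.1).sign : ℝ) * (A - ‖latticePt n‖)) • ‖v‖⁻¹ • v := by
      have h6 : (windowParam I ν A ((n I.1).sign : ℝ) n).2.2.2.2 =
          (((n I.1).sign : ℝ) * A) • ‖w‖⁻¹ • w - latticePt n := by
        ext k
        simp only [windowParam, PiLp.sub_apply, PiLp.smul_apply, smul_eq_mul, latticePt_apply]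
        rw [← mul_assoc, div_eq_inv_mul]
        rfl
      have h7 : latticePt n = (((n I.1).sign : ℝ) * ‖latticePt n‖) • ‖v‖⁻¹ • v := by
        rw [hnorm, ← mul_assoc, hσn, smul_smul, mul_assoc, mul_inv_cancel₀ (by positivity), mul_one,
          hlat]
      rw [h6]
      nth_rewrite 1 [h7]
      module
    rw [hceq]
    refine (norm_add_le _ _).trans (add_le_add ?_ ?_)
    · rw [norm_smul, Real.norm_eq_abs, abs_mul, hσ, one_mul, abs_of_nonneg hA0]
      calc A * ‖‖w‖⁻¹ • w - ‖v‖⁻¹ • v‖ ≤ A * (2 * (Real.sqrt d * (2 ^ I.2.1)⁻¹)) := by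
            gcongr
            exact (norm_normalize_sub_le hw1 hv0).trans (by gcongr)
        _ = Real.sqrt d * (2 * (A * (2 ^ I.2.1)⁻¹)) := by ring
        _ ≤ _ := by gcongr
    · rw [norm_smul, Real.norm_eq_abs, abs_mul, hσ, one_mul, norm_smul, norm_inv, norm_norm,
        inv_mul_cancel₀ (by positivity), mul_one]
      exact h.norm_sub_le hA0
  have hbig : 2 * S ≤ Real.sqrt d * (2 * S) + Real.sqrt d := by nlinarith
  simp only [Prod.norm_def, sup_le_iff]
  refine ⟨?_, ?_, ?_, ?_, ?_⟩
  · refine le_max_of_le_left ?_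
    rw [Real.norm_of_nonneg (by simp only [windowParam]; positivity)]
    exact ha
  · refine le_max_of_le_right ?_
    rw [Real.norm_of_nonneg (by simp only [windowParam]; positivity)]
    have : ((2 : ℝ) ^ I.2.1)⁻¹ ≤ 1 := inv_le_one_of_one_le₀ h2
    exact this.trans (by linarith)
  · exact le_max_of_le_right (by nlinarith)
  · refine le_max_of_le_right ?_
    rw [Real.norm_of_nonneg (by simp only [windowParam]; positivity)]
    exact hS.trans (by linarith)
  · exact le_max_of_le_right hc

/-- Across the window the slope arguments move by at most 2^j · 4√d/A ≤ δ from the adapted ones, so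
`psi2Inv` is a true inverse and only |ψ̂₁|² remains. -/
theorem ShearletGenerator.IsAdapted.dualHat_mul_psiHat {ξ : Rd d} {δ : ℝ} (hd : 0 < d)
    (hA : 4 * Real.sqrt d ≤ A) (hI : G.IsAdapted n I) (hξ : 0 < ‖ξ‖)
    (h : IsWindowPt A n (‖ξ‖⁻¹ • ξ))
    (hδ : ∀ x y : ℝ, |x - y| ≤ δ → 1 / 3 ≤ ‖G.psi2 x‖ ^ 2 → 1 / 4 ≤ ‖G.psi2 y‖)
    (hj : G.psi1 (ξ I.1 / 4 ^ I.2.1) ≠ 0 → 2 ^ I.2.1 * (4 * Real.sqrt d / A) ≤ δ) :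
    G.dualHat I.1 ((n I.1).sign : ℝ) (shearCoord I ξ) * G.psiHat I.1 (shearCoord I ξ) =
      ((‖G.psi1 (ξ I.1 / 4 ^ I.2.1)‖ ^ 2 : ℝ) : ℂ) := by
  rw [ShearletGenerator.dualHat, ShearletGenerator.psiHat, ShearletGenerator.psi1Half]
  have hs := IsDominant.sign_pos hd hA hI.1 h
  rw [PiLp.smul_apply, smul_eq_mul, mul_left_comm] at hs
  have hs1 : 0 < ((n I.1).sign : ℝ) * ξ I.1 := (mul_pos_iff_of_pos_left (inv_pos.2 hξ)).1 hs
  have hξi : ξ I.1 ≠ 0 := by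
    intro h0
    rw [h0, mul_zero] at hs1
    exact lt_irrefl _ hs1
  have hs2 : 0 < ((n I.1).sign : ℝ) * shearCoord I ξ I.1 := by
    rw [shearCoord_self, ← mul_div_assoc]
    positivity
  rw [if_pos hs2]
  by_cases h0 : G.psi1 (ξ I.1 / 4 ^ I.2.1) = 0
  · rw [shearCoord_self, h0]
    simp
  · have hp : ∏ k ∈ Finset.univ.erase I.1, (G.psi2Inv (shearCoord I ξ k / shearCoord I ξ I.1) *
        G.psi2 (shearCoord I ξ k / shearCoord I ξ I.1)) = 1 := by
      refine Finset.prod_eq_one fun k hk => G.psi2Inv_mul ?_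
      have hk' := Finset.ne_of_mem_erase hk
      refine hδ _ _ ?_ (hI.2 ⟨k, hk'⟩)
      rw [shearCoord_div I ξ hξi k hk']
      have h1 := IsDominant.slope_sub_le hd hA hI.1 h k
      rw [PiLp.smul_apply, PiLp.smul_apply, smul_eq_mul, smul_eq_mul,
        mul_div_mul_left _ _ (inv_ne_zero hξ.ne')] at h1
      refine le_trans ?_ (hj h0)
      rw [show (2 : ℝ) ^ I.2.1 * ((n k : ℝ) / n I.1) - I.2.2.1 ⟨k, hk'⟩ -
        (2 ^ I.2.1 * (ξ k / ξ I.1) - I.2.2.1 ⟨k, hk'⟩) =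
        -(2 ^ I.2.1 * (ξ k / ξ I.1 - n k / n I.1)) by ring, abs_neg, abs_mul,
        abs_of_pos (by positivity : (0 : ℝ) < 2 ^ I.2.1)]
      gcongr
    rw [Finset.prod_mul_distrib] at hp
    rw [shearCoord_self] at hp ⊢
    rw [mul_mul_mul_comm, hp, mul_one, mul_comm, Complex.mul_conj, Complex.normSq_eq_norm_sq]

end WindowDecomposition

/-! ### Decomposition of a dyadic annulus -/

section WindowDecomposition

variable {d : ℕ} (G : ShearletGenerator d)

theorem ShearletGenerator.sum_norm_psi1_sq {x : ℝ} (hx : 1 / 8 ≤ |x|) {J : Finset ℕ}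
    (hJ : ∀ j, G.psi1 (x / 4 ^ j) ≠ 0 → j ∈ J) : ∑ j ∈ J, ‖G.psi1 (x / 4 ^ j)‖ ^ 2 = 1 := by
  have h1 := G.sum_psi1 x hx
  simp only [pow_mul, show (2 : ℝ) ^ 2 = 4 by norm_num] at h1
  refine (hasSum_sum_of_ne_finset_zero fun j hj => ?_).unique h1
  have : G.psi1 (x / 4 ^ j) = 0 := by
    by_contra h
    exact hj (hJ j h)
  rw [this]
  simp

theorem sum_prod_bump {A : ℝ} {x : Rd d} {N : ℕ} (hN : ∀ k, |A * x k| ≤ N) {s : Finset (Fin d → ℤ)}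
    (hs : ∀ n : Fin d → ℤ, (∀ k, |A * x k - n k| < 1) → (∀ k, |n k| ≤ N) → n ∈ s)
    (hs' : ∀ n ∈ s, ∀ k, |n k| ≤ N) :
    ∑ n ∈ s, ∏ k, bump (A * x k - n k) = 1 := by
  have h1 : ∑ n ∈ Fintype.piFinset fun _ : Fin d => Finset.Icc (-(N : ℤ)) N,
      ∏ k, bump (A * x k - n k) = 1 := by
    rw [← Finset.prod_univ_sum (fun _ : Fin d => Finset.Icc (-(N : ℤ)) N)
      fun k m => bump (A * x k - m)]
    exact Finset.prod_eq_one fun k _ => sum_bump _ N (hN k)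
  rw [← h1]
  refine Finset.sum_subset (fun n hn => ?_) fun n hn hns => ?_
  · rw [Fintype.mem_piFinset]
    exact fun k => Finset.mem_Icc.2 (abs_le.1 (hs' n hn k))
  · rw [Fintype.mem_piFinset] at hn
    have : ∃ k, 1 ≤ |A * x k - n k| := by
      by_contra! h
      exact hns (hs n h fun k => abs_le.2 (Finset.mem_Icc.1 (hn k)))
    obtain ⟨k, hk⟩ := this
    exact Finset.prod_eq_zero (Finset.mem_univ k) (bump_eq_zero hk)

/-- Insert two partitions of unity into φ̂(2^{-ν} ξ): the bumps in A ξ/‖ξ‖ indexed by lattice points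
n, and for each n the sum ∑_j |ψ̂₁(4^{-j} ξ_i)|² = 1. Each product is a symbol times the shearlet
transform adapted to (n, j). -/
theorem ShearletGenerator.exists_window_decomposition (hd : 0 < d) (φ : 𝓢(Rd d, ℂ))
    (hφ : ∀ ξ, 𝓕 φ ξ ≠ 0 → 1 / 2 ≤ ‖ξ‖ ∧ ‖ξ‖ ≤ 2) :
    ∃ (ν₀ e : ℕ) (K B : ℝ), 0 ≤ K ∧ ∀ ν ≥ ν₀, ∃ (T : Finset ((Fin d → ℤ) × ℕ))
      (I : (Fin d → ℤ) × ℕ → ShearIndex d) (σ : (Fin d → ℤ) × ℕ → ℝ)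
      (θ : (Fin d → ℤ) × ℕ → SymbolParam d),
      (T.card : ℝ) ≤ K * Real.sqrt (2 ^ ν) ^ (d - 1) ∧
      (∀ t ∈ T, (σ t = 1 ∨ σ t = -1) ∧ ‖θ t‖ ≤ B ∧ ν ≤ 2 * (I t).2.1 + e ∧
        2 * (I t).2.1 ≤ ν + e) ∧
      ∀ ξ, 𝓕 φ (((2 : ℝ) ^ ν)⁻¹ • ξ) =
        ∑ t ∈ T, G.windowSymbol φ (I t).1 (σ t) (shearCoord (I t) ξ, θ t) *
          G.psiHat (I t).1 (shearCoord (I t) ξ) := by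
  have hsd1 : 1 ≤ Real.sqrt d := Real.one_le_sqrt.2 (by exact_mod_cast hd)
  have hsd : 0 < Real.sqrt d := by linarith
  obtain ⟨δ, hδ, hmod⟩ := G.exists_modulus
  obtain ⟨K, hK, hcard⟩ := card_annulus_le d hd (Real.sqrt d) hsd.le
  obtain ⟨e₀, he₀⟩ := pow_unbounded_of_one_lt (2 * Real.sqrt d) (one_lt_two (α := ℝ))
  choose i I hIi hIj hI using fun n => G.exists_isAdapted hd n
  set M : ℝ := 24 * Real.sqrt d / δ + 4 * Real.sqrt d with hM
  have hM4 : 4 * Real.sqrt d ≤ M := le_add_of_nonneg_left (by positivity)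
  have hM0 : 0 < M := by linarith
  set e : ℕ := e₀ + 3 with he
  set S : ℝ := M * 2 ^ (e + 1) with hS
  have hS1 : 1 ≤ S := by
    have : (1 : ℝ) ≤ 2 ^ (e + 1) := one_le_pow₀ (by norm_num)
    nlinarith
  refine ⟨e₀, 2 * e + 1, K * M ^ (d - 1) * (2 * e + 1),
    max (4 ^ e) (Real.sqrt d * (2 * S) + Real.sqrt d), by positivity, fun ν hν => ?_⟩
  set ρ : ℝ := Real.sqrt (2 ^ ν) with hρ
  have hρ2 : ρ ^ 2 = 2 ^ ν := Real.sq_sqrt (by positivity)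
  have hρ1 : 1 ≤ ρ := Real.one_le_sqrt.2 (one_le_pow₀ (by norm_num))
  set A : ℝ := M * ρ with hAdef
  have hAM : M ≤ A := le_mul_of_one_le_right hM0.le hρ1
  have hA : 4 * Real.sqrt d ≤ A := hM4.trans hAM
  have hA0 : 0 < A := by linarith
  obtain ⟨N, hN⟩ := exists_nat_ge A
  classical
  set s : Finset (Fin d → ℤ) := (Fintype.piFinset fun _ : Fin d => Finset.Icc (-(N : ℤ)) N).filter
    fun n => ∃ ω : Rd d, IsWindowPt A n ω with hs
  -- Active scales satisfy ν - e₀ ≤ 2j ≤ ν + 5, which lies in this range; truncated subtraction at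
  -- small ν is harmless.
  set J : Finset ℕ := Finset.Icc (ν / 2 - e) (ν / 2 + e) with hJ
  have hJmem : ∀ j ∈ J, ν ≤ 2 * j + (2 * e + 1) ∧ 2 * j ≤ ν + 2 * e := by
    intro j hj
    rw [hJ, Finset.mem_Icc] at hj
    omega
  refine ⟨s ×ˢ J, fun t => I t.1 t.2, fun t => ((t.1 (i t.1)).sign : ℝ),
    fun t => windowParam (I t.1 t.2) ν A ((t.1 (i t.1)).sign : ℝ) t.1, ?_, ?_, ?_⟩
  · have h1 := hcard A s (by linarith) fun n hn => by
      obtain ⟨ω, hω⟩ := (Finset.mem_filter.1 hn).2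
      exact hω.norm_sub_le hA0.le
    have h2 : J.card ≤ 2 * e + 1 := by
      rw [hJ, Nat.card_Icc]
      omega
    have h2' : (J.card : ℝ) ≤ 2 * e + 1 := by exact_mod_cast h2
    rw [Finset.card_product]
    push_cast
    calc (s.card : ℝ) * J.card ≤ (K * A ^ (d - 1)) * (2 * e + 1) := by gcongr
      _ = _ := by rw [hAdef, mul_pow]; ring
  · rintro ⟨n, j⟩ ht
    obtain ⟨hn, hj⟩ := Finset.mem_product.1 ht
    obtain ⟨ω, hω⟩ := (Finset.mem_filter.1 hn).2
    obtain ⟨hj1, hj2⟩ := hJmem j hj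
    dsimp only
    rw [← hIi n j]
    refine ⟨?_, ?_, ?_, ?_⟩
    · rcases lt_or_gt_of_ne (IsDominant.ne_zero hd hA (hI n j).1 hω) with h0 | h0
      · right; rw [Int.sign_eq_neg_one_of_neg h0]; norm_num
      · left; rw [Int.sign_eq_one_of_pos h0]; norm_num
    · refine (hI n j).norm_windowParam_le hd hA hω ?_ ?_ hS1
      · rw [hIj, div_le_iff₀ (by positivity), show (4 : ℝ) = 2 ^ 2 by norm_num, ← pow_mul, ← pow_mul,
          ← pow_add]
        exact pow_le_pow_right₀ (by norm_num) (by omega)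
      · rw [hIj, ← div_eq_mul_inv, div_le_iff₀ (by positivity), hAdef, hS, mul_assoc, ← pow_add]
        gcongr
        rw [hρ]
        refine Real.sqrt_le_iff.2 ⟨by positivity, ?_⟩
        rw [← pow_mul]
        exact pow_le_pow_right₀ (by norm_num) (by omega)
    · rw [hIj]; exact hj1
    · rw [hIj]; omega
  · intro ξ
    by_cases hξ0 : 𝓕 φ (((2 : ℝ) ^ ν)⁻¹ • ξ) = 0
    · rw [hξ0, eq_comm]
      refine Finset.sum_eq_zero fun t ht => ?_
      obtain ⟨n, j⟩ := t
      obtain ⟨ω, hω⟩ := (Finset.mem_filter.1 (Finset.mem_product.1 ht).1).2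
      dsimp only
      rw [← hIi n j, G.windowSymbol_shearCoord φ _ ν A _ ?_ n ξ, hξ0]
      · simp
      · rcases lt_or_gt_of_ne (IsDominant.ne_zero hd hA (hI n j).1 hω) with h0 | h0
        · rw [Int.sign_eq_neg_one_of_neg h0]; norm_num
        · rw [Int.sign_eq_one_of_pos h0]; norm_num
    obtain ⟨hl, hu⟩ := hφ _ hξ0
    have h2ν : (0 : ℝ) < 2 ^ ν := by positivity
    rw [norm_smul, norm_inv, norm_pow, Real.norm_of_nonneg zero_le_two, inv_mul_eq_div] at hl hu
    rw [le_div_iff₀ h2ν] at hl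
    rw [div_le_iff₀ h2ν] at hu
    have hξ : 0 < ‖ξ‖ := by linarith
    set ω : Rd d := ‖ξ‖⁻¹ • ξ with hω
    have hω1 : ‖ω‖ = 1 := by rw [hω, norm_smul, norm_inv, norm_norm, inv_mul_cancel₀ hξ.ne']
    have hωk : ∀ k, ξ k / ‖ξ‖ = ω k := fun k => by
      rw [hω, PiLp.smul_apply, smul_eq_mul, div_eq_inv_mul]
    have hsum : ∑ n ∈ s, ∏ k, bump (A * ω k - n k) = 1 := by
      refine sum_prod_bump (N := N) (fun k => ?_) (fun n hn hnN => ?_) fun n hn k => ?_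
      · rw [abs_mul, abs_of_pos hA0]
        have := PiLp.norm_apply_le ω k
        rw [hω1, Real.norm_eq_abs] at this
        nlinarith
      · refine Finset.mem_filter.2 ⟨?_, ω, hω1, hn⟩
        rw [Fintype.mem_piFinset]
        exact fun k => Finset.mem_Icc.2 (abs_le.1 (hnN k))
      · exact abs_le.2 (Finset.mem_Icc.1 (Fintype.mem_piFinset.1 (Finset.mem_filter.1 hn).1 k))
    have hinner : ∀ n ∈ s, ∑ j ∈ J,
        G.windowSymbol φ (I n j).1 ((n (i n)).sign : ℝ) (shearCoord (I n j) ξ,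
          windowParam (I n j) ν A ((n (i n)).sign : ℝ) n) *
          G.psiHat (I n j).1 (shearCoord (I n j) ξ) =
        𝓕 φ (((2 : ℝ) ^ ν)⁻¹ • ξ) * ((∏ k, bump (A * ω k - n k) : ℝ) : ℂ) := by
      intro n hn
      obtain ⟨ω', hω'⟩ := (Finset.mem_filter.1 hn).2
      have hterm : ∀ j, G.windowSymbol φ (I n j).1 ((n (i n)).sign : ℝ) (shearCoord (I n j) ξ,
          windowParam (I n j) ν A ((n (i n)).sign : ℝ) n) *
          G.psiHat (I n j).1 (shearCoord (I n j) ξ) =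
          𝓕 φ (((2 : ℝ) ^ ν)⁻¹ • ξ) * ((∏ k, bump (A * ω k - n k) : ℝ) : ℂ) *
          (G.dualHat (I n j).1 ((n (I n j).1).sign : ℝ) (shearCoord (I n j) ξ) *
            G.psiHat (I n j).1 (shearCoord (I n j) ξ)) := by
        intro j
        rw [← hIi n j, G.windowSymbol_shearCoord φ _ ν A _ ?_ n ξ]
        · simp only [hωk]
          ring
        · rcases lt_or_gt_of_ne (IsDominant.ne_zero hd hA (hI n j).1 hω') with h0 | h0
          · rw [Int.sign_eq_neg_one_of_neg h0]; norm_num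
          · rw [Int.sign_eq_one_of_pos h0]; norm_num
      rw [Finset.sum_congr rfl fun j _ => hterm j, ← Finset.mul_sum]
      by_cases hwin : ∀ k, |A * ω k - n k| < 1
      swap
      · push Not at hwin
        obtain ⟨k, hk⟩ := hwin
        rw [Finset.prod_eq_zero (Finset.mem_univ k) (bump_eq_zero hk)]
        simp
      have hW : IsWindowPt A n ω := ⟨hω1, hwin⟩
      have hdom : IsDominant n (i n) := by
        have := (hI n 0).1
        rwa [hIi] at this
      have hlow : 2 ^ ν / (4 * Real.sqrt d) ≤ |ξ (i n)| := by
        have h1 := IsDominant.coord_lower hd hA hdom hW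
        rw [← hωk, abs_div, abs_norm, le_div_iff₀ hξ] at h1
        refine le_trans ?_ h1
        rw [show (2 : ℝ) ^ ν / (4 * Real.sqrt d) = 1 / (2 * Real.sqrt d) * (1 / 2 * 2 ^ ν) by
          field_simp; norm_num]
        gcongr
      have hupp : |ξ (i n)| ≤ 2 * 2 ^ ν := by
        have := PiLp.norm_apply_le ξ (i n)
        rw [Real.norm_eq_abs] at this
        linarith
      have hnz : ∀ j, G.psi1 (ξ (i n) / 4 ^ j) ≠ 0 →
          (4 : ℝ) ^ j ≤ 32 * 2 ^ ν ∧ 2 ^ ν ≤ 2 * Real.sqrt d * 4 ^ j := by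
        intro j hj
        have h4 : (0 : ℝ) < 4 ^ j := by positivity
        have h1 : 1 / 16 ≤ |ξ (i n) / 4 ^ j| ∧ |ξ (i n) / 4 ^ j| ≤ 1 / 2 := by
          constructor
          · by_contra! h
            exact hj (G.psi1_eq_zero (Or.inl h))
          · by_contra! h
            exact hj (G.psi1_eq_zero (Or.inr h))
        rw [abs_div, abs_of_pos h4, le_div_iff₀ h4, div_le_iff₀ h4] at h1
        refine ⟨by linarith, ?_⟩
        rw [div_le_iff₀ (by positivity)] at hlow
        nlinarith
      have hone : ∑ j ∈ J, G.dualHat (I n j).1 ((n (I n j).1).sign : ℝ) (shearCoord (I n j) ξ) *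
          G.psiHat (I n j).1 (shearCoord (I n j) ξ) = 1 := by
        -- Here ν ≥ e₀ is used: it places ξ_i in the range where the squares of ψ̂₁ sum to 1.
        have h8 : 1 / 8 ≤ |ξ (i n)| := by
          refine le_trans ?_ hlow
          rw [le_div_iff₀ (by positivity)]
          have : (2 : ℝ) ^ e₀ ≤ 2 ^ ν := pow_le_pow_right₀ (by norm_num) hν
          linarith
        have h9 : ∀ j, G.psi1 (ξ (i n) / 4 ^ j) ≠ 0 → j ∈ J := by
          intro j hj
          obtain ⟨h1, h2⟩ := hnz j hj
          have h3 : 2 * j ≤ ν + 5 := by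
            rw [← Nat.pow_le_pow_iff_right (a := 2) (by norm_num)]
            have : (2 : ℝ) ^ (2 * j) ≤ 2 ^ (ν + 5) := by
              rw [pow_mul, pow_add]
              norm_num
              linarith
            exact_mod_cast this
          have h4 : ν ≤ e₀ + 2 * j := by
            rw [← Nat.pow_le_pow_iff_right (a := 2) (by norm_num)]
            have : (2 : ℝ) ^ ν ≤ 2 ^ (e₀ + 2 * j) := by
              rw [pow_add, pow_mul]
              norm_num
              exact h2.trans (by gcongr)
            exact_mod_cast this
          rw [hJ, Finset.mem_Icc]
          omega
        rw [← Complex.ofReal_one, ← G.sum_norm_psi1_sq h8 h9, Complex.ofReal_sum]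
        refine Finset.sum_congr rfl fun j _ => ?_
        have := (hI n j).dualHat_mul_psiHat hd hA hξ hW hmod fun hj => ?_
        · rw [hIj, hIi] at this
          rw [hIi]
          exact this
        · rw [hIj, hIi] at hj
          rw [hIj]
          have h1 := (hnz j hj).1
          have h2 : (2 : ℝ) ^ j ≤ 6 * ρ := by
            refine le_of_sq_le_sq ?_ (by positivity)
            rw [mul_pow, hρ2, ← pow_mul, mul_comm j, pow_mul]
            norm_num
            linarith
          have h3 : 24 * Real.sqrt d / δ ≤ M := le_add_of_nonneg_right (by positivity)
          rw [div_le_iff₀ hδ] at h3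
          rw [← mul_div_assoc, div_le_iff₀ hA0, hAdef]
          calc (2 : ℝ) ^ j * (4 * Real.sqrt d) ≤ 6 * ρ * (4 * Real.sqrt d) := by gcongr
            _ = 24 * Real.sqrt d * ρ := by ring
            _ ≤ M * δ * ρ := by gcongr
            _ = _ := by ring
      rw [hone, mul_one]
    rw [Finset.sum_product]
    dsimp only
    rw [Finset.sum_congr rfl hinner, ← Finset.mul_sum, ← Complex.ofReal_sum, hsum]
    simp

end WindowDecomposition

/-! ### Dyadic estimates and the embedding -/

section Embedding

variable {d : ℕ} (G : ShearletGenerator d)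

theorem ShearletGenerator.windowSymbol_eq_zero (φ : 𝓢(Rd d, ℂ)) (i : Fin d) (σ : ℝ) (η : Rd d)
    (θ : SymbolParam d) (h : ∃ k, 1 / 2 ≤ |η k|) : G.windowSymbol φ i σ (η, θ) = 0 := by
  rw [ShearletGenerator.windowSymbol, G.dualHat_eq_zero σ h]
  simp

theorem ShearletGenerator.exists_schwartz_windowSymbol (φ : 𝓢(Rd d, ℂ)) (i : Fin d) (σ : ℝ)
    (θ : SymbolParam d) : ∃ m : 𝓢(Rd d, ℂ), ∀ η, m η = G.windowSymbol φ i σ (η, θ) := by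
  have h1 : ContDiff ℝ (⊤ : ℕ∞) fun η => G.windowSymbol φ i σ (η, θ) :=
    (G.contDiff_windowSymbol φ i σ).comp (contDiff_id.prodMk contDiff_const)
  have h2 : HasCompactSupport fun η => G.windowSymbol φ i σ (η, θ) := by
    refine HasCompactSupport.of_support_subset_isCompact
      (isCompact_closedBall (0 : Rd d) (Real.sqrt d * (1 / 2))) fun η hη => ?_
    rw [mem_closedBall_zero_iff]
    refine norm_le_sqrt_mul (by norm_num) fun k => ?_
    by_contra! h
    exact hη (G.windowSymbol_eq_zero φ i σ η θ ⟨k, h.le⟩)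
  exact ⟨h2.toSchwartzMap h1, fun η => rfl⟩

/-- The parameters fill a compact ball, and only finitely many pairs (i, σ) occur. -/
theorem ShearletGenerator.exists_tsum_fourier_windowSymbol_le {p : ℝ≥0∞} (hp : 0 < p)
    (φ : 𝓢(Rd d, ℂ)) (B : ℝ) :
    ∃ C : ℝ≥0∞, C ≠ ∞ ∧ ∀ (i : Fin d) (σ : ℝ), σ = 1 ∨ σ = -1 → ∀ θ : SymbolParam d, ‖θ‖ ≤ B →
      ∀ m : 𝓢(Rd d, ℂ), (∀ η, m η = G.windowSymbol φ i σ (η, θ)) →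
        ∑' n, ‖𝓕 m (latticePt n)‖ₑ ^ subExp p ≤ C := by
  obtain ⟨N, hN⟩ := tsum_fourier_latticePt_lt_top hp d
  have h := fun (i : Fin d) (σ : ℝ) => exists_fourier_decay_of_contDiff
    (G.contDiff_windowSymbol φ i σ) (G.windowSymbol_eq_zero φ i σ)
    (isCompact_closedBall (0 : SymbolParam d) B) N
  choose b hb using h
  obtain ⟨C, hC, hC'⟩ := hN (∑ i, (|b i 1| + |b i (-1)|))
  refine ⟨C, hC, fun i σ hσ θ hθ m hm => hC' m fun n => ?_⟩
  refine (hb i σ θ (by simpa using hθ) m hm _).trans ?_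
  have h1 := Finset.single_le_sum (f := fun i => |b i 1| + |b i (-1)|)
    (fun i _ => by positivity) (Finset.mem_univ i)
  refine le_trans ?_ h1
  rcases hσ with rfl | rfl
  · linarith [le_abs_self (b i 1), abs_nonneg (b i (-1))]
  · linarith [le_abs_self (b i (-1)), abs_nonneg (b i 1)]

/-- There are O(2^{ν(d-1)/2}) terms, each of r-th power at most C (2^{-(d+1)αj} ‖f‖)^r with 2j = ν +
O(1). Taking the r-th root turns the count into the loss (d-1)/(2r) in the exponent. -/
theorem ShearletGenerator.exists_eLpNorm_dyadic_le_of_large (hd : 0 < d) {p q : ℝ≥0∞} (hp : 0 < p)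
    (hq : 0 < q) (α : ℝ) (φ : 𝓢(Rd d, ℂ)) (hφ : ∀ ξ, 𝓕 φ ξ ≠ 0 → 1 / 2 ≤ ‖ξ‖ ∧ ‖ξ‖ ≤ 2) :
    ∃ (ν₀ : ℕ) (C : ℝ≥0∞), C ≠ ∞ ∧ ∀ ν ≥ ν₀, ∀ f : 𝓢'(Rd d, ℂ),
      eLpNorm (conv f (dyadicDilate ν φ)) p volume ≤
        C * ENNReal.ofReal ((2 : ℝ) ^ ((ν : ℝ) * ((((d : ℝ) - 1) / subExp p - (d + 1) * α) / 2))) *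
          shearBesovNorm G α p q f := by
  obtain ⟨ν₀, e, K, B, hK, hdec⟩ := G.exists_window_decomposition hd φ hφ
  obtain ⟨C, hC, hCm⟩ := G.exists_tsum_fourier_windowSymbol_le hp φ B
  set r := subExp p with hr
  have hr0 : 0 < r := subExp_pos hp
  -- Cost of replacing j by ν/2 in the weight, where |ν - 2j| ≤ e.
  set D : ℝ := 2 ^ ((d + 1) * |α| * e / 2) with hD
  refine ⟨ν₀, (ENNReal.ofReal K * C) ^ r⁻¹ * ENNReal.ofReal D, ?_, fun ν hν f => ?_⟩
  · exact ENNReal.mul_ne_top (ENNReal.rpow_ne_top_of_nonneg (by positivity)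
      (ENNReal.mul_ne_top ENNReal.ofReal_ne_top hC)) ENNReal.ofReal_ne_top
  obtain ⟨T, I, σ, θ, hT, hpar, hid⟩ := hdec ν hν
  choose m hm using fun t => G.exists_schwartz_windowSymbol φ (I t).1 (σ t) (θ t)
  set S := shearBesovNorm G α p q f
  set β : ℝ := -((d + 1) * α * ν / 2) with hβ
  have h1 := eLpNorm_conv_decomposition_le hp f T (fun t => shearletMatrix (I t)) m
    (fun t => G.psi (I t).1) (dyadicDilate ν φ)
    (fun t η h => by rw [hm, G.windowSymbol_eq_zero φ _ _ η _ h])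
    (fun t η ⟨k, hk⟩ => by rw [G.fourier_psi, G.psiHat_eq_zero ⟨k, hk.le⟩])
    (fun ξ => by
      rw [fourier_dyadicDilate, hid]
      refine Finset.sum_congr rfl fun t _ => ?_
      rw [hm, G.fourier_psi]
      rfl)
  have h2 : ∀ t ∈ T, (∑' n, ‖𝓕 (m t) (latticePt n)‖ₑ ^ r) *
      eLpNorm (conv f (matrixDilate (shearletMatrix (I t)) (G.psi (I t).1))) p volume ^ r ≤
        C * (ENNReal.ofReal (D * 2 ^ β) * S) ^ r := by
    intro t ht
    obtain ⟨hσ, hθ, hj1, hj2⟩ := hpar t ht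
    refine mul_le_mul' (hCm _ _ hσ _ hθ _ (hm t)) (ENNReal.rpow_le_rpow ?_ hr0.le)
    refine (eLpNorm_psiDilated_le G hq α p f (I t)).trans (mul_le_mul' (ENNReal.ofReal_le_ofReal ?_) le_rfl)
    rw [hD, ← Real.rpow_add two_pos]
    refine Real.rpow_le_rpow_of_exponent_le one_le_two ?_
    have h3 : |(ν : ℝ) - 2 * (I t).2.1| ≤ e := by
      rw [abs_le]
      constructor
      · have : (2 * (I t).2.1 : ℝ) ≤ ν + e := by exact_mod_cast hj2
        linarith
      · have : (ν : ℝ) ≤ 2 * (I t).2.1 + e := by exact_mod_cast hj1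
        linarith
    have h4 : α * (ν - 2 * (I t).2.1) ≤ |α| * e := by
      refine (le_abs_self _).trans ?_
      rw [abs_mul]
      gcongr
    have h5 : ((d : ℝ) + 1) * (α * (ν - 2 * (I t).2.1)) ≤ (d + 1) * (|α| * e) := by gcongr
    rw [hβ]
    linarith
  have h6 := h1.trans (Finset.sum_le_sum h2)
  rw [Finset.sum_const, nsmul_eq_mul] at h6
  have h7 : (T.card : ℝ≥0∞) ≤ ENNReal.ofReal K * ENNReal.ofReal (Real.sqrt (2 ^ ν) ^ (d - 1)) := by
    rw [← ENNReal.ofReal_mul hK, ← ENNReal.ofReal_natCast]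
    exact ENNReal.ofReal_le_ofReal hT
  have h8 : Real.sqrt (2 ^ ν) ^ (d - 1) = (2 : ℝ) ^ ((ν : ℝ) * ((d - 1) / 2)) := by
    rw [Real.sqrt_eq_rpow, ← Real.rpow_natCast, ← Real.rpow_natCast, ← Real.rpow_mul (by norm_num),
      ← Real.rpow_mul (by norm_num), Nat.cast_sub hd]
    congr 1
    push_cast
    ring
  have h9 := ENNReal.rpow_le_rpow (h6.trans (mul_le_mul' h7 le_rfl)) (inv_nonneg.2 hr0.le)
  rw [← ENNReal.rpow_mul, mul_inv_cancel₀ hr0.ne', ENNReal.rpow_one] at h9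
  refine h9.trans_eq ?_
  rw [show ∀ a b c x : ℝ≥0∞, a * b * (c * x) = a * c * b * x from fun a b c x => by ring,
    ENNReal.mul_rpow_of_nonneg _ _ (inv_nonneg.2 hr0.le),
    ENNReal.mul_rpow_of_nonneg _ _ (inv_nonneg.2 hr0.le), ← ENNReal.rpow_mul,
    mul_inv_cancel₀ hr0.ne', ENNReal.rpow_one, h8,
    ENNReal.ofReal_rpow_of_nonneg (by positivity) (inv_nonneg.2 hr0.le),
    ENNReal.ofReal_mul (by positivity), ← Real.rpow_mul (by norm_num)]
  rw [show ∀ a b c x s : ℝ≥0∞, a * b * (c * x * s) = a * c * (b * x) * s from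
    fun a b c x s => by ring, ← ENNReal.ofReal_mul (by positivity), ← Real.rpow_add two_pos]
  congr 4
  rw [hβ]
  field_simp
  ring

theorem hasCompactSupport_fourier_of_norm_le {g : 𝓢(Rd d, ℂ)} {R : ℝ}
    (h : ∀ ξ, 𝓕 g ξ ≠ 0 → ‖ξ‖ ≤ R) : HasCompactSupport (𝓕 g : 𝓢(Rd d, ℂ)) :=
  HasCompactSupport.of_support_subset_isCompact (isCompact_closedBall (0 : Rd d) R)
    fun ξ hξ => by
      rw [mem_closedBall_zero_iff]
      exact h ξ hξ

theorem ShearletGenerator.exists_eLpNorm_dyadic_le (hd : 0 < d) {p q : ℝ≥0∞} (hp : 0 < p)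
    (hq : 0 < q) (α : ℝ) (φ : 𝓢(Rd d, ℂ)) (hφ : ∀ ξ, 𝓕 φ ξ ≠ 0 → 1 / 2 ≤ ‖ξ‖ ∧ ‖ξ‖ ≤ 2) :
    ∃ C : ℝ≥0∞, C ≠ ∞ ∧ ∀ (ν : ℕ) (f : 𝓢'(Rd d, ℂ)),
      eLpNorm (conv f (dyadicDilate ν φ)) p volume ≤
        C * ENNReal.ofReal ((2 : ℝ) ^ ((ν : ℝ) * ((((d : ℝ) - 1) / subExp p - (d + 1) * α) / 2))) *
          shearBesovNorm G α p q f := by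
  obtain ⟨ν₀, C, hC, hlarge⟩ := G.exists_eLpNorm_dyadic_le_of_large hd hp hq α φ hφ
  set β : ℝ := (((d : ℝ) - 1) / subExp p - (d + 1) * α) / 2
  have hsmall : ∀ ν : ℕ, ∃ C : ℝ≥0∞, C ≠ ∞ ∧ ∀ f : 𝓢'(Rd d, ℂ),
      eLpNorm (conv f (dyadicDilate ν φ)) p volume ≤ C * shearBesovNorm G α p q f := by
    intro ν
    refine exists_eLpNorm_conv_le G hp hq α _
      (hasCompactSupport_fourier_of_norm_le (R := 2 ^ ν * 2) fun ξ hξ => ?_)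
    rw [fourier_dyadicDilate] at hξ
    have h1 := (hφ _ hξ).2
    rwa [norm_smul, norm_inv, norm_pow, Real.norm_of_nonneg zero_le_two,
      inv_mul_le_iff₀ (by positivity)] at h1
  choose c hc hc' using hsmall
  have h2 : ∀ ν : ℕ, ENNReal.ofReal ((2 : ℝ) ^ (-((ν : ℝ) * β))) *
      ENNReal.ofReal ((2 : ℝ) ^ ((ν : ℝ) * β)) = 1 := by
    intro ν
    rw [← ENNReal.ofReal_mul (by positivity), ← Real.rpow_add two_pos]
    simp
  refine ⟨C + ∑ ν ∈ Finset.range ν₀, c ν * ENNReal.ofReal ((2 : ℝ) ^ (-((ν : ℝ) * β))), ?_,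
    fun ν f => ?_⟩
  · refine ENNReal.add_ne_top.2 ⟨hC, ENNReal.sum_ne_top.2 fun ν _ => ?_⟩
    exact ENNReal.mul_ne_top (hc ν) ENNReal.ofReal_ne_top
  · rcases le_or_gt ν₀ ν with h | h
    · refine (hlarge ν h f).trans ?_
      gcongr
      exact le_self_add
    · refine (hc' ν f).trans ?_
      gcongr
      calc c ν = c ν * ENNReal.ofReal ((2 : ℝ) ^ (-((ν : ℝ) * β))) *
            ENNReal.ofReal ((2 : ℝ) ^ ((ν : ℝ) * β)) := by rw [mul_assoc, h2, mul_one]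
        _ ≤ _ := by
          gcongr
          refine le_add_of_nonneg_of_le zero_le ?_
          exact Finset.single_le_sum
            (f := fun ν : ℕ => c ν * ENNReal.ofReal ((2 : ℝ) ^ (-((ν : ℝ) * β))))
            (fun _ _ => zero_le) (Finset.mem_range.2 h)

theorem lqNorm_mono {ι : Type} (q : ℝ≥0∞) {a b : ι → ℝ≥0∞} (h : ∀ i, a i ≤ b i) :
    lqNorm q a ≤ lqNorm q b := by
  unfold lqNorm
  split_ifs
  · exact iSup_mono h
  · refine ENNReal.rpow_le_rpow (ENNReal.tsum_le_tsum fun i => ?_) (by positivity)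
    exact ENNReal.rpow_le_rpow (h i) ENNReal.toReal_nonneg

theorem lqNorm_mul_const {ι : Type} {q : ℝ≥0∞} (hq : 0 < q) (a : ι → ℝ≥0∞) (x : ℝ≥0∞) :
    lqNorm q (fun i => a i * x) = lqNorm q a * x := by
  unfold lqNorm
  split_ifs with h
  · rw [ENNReal.iSup_mul]
  · have hq0 : 0 < q.toReal := ENNReal.toReal_pos hq.ne' h
    simp only [ENNReal.mul_rpow_of_nonneg _ _ hq0.le, ENNReal.tsum_mul_right]
    rw [ENNReal.mul_rpow_of_nonneg _ _ (by positivity), ← ENNReal.rpow_mul,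
      mul_inv_cancel₀ hq0.ne', ENNReal.rpow_one]

theorem lqNorm_geometric_ne_top {q : ℝ≥0∞} (hq : 0 < q) {ε : ℝ} (hε : 0 < ε) :
    lqNorm q (fun ν : ℕ => ENNReal.ofReal ((2 : ℝ) ^ (-((ν : ℝ) * ε)))) ≠ ∞ := by
  unfold lqNorm
  split_ifs with h
  · refine ne_top_of_le_ne_top ENNReal.one_ne_top (iSup_le fun ν => ?_)
    rw [ENNReal.ofReal_le_one]
    exact Real.rpow_le_one_of_one_le_of_nonpos one_le_two (by
      have : 0 ≤ (ν : ℝ) * ε := by positivity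
      linarith)
  · have hq0 : 0 < q.toReal := ENNReal.toReal_pos hq.ne' h
    refine ENNReal.rpow_ne_top_of_nonneg (by positivity) ?_
    have h1 : ∀ ν : ℕ, ENNReal.ofReal ((2 : ℝ) ^ (-((ν : ℝ) * ε))) ^ q.toReal =
        ENNReal.ofReal ((2 : ℝ) ^ (-(ε * q.toReal))) ^ ν := by
      intro ν
      rw [ENNReal.ofReal_rpow_of_nonneg (by positivity) hq0.le, ← Real.rpow_mul (by norm_num),
        ← ENNReal.ofReal_pow (by positivity), ← Real.rpow_natCast, ← Real.rpow_mul (by norm_num)]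
      congr 2
      ring
    simp only [h1]
    rw [ENNReal.tsum_geometric, ENNReal.inv_ne_top]
    refine (tsub_pos_of_lt ?_).ne'
    rw [ENNReal.ofReal_lt_one]
    refine Real.rpow_lt_one_of_one_lt_of_neg one_lt_two ?_
    have : 0 < ε * q.toReal := by positivity
    linarith

theorem inv_subExp {p : ℝ≥0∞} (hp : 0 < p) : (subExp p)⁻¹ = max 1 (p⁻¹).toReal := by
  unfold subExp
  rw [← ENNReal.toReal_inv]
  rcases le_total p 1 with h | h
  · have h1 : 1 ≤ p⁻¹ := ENNReal.one_le_inv.2 h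
    rw [min_eq_right h, max_eq_right]
    rw [← ENNReal.toReal_one]
    exact ENNReal.toReal_mono (ENNReal.inv_ne_top.2 hp.ne') h1
  · have h1 : p⁻¹ ≤ 1 := ENNReal.inv_le_one.2 h
    rw [min_eq_left h, max_eq_left]
    · simp
    · rw [← ENNReal.toReal_one]
      exact ENNReal.toReal_mono ENNReal.one_ne_top h1

/-- Half the gap in the hypothesis is the rate ε of geometric decay in ν, which makes the weights
ℓ^q summable for every q. -/
theorem exists_besovNorm_le (hd : 0 < d) {Φ φ : 𝓢(Rd d, ℂ)} (h : IsDyadicPair Φ φ)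
    {p q : ℝ≥0∞} (hp : 0 < p) (hq : 0 < q) {α₁ α₂ : ℝ}
    (hα : 2 * α₁ + ((d : ℝ) - 1) * max 1 (p⁻¹).toReal < (d + 1) * α₂) :
    ∃ C : ℝ≥0∞, C ≠ ∞ ∧ ∀ f : 𝓢'(Rd d, ℂ),
      besovNorm Φ φ α₁ p q f ≤ C * shearBesovNorm G α₂ p q f := by
  have hφ : ∀ ξ, 𝓕 φ ξ ≠ 0 → 1 / 2 ≤ ‖ξ‖ ∧ ‖ξ‖ ≤ 2 := fun ξ hξ =>
    h.support_phi (subset_tsupport _ hξ)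
  obtain ⟨C₁, hC₁, h₁⟩ := exists_eLpNorm_conv_le G hp hq α₂ Φ
    (hasCompactSupport_fourier_of_norm_le (R := 2) fun ξ hξ =>
      h.support_Phi (subset_tsupport _ hξ))
  obtain ⟨C₂, hC₂, h₂⟩ := G.exists_eLpNorm_dyadic_le hd hp hq α₂ φ hφ
  set ε : ℝ := ((d + 1) * α₂ - (2 * α₁ + ((d : ℝ) - 1) * max 1 (p⁻¹).toReal)) / 2 with hε
  have hε0 : 0 < ε := by rw [hε]; linarith
  refine ⟨C₁ + lqNorm q (fun ν : ℕ => ENNReal.ofReal ((2 : ℝ) ^ (-((ν : ℝ) * ε)))) * C₂,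
    ENNReal.add_ne_top.2 ⟨hC₁, ENNReal.mul_ne_top (lqNorm_geometric_ne_top hq hε0) hC₂⟩,
    fun f => ?_⟩
  rw [add_mul, mul_assoc, ← lqNorm_mul_const hq]
  refine add_le_add (h₁ f) (lqNorm_mono q fun ν => ?_)
  refine (mul_le_mul' le_rfl (h₂ ν f)).trans_eq ?_
  rw [show ∀ a b c x : ℝ≥0∞, a * (c * b * x) = a * b * (c * x) from fun a b c x => by ring,
    ← ENNReal.ofReal_mul (by positivity), ← Real.rpow_add two_pos]
  congr 3
  rw [hε, div_eq_mul_inv _ (subExp p), inv_subExp hp]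
  ring

end Embedding

end ShearBesov

theorem mainTheorem6 (d : ℕ) (hd : 2 ≤ d)
    (G : ShearBesov.ShearletGenerator d)
    (Φ φ : 𝓢(EuclideanSpace ℝ (Fin d), ℂ)) (hΦφ : ShearBesov.IsDyadicPair Φ φ)
    (p q : ℝ≥0∞) (hp : 0 < p) (hq : 0 < q) (α₁ α₂ s lam : ℝ)
    (hs : s = (max 1 (p⁻¹).toReal - min 1 (q⁻¹).toReal) / 2)
    (hlam : (p ≤ 1 ∧ lam = 0) ∨ (1 < p ∧ (d : ℝ) * (1 - (p⁻¹).toReal) < lam))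
    (hcond : 2 * (d : ℝ) + lam + 2 * (α₁ + s * ((d : ℝ) - 1)) < ((d : ℝ) + 1) * (α₂ + 1)) :
    ShearBesov.shearBesovSpace G α₂ p q ⊆ ShearBesov.besovSpace Φ φ α₁ p q ∧
      ∃ C : ℝ, 0 < C ∧ ∀ f ∈ ShearBesov.shearBesovSpace G α₂ p q,
        ShearBesov.besovNorm Φ φ α₁ p q f ≤
          ENNReal.ofReal C * ShearBesov.shearBesovNorm G α₂ p q f := by
  have hd' : (2 : ℝ) ≤ d := by exact_mod_cast hd
  have hlam0 : 0 ≤ lam := by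
    rcases hlam with ⟨-, rfl⟩ | ⟨h1, h2⟩
    · exact le_rfl
    · have h3 : (p⁻¹).toReal ≤ 1 := by
        rw [← ENNReal.toReal_one]
        exact ENNReal.toReal_mono ENNReal.one_ne_top (ENNReal.inv_le_one.2 h1.le)
      have h4 : 0 ≤ (d : ℝ) * (1 - (p⁻¹).toReal) := mul_nonneg (by linarith) (by linarith)
      linarith
  -- Since min(1, 1/q) ≤ 1, 2s ≥ max(1, 1/p) - 1. Moving d + 1 to the left turns 2d into d - 1, and
  -- λ ≥ 0 is dropped.
  have hα : 2 * α₁ + ((d : ℝ) - 1) * max 1 (p⁻¹).toReal < (d + 1) * α₂ := by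
    have h1 : (max 1 (p⁻¹).toReal - 1) * ((d : ℝ) - 1) ≤ 2 * s * (d - 1) := by
      refine mul_le_mul_of_nonneg_right ?_ (by linarith)
      rw [hs]
      linarith [min_le_left 1 (q⁻¹).toReal]
    linarith
  obtain ⟨C, hC, hle⟩ := ShearBesov.exists_besovNorm_le G (by omega) hΦφ hp hq hα
  -- Adding 1 keeps the real constant positive even if C = 0.
  refine ⟨fun f hf => (hle f).trans_lt (ENNReal.mul_lt_top hC.lt_top hf), C.toReal + 1,
    by positivity, fun f _ => (hle f).trans ?_⟩
  gcongr
  rw [ENNReal.ofReal_add ENNReal.toReal_nonneg zero_le_one, ENNReal.ofReal_toReal hC]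
  exact le_self_add
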